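/- Let $c,\alpha\in\mathbb R$ and $\varepsilon\in\{1,-1\}$ with $\alpha\varepsilon<0$ and $c\alpha<0$, and let $p>0$ be a rational number which in lowest terms has an odd denominator (so that $t^{p+1}$ is defined for all real $t$ through odd roots). Let $\mathscr Z$ be the closure of $C_0^\infty(\mathbb R^2)$ for the norm given by $\|\varphi\|_{\mathscr Z}^2=\|\varphi\|_{L^2}^2+\|\varphi_y\|_{L^2}^2+\|D_x^{1/2}\varphi\|_{L^2}^2$, where $D_x^{1/2}$ is the Fourier multiplier with symbol $|\xi_1|^{1/2}$. A solitary wave is a real-valued function $\varphi\in\mathscr Z$ with $\varphi^{p+1}\in L^1_{\mathrm{loc}}(\mathbb R^2)$ that solves $$-c\varphi+\frac{1}{p+1}\varphi^{p+1}+\alpha\mathscr H\varphi_x+\varepsilon\varphi_{yy}=0$$ on $\mathbb R^2$ in the sense of distributions, where $\mathscr H u(x,y)=\mathrm{p.v.}\,\frac1\pi\int_{\mathbb R}\frac{u(z,y)}{x-z}\,dz$ is the Hilbert transform in $x$. For $k\in\mathbb N$ and $r\in[1,\infty]$ let $H^{(k)}_r$ be the space of all $f\in L^r(\mathbb R^2)$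 whose Bessel derivatives of order $k$ in each of the two variables, $(1-\partial_x^2)^{k/2}f$ and $(1-\partial_y^2)^{k/2}f$, belong to $L^r(\mathbb R^2)$. (1) If $p$ is a positive integer, then every solitary wave $\varphi$ (with $\varphi^{p+1}\in L^2(\mathbb R^2)$ if $p>4$, where the equation is understood in $L^2$) lies in $H^{(k)}_r$ for all $k\in\mathbb N$ and all $r\in[1,\infty]$. (2) If $0<p<4$, then every solitary wave is, after modification on a null set, continuous, belongs to $L^\infty(\mathbb R^2)$ and tends to zero at infinity. -/

import Mathlib

open MeasureTheory Filter Topology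
open scoped ENNReal FourierTransform SchwartzMap ContDiff

namespace BOZK

/-- The plane `ℝ²`; the coordinate `z 0` is the propagation variable `x` and the coordinate `z 1`
is the transverse variable `y`. -/
abbrev Plane : Type := EuclideanSpace ℝ (Fin 2)

/-- The partial derivative of `u` in the `i`-th coordinate. -/
noncomputable def partialD (i : Fin 2) (u : Plane → ℝ) (z : Plane) : ℝ :=
  fderiv ℝ u z (EuclideanSpace.single i 1)

/-- `u` is a test function: smooth with compact support. -/
def IsTest (u : Plane → ℝ) : Prop :=
  ContDiff ℝ ∞ u ∧ HasCompactSupport u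

/-- The Hilbert transform in the variable `x`, as a principal value:
`(H u)(x, y) = lim_{δ → 0+} (1 / π) ∫_{|x - s| > δ} u(s, y) / (x - s) ds`.
It is applied to test functions only, for which the limit exists. -/
noncomputable def hilbertX (u : Plane → ℝ) (z : Plane) : ℝ :=
  limUnder (𝓝[>] (0 : ℝ)) fun δ : ℝ =>
    (1 / Real.pi) * ∫ s in {s : ℝ | δ < |z 0 - s|}, u !₂[s, z 1] / (z 0 - s)

/-- The square of the `Z`-norm, `‖f‖² + ‖f_y‖² + ‖D_x^{1/2} f‖²` (all norms in `L²(ℝ²)`), as an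
extended number. The last two terms are computed on the Fourier side; with the normalization
`∫ exp(-2πi z·ξ) f(z) dz` of the transform, `∂_y` has the symbol `2πi ξ₁` and `D_x^{1/2}` has the
symbol `|2π ξ₀|^{1/2}`. -/
noncomputable def zNormSq (f : Lp ℂ 2 (volume : Measure Plane)) : ℝ≥0∞ :=
  (∫⁻ z, ‖f z‖ₑ ^ 2)
    + (∫⁻ ξ : Plane, ‖2 * Real.pi * ξ 1‖ₑ ^ 2 * ‖(𝓕 f : Lp ℂ 2 (volume : Measure Plane)) ξ‖ₑ ^ 2)
    + ∫⁻ ξ : Plane, ‖2 * Real.pi * ξ 0‖ₑ * ‖(𝓕 f : Lp ℂ 2 (volume : Measure Plane)) ξ‖ₑ ^ 2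

/-- `φ` belongs to the space `Z`, the closure of the test functions for the `Z`-norm. -/
def MemZ (φ : Plane → ℝ) : Prop :=
  ∀ δ : ℝ≥0∞, 0 < δ → ∃ u : Plane → ℝ, IsTest u ∧
    ∃ h : MemLp (fun z => ((φ z - u z : ℝ) : ℂ)) 2 volume, zNormSq (h.toLp _) < δ

/-- The real `n`-th root for odd `n`: `sign(x) |x|^{1/n}`. -/
noncomputable def oddRoot (n : ℕ) (x : ℝ) : ℝ :=
  Real.sign x * |x| ^ (1 / (n : ℝ))

/-- The real power `x ^ q = (x^{1/m})^k` for a rational exponent `q = k / m` in lowest terms with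
odd denominator `m`; it is defined for negative `x` too. -/
noncomputable def ratPow (q : ℚ) (x : ℝ) : ℝ :=
  oddRoot q.den x ^ q.num

/-- `φ` is a solitary wave: it lies in `Z` and solves
`-c φ + φ^{p+1} / (p+1) + α H φ_x + ε φ_yy = 0` in the sense of distributions. The operator
`H ∂_x` is symmetric, so that `⟨H φ_x, v⟩ = ∫ φ (H v_x)`. -/
structure IsSolitaryWave (c α ε : ℝ) (p : ℚ) (φ : Plane → ℝ) : Prop where
  memZ : MemZ φ
  locallyIntegrable : LocallyIntegrable (fun z => ratPow (p + 1) (φ z)) volume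
  weak : ∀ v : Plane → ℝ, IsTest v →
    -c * (∫ z, φ z * v z) + 1 / ((p : ℝ) + 1) * (∫ z, ratPow (p + 1) (φ z) * v z)
      + α * (∫ z, φ z * hilbertX (partialD 0 v) z)
      + ε * (∫ z, φ z * partialD 1 (partialD 1 v) z) = 0

/-- The Bessel derivative of order `s` in the `i`-th coordinate, `(1 - ∂_i²)^{s/2} v`, of a
Schwartz function: the Fourier multiplier with symbol `(1 + (2π ξ_i)²)^{s/2}`. -/
noncomputable def besselD (i : Fin 2) (s : ℝ) (v : 𝓢(Plane, ℂ)) : Plane → ℂ :=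
  𝓕⁻ fun ξ : Plane => (((1 + (2 * Real.pi * ξ i) ^ 2) ^ (s / 2) : ℝ) : ℂ) * 𝓕 (v : Plane → ℂ) ξ

/-- `g` is the Bessel derivative of order `s` of `f` in the `i`-th coordinate, in the sense of
tempered distributions (the operator is symmetric for the bilinear pairing). -/
def HasBesselD (i : Fin 2) (s : ℝ) (f g : Plane → ℝ) : Prop :=
  ∀ v : 𝓢(Plane, ℂ), ∫ z, (f z : ℂ) * besselD i s v z = ∫ z, (g z : ℂ) * v z

/-- The Sobolev-Liouville space `H_r^{(s₁,s₂)}(ℝ²)`, here for all `r ∈ [1, ∞]`: functions in `L^r`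
whose Bessel derivative of order `s i` in the `i`-th coordinate is in `L^r`, for both `i`. -/
def MemSobolevLiouville (s : Fin 2 → ℝ) (r : ℝ≥0∞) (f : Plane → ℝ) : Prop :=
  MemLp f r volume ∧ ∀ i : Fin 2, ∃ g : Plane → ℝ, MemLp g r volume ∧ HasBesselD i (s i) f g

end BOZK

namespace BOZK

/-! Put a(ξ) = |c| + |α| |2πξ₀| + (2πξ₁)². The sign conditions force c and ε to have the same sign
and α the opposite one, and `H ∂_x` has the symbol |2πξ₀| (`IsTest.hilbertX_partialD`).
Multiplication by ε therefore turns the equation into the elliptic equation a(D)φ = κ φ^{p+1} with κ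
= ε/(p+1) (`IsSolitaryWave.exists_weak_fourier`). The set {a ≤ M} has measure of order at most
M^{3/2}, so 3/2 plays the role of a dimension: a(D)^{-s/2} maps L² to L^q with 1/q = 1/2 − s/3 for 0
< s < 3/2 (`exists_lintegral_smoothing_le`), and 1/a is in L² (`memLp_inv_symbol`). The energy space
is the case s = 1 and embeds in L⁶.

The main point is that φ^{p+1} is in L² for p ≤ 4. The power p = 4 is critical, since |φ|⁴ is then
only known to be in L^{3/2}, and a plain bootstrap gains nothing. Instead φ^{p+1} is split as Vφ +
ρ, where V lives on {|φ| > R} and has small L^{3/2} norm, and ρ is in L². For φ = a(D)^{-1/2}h this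
is a fixed point equation for h with a small operator. The same potential is small on a slightly
smoother scale too, and uniqueness of the fixed point (`exists_eq_of_two_scales`) shows that h has
the extra smoothness, which puts φ in L¹⁰ (`lintegral_ten_lt_top`). As 2(p+1) ≤ 10, the nonlinearity
is in L².

Then φ̂ = κ a⁻¹ (φ^{p+1})^ is a product of two L² functions, hence integrable, and Riemann–Lebesgue
gives continuity, boundedness and decay of φ.

For integer p, u = φ̂ solves u = κ a⁻¹ u^{*(p+1)}. Convolution preserves weighted L¹ ∩ L^∞ and a⁻¹
gains one weight, so u decays faster than every power. It need not be smooth, because a is not, so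
integrability of the derivatives of φ needs another argument: derivatives of φ · φ^p are sums of
products of two L² functions, hence integrable, and a⁻¹ and the negative Bessel powers are Fourier
transforms of finite measures, so they preserve integrability (`integrable_fourierInv_average_mul`).
Functions in L¹ ∩ L^∞ are in every L^r. -/

/-- The Hilbert space `L²(ℝ²; ℂ)`. -/
abbrev L2 : Type := Lp ℂ 2 (volume : Measure Plane)

/-! ### Fourier transforms of integrable and of square integrable functions -/

theorem integral_fourier_mul_eq {f g : Plane → ℂ} (hf : Integrable f) (hg : Integrable g) :
    ∫ ξ, 𝓕 f ξ * g ξ = ∫ x, f x * 𝓕 g x := by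
  have := VectorFourier.integral_fourierIntegral_smul_eq_flip (e := Real.fourierChar)
    (L := innerₗ Plane) (μ := volume) (ν := volume) Real.continuous_fourierChar
    (by exact continuous_inner) hf hg
  rw [flip_innerₗ] at this
  simp only [smul_eq_mul] at this
  exact this

theorem integral_fourierInv_mul_eq {f g : Plane → ℂ} (hf : Integrable f) (hg : Integrable g) :
    ∫ ξ, 𝓕⁻ f ξ * g ξ = ∫ x, f x * 𝓕⁻ g x := by
  have h1 : ∀ ξ, 𝓕⁻ f ξ = 𝓕 (fun x => f (-x)) ξ := fun ξ => by
    rw [Real.fourierInv_eq_fourier_comp_neg]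
  simp_rw [h1]
  rw [integral_fourier_mul_eq hf.comp_neg hg, ← integral_neg_eq_self]
  simp [Real.fourierInv_eq_fourier_neg]

theorem ae_eq_zero_of_integral_schwartz {G : Plane → ℂ} (hG : LocallyIntegrable G)
    (h : ∀ ψ : 𝓢(Plane, ℂ), ∫ z, G z * ψ z = 0) : G =ᵐ[volume] 0 := by
  apply ae_eq_zero_of_integral_contDiff_smul_eq_zero hG
  intro g g_smooth g_cpt
  have hg₁ : HasCompactSupport (Complex.ofRealCLM ∘ g) := g_cpt.comp_left rfl
  have hg₂ : ContDiff ℝ ∞ (Complex.ofRealCLM ∘ g) := by fun_prop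
  rw [← h (hg₁.toSchwartzMap hg₂)]
  apply integral_congr_ae
  refine Eventually.of_forall fun z => ?_
  simp [mul_comm]

/-- An integrable function is determined by its Fourier transform. -/
theorem ae_eq_zero_of_fourier_eq_zero {G : Plane → ℂ} (hG : Integrable G)
    (h : ∀ ξ, 𝓕 G ξ = 0) : G =ᵐ[volume] 0 := by
  apply ae_eq_zero_of_integral_schwartz hG.locallyIntegrable
  intro ψ
  have : (ψ : Plane → ℂ) = 𝓕 ((𝓕⁻ ψ : 𝓢(Plane, ℂ)) : Plane → ℂ) := by
    rw [← SchwartzMap.fourier_coe, FourierTransform.fourier_fourierInv_eq]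
  rw [this, ← integral_fourier_mul_eq hG (SchwartzMap.integrable _)]
  simp [h]

/-- Both transforms have the same pairing with every Schwartz function: one by its agreement with
the transform of tempered distributions, the other by Fubini. -/
theorem lp_fourier_ae_eq {f : Plane → ℂ} (h1 : Integrable f) (h2 : MemLp f 2) :
    (𝓕 (h2.toLp f) : L2) =ᵐ[volume] 𝓕 f := by
  have hc : Continuous (𝓕 f) :=
    VectorFourier.fourierIntegral_continuous Real.continuous_fourierChar
      (by exact continuous_inner) h1
  have key : (fun ξ => (𝓕 (h2.toLp f) : L2) ξ - 𝓕 f ξ) =ᵐ[volume] 0 := by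
    apply ae_eq_zero_of_integral_schwartz
    · exact ((Lp.memLp _).locallyIntegrable (by norm_num)).sub hc.locallyIntegrable
    intro ψ
    have e1 : ∫ z, (𝓕 (h2.toLp f) : L2) z * ψ z = ∫ z, f z * 𝓕 (ψ : Plane → ℂ) z := by
      have := congrArg (fun T : 𝓢'(Plane, ℂ) => T ψ) (Lp.fourier_toTemperedDistribution_eq (h2.toLp f))
      simp only [TemperedDistribution.fourier_apply, Lp.toTemperedDistribution_apply] at this
      rw [SchwartzMap.fourier_coe] at this
      simp only [smul_eq_mul] at this
      calc _ = ∫ z, ψ z * (𝓕 (h2.toLp f) : L2) z := by simp_rw [mul_comm]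
        _ = _ := this.symm
        _ = _ := by
          apply integral_congr_ae
          filter_upwards [h2.coeFn_toLp] with z hz
          rw [hz, mul_comm]
    have i1 : Integrable fun z => (𝓕 (h2.toLp f) : L2) z * ψ z :=
      (Lp.memLp (𝓕 (h2.toLp f) : L2)).integrable_mul (ψ.memLp 2)
    have i2 : Integrable fun z => 𝓕 f z * ψ z := by
      refine (ψ.integrable).bdd_mul (c := ∫ v, ‖f v‖) hc.aestronglyMeasurable ?_
      exact Eventually.of_forall fun z => VectorFourier.norm_fourierIntegral_le_integral_norm _ _ _ _ _
    simp_rw [sub_mul]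
    rw [integral_sub i1 i2, e1, integral_fourier_mul_eq h1 ψ.integrable, sub_self]
  filter_upwards [key] with z hz
  simpa [sub_eq_zero] using hz

theorem continuous_fourier {f : Plane → ℂ} (h1 : Integrable f) : Continuous (𝓕 f) :=
  VectorFourier.fourierIntegral_continuous Real.continuous_fourierChar
    (by exact continuous_inner) h1

theorem norm_fourier_le (f : Plane → ℂ) (ξ : Plane) : ‖𝓕 f ξ‖ ≤ ∫ v, ‖f v‖ :=
  VectorFourier.norm_fourierIntegral_le_integral_norm _ _ _ _ _

theorem continuous_fourierInv {f : Plane → ℂ} (h1 : Integrable f) : Continuous (𝓕⁻ f) := by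
  rw [Real.fourierInv_eq_fourier_comp_neg]
  exact continuous_fourier h1.comp_neg

theorem norm_fourierInv_le (f : Plane → ℂ) (ξ : Plane) : ‖𝓕⁻ f ξ‖ ≤ ∫ v, ‖f v‖ := by
  rw [Real.fourierInv_eq_fourier_comp_neg]
  refine (norm_fourier_le _ _).trans_eq ?_
  rw [← integral_neg_eq_self]; simp

theorem lp_fourierInv_ae_eq {f : Plane → ℂ} (h1 : Integrable f) (h2 : MemLp f 2) :
    (𝓕⁻ (h2.toLp f) : L2) =ᵐ[volume] 𝓕⁻ f := by
  have hc := continuous_fourierInv h1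
  have key : (fun ξ => (𝓕⁻ (h2.toLp f) : L2) ξ - 𝓕⁻ f ξ) =ᵐ[volume] 0 := by
    apply ae_eq_zero_of_integral_schwartz
    · exact ((Lp.memLp _).locallyIntegrable (by norm_num)).sub hc.locallyIntegrable
    intro ψ
    have e1 : ∫ z, (𝓕⁻ (h2.toLp f) : L2) z * ψ z = ∫ z, f z * 𝓕⁻ (ψ : Plane → ℂ) z := by
      have := congrArg (fun T : 𝓢'(Plane, ℂ) => T ψ)
        (Lp.fourierInv_toTemperedDistribution_eq (h2.toLp f))
      simp only [TemperedDistribution.fourierInv_apply, Lp.toTemperedDistribution_apply] at this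
      rw [SchwartzMap.fourierInv_coe] at this
      simp only [smul_eq_mul] at this
      calc _ = ∫ z, ψ z * (𝓕⁻ (h2.toLp f) : L2) z := by simp_rw [mul_comm]
        _ = _ := this.symm
        _ = _ := by
          apply integral_congr_ae
          filter_upwards [h2.coeFn_toLp] with z hz
          rw [hz, mul_comm]
    have i1 : Integrable fun z => (𝓕⁻ (h2.toLp f) : L2) z * ψ z :=
      (Lp.memLp (𝓕⁻ (h2.toLp f) : L2)).integrable_mul (ψ.memLp 2)
    have i2 : Integrable fun z => 𝓕⁻ f z * ψ z :=
      (ψ.integrable).bdd_mul (c := ∫ v, ‖f v‖) hc.aestronglyMeasurable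
        (Eventually.of_forall fun z => norm_fourierInv_le _ _)
    simp_rw [sub_mul]
    rw [integral_sub i1 i2, e1, integral_fourierInv_mul_eq h1 ψ.integrable, sub_self]
  filter_upwards [key] with z hz
  simpa [sub_eq_zero] using hz

/-! ### Transforms of real test functions and Parseval -/

/-- A real test function, seen as a complex Schwartz function. -/
noncomputable def IsTest.schwartz {v : Plane → ℝ} (hv : IsTest v) : 𝓢(Plane, ℂ) :=
  HasCompactSupport.toSchwartzMap (f := Complex.ofRealCLM ∘ v) (hv.2.comp_left rfl)
    (Complex.ofRealCLM.contDiff.comp hv.1)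

theorem IsTest.schwartz_apply {v : Plane → ℝ} (hv : IsTest v) (z : Plane) :
    hv.schwartz z = (v z : ℂ) := rfl

theorem IsTest.comp_add {v : Plane → ℝ} (hv : IsTest v) (τ : Plane) :
    IsTest fun z => v (z + τ) :=
  ⟨hv.1.comp (contDiff_id.add contDiff_const),
    hv.2.comp_homeomorph (Homeomorph.addRight τ)⟩

theorem IsTest.comp_smul {v : Plane → ℝ} (hv : IsTest v) {n : ℝ} (hn : n ≠ 0) :
    IsTest fun z => v (n • z) :=
  ⟨hv.1.comp (contDiff_const_smul n), hv.2.comp_smul hn⟩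

theorem exists_isTest_integral_pos : ∃ v : Plane → ℝ, IsTest v ∧ 0 < ∫ z, v z := by
  let b : ContDiffBump (0 : Plane) := ⟨1, 2, by norm_num, by norm_num⟩
  exact ⟨b, ⟨b.contDiff, b.hasCompactSupport⟩, b.integral_pos⟩

/-- The Fourier transform of a real test function, as a function. -/
noncomputable def ftReal (v : Plane → ℝ) : Plane → ℂ := 𝓕 fun z => (v z : ℂ)

theorem IsTest.ftReal_eq {v : Plane → ℝ} (hv : IsTest v) :
    ftReal v = (𝓕 hv.schwartz : 𝓢(Plane, ℂ)) := by
  rw [SchwartzMap.fourier_coe]; rfl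

theorem ftReal_comp_add (v : Plane → ℝ) (τ ξ : Plane) :
    ftReal (fun z => v (z + τ)) ξ = Real.fourierChar (inner ℝ τ ξ) • ftReal v ξ := by
  have := VectorFourier.fourierIntegral_comp_add_right Real.fourierChar volume (innerₗ Plane)
    (fun z => (v z : ℂ)) τ
  exact congrFun this ξ

theorem ftReal_comp_smul (v : Plane → ℝ) {n : ℝ} (hn : n ≠ 0) (ξ : Plane) :
    ftReal (fun z => v (n • z)) ξ = |(n ^ Module.finrank ℝ Plane)⁻¹| • ftReal v (n⁻¹ • ξ) := by
  simp only [ftReal, Real.fourier_eq]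
  rw [← Measure.integral_comp_smul]
  congr 1; ext z
  congr 3
  rw [inner_smul_left, inner_smul_right]
  simp [hn]

/-- A function all of whose pairings with the transforms of real test functions vanish is zero:
the pairing with translates is a Fourier transform. -/
theorem ae_eq_zero_of_integral_ftReal {G : Plane → ℂ}
    (hi : ∀ v, IsTest v → Integrable fun ξ => G ξ * ftReal v ξ)
    (h0 : ∀ v, IsTest v → ∫ ξ, G ξ * ftReal v ξ = 0) : G =ᵐ[volume] 0 := by
  have key : ∀ v, IsTest v → (fun ξ => G ξ * ftReal v ξ) =ᵐ[volume] 0 := by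
    intro v hv
    apply ae_eq_zero_of_fourier_eq_zero (hi v hv)
    intro τ
    rw [← h0 _ (hv.comp_add (-τ)), Real.fourier_eq]
    congr 1; ext ξ
    rw [ftReal_comp_add]
    simp only [Circle.smul_def, smul_eq_mul, inner_neg_left, real_inner_comm]
    ring
  -- At ξ the transform of the dilate ρ((n+1)·) is a nonzero multiple of ρ̂(ξ/(n+1)), which tends to
  -- ∫ρ ≠ 0. So countably many dilates have no common zero, and countability allows one null set for
  -- all of them.
  obtain ⟨ρ, hρ, hpos⟩ := exists_isTest_integral_pos
  have hall : ∀ᵐ ξ, ∀ n : ℕ, G ξ * ftReal (fun z => ρ ((n + 1 : ℝ) • z)) ξ = 0 := by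
    rw [ae_all_iff]
    intro n
    exact key _ (hρ.comp_smul (by positivity))
  filter_upwards [hall] with ξ hξ
  have hc : Continuous (ftReal ρ) := by rw [hρ.ftReal_eq]; exact SchwartzMap.continuous _
  have h0' : ftReal ρ 0 ≠ 0 := by
    have : ftReal ρ 0 = ((∫ z, ρ z : ℝ) : ℂ) := by
      simp only [ftReal, Real.fourier_eq, inner_zero_right, neg_zero, AddChar.map_zero_eq_one, one_smul]
      exact integral_ofReal
    rw [this]; exact_mod_cast hpos.ne'
  have ht : Tendsto (fun n : ℕ => ftReal ρ (((n : ℝ) + 1)⁻¹ • ξ)) atTop (𝓝 (ftReal ρ 0)) := by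
    apply (hc.tendsto 0).comp
    have : Tendsto (fun n : ℕ => ((n : ℝ) + 1)⁻¹) atTop (𝓝 0) := by
      simpa using tendsto_one_div_add_atTop_nhds_zero_nat (𝕜 := ℝ)
    simpa using this.smul_const ξ
  obtain ⟨n, hn⟩ := (ht.eventually_ne h0').exists
  have := hξ n
  rw [ftReal_comp_smul _ (by positivity)] at this
  rcases mul_eq_zero.1 this with h | h
  · exact h
  · exfalso
    have h2 : |(((n : ℝ) + 1) ^ Module.finrank ℝ Plane)⁻¹| ≠ 0 := by positivity
    exact (smul_ne_zero h2 hn) h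

/-- Parseval for a real function in `L²` and the inverse transform of a function in `L¹ ∩ L²`. -/
theorem integral_mul_fourierInv {φ : Plane → ℝ} (hφ : MemLp (fun z => (φ z : ℂ)) 2)
    {M : Plane → ℂ} (h1 : Integrable M) (h2 : MemLp M 2) :
    ∫ z, (φ z : ℂ) * 𝓕⁻ M z = ∫ ξ, starRingEnd ℂ ((𝓕 (hφ.toLp _) : L2) ξ) * M ξ := by
  have h := Lp.inner_fourier_eq (hφ.toLp _) (𝓕⁻ (h2.toLp M) : L2)
  rw [FourierTransform.fourier_fourierInv_eq, L2.inner_def, L2.inner_def] at h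
  have e1 : ∫ z, (φ z : ℂ) * 𝓕⁻ M z
      = ∫ a, inner ℂ ((hφ.toLp _ : L2) a) ((𝓕⁻ (h2.toLp M) : L2) a) := by
    apply integral_congr_ae
    filter_upwards [hφ.coeFn_toLp, lp_fourierInv_ae_eq h1 h2] with z h3 h4
    rw [h3, h4]; simp [mul_comm]
  rw [e1, ← h]
  apply integral_congr_ae
  filter_upwards [h2.coeFn_toLp] with z h3
  rw [h3]; simp [mul_comm]

/-! ### The Hilbert transform as a Fourier multiplier -/

open scoped LineDeriv

theorem integral_exp_neg_mul_cos {ε : ℝ} (hε : 0 < ε) (b : ℝ) :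
    ∫ t in Set.Ioi (0 : ℝ), Real.exp (-ε * t) * Real.cos (b * t) = ε / (ε ^ 2 + b ^ 2) := by
  have ha : ((-ε : ℝ) + b * Complex.I : ℂ).re < 0 := by simpa using hε
  have h1 := integral_exp_mul_complex_Ioi ha 0
  have h2 := integrableOn_exp_mul_complex_Ioi ha 0
  have h3 := congrArg Complex.re h1
  have h4 : (∫ t in Set.Ioi (0 : ℝ), Complex.exp (((-ε : ℝ) + b * Complex.I : ℂ) * t)).re
      = ∫ t in Set.Ioi (0 : ℝ), (Complex.exp (((-ε : ℝ) + b * Complex.I : ℂ) * t)).re :=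
    (integral_re (𝕜 := ℂ) h2).symm
  rw [h4] at h3
  calc _ = ∫ t in Set.Ioi (0 : ℝ), (Complex.exp (((-ε : ℝ) + b * Complex.I : ℂ) * t)).re := by
        congr 1; ext t
        rw [Complex.exp_re]; simp
    _ = _ := h3
    _ = _ := by
        simp only [Complex.ofReal_zero, mul_zero, Complex.exp_zero, Complex.div_re, Complex.neg_re,
          Complex.one_re, Complex.add_re, Complex.ofReal_re, Complex.mul_re, Complex.I_re,
          Complex.ofReal_im, Complex.I_im, Complex.normSq_apply, Complex.add_im, Complex.mul_im,
          Complex.neg_im, Complex.one_im]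
        have : ε ^ 2 + b ^ 2 ≠ 0 := by positivity
        have h5 : ε * ε + b * b ≠ 0 := by simpa [sq] using this
        simp
        field_simp

theorem abs_sin_mul_div_le (b t : ℝ) (ht : 0 < t) : |Real.sin (b * t) / t| ≤ |b| := by
  rw [abs_div, abs_of_pos ht, div_le_iff₀ ht]
  calc |Real.sin (b * t)| ≤ |b * t| := Real.abs_sin_le_abs
    _ = _ := by rw [abs_mul, abs_of_pos ht]

/-- Differentiation in b under the integral gives the integral of e^{−εt} cos(bt), which is the
derivative of the arctangent; both sides vanish at b = 0. -/
theorem integral_exp_neg_mul_sin_div {ε : ℝ} (hε : 0 < ε) (b : ℝ) :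
    ∫ t in Set.Ioi (0 : ℝ), Real.exp (-ε * t) * (Real.sin (b * t) / t) = Real.arctan (b / ε) := by
  set f : ℝ → ℝ := fun b => ∫ t in Set.Ioi (0 : ℝ), Real.exp (-ε * t) * (Real.sin (b * t) / t)
  have hd : ∀ b, HasDerivAt f (ε / (ε ^ 2 + b ^ 2)) b := by
    intro b
    rw [← integral_exp_neg_mul_cos hε b]
    refine (hasDerivAt_integral_of_dominated_loc_of_deriv_le (μ := volume.restrict (Set.Ioi 0))
      (F := fun b t => Real.exp (-ε * t) * (Real.sin (b * t) / t))
      (F' := fun b t => Real.exp (-ε * t) * Real.cos (b * t))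
      (bound := fun t => Real.exp (-ε * t)) univ_mem
      (Eventually.of_forall fun b => ?_) ?_ ?_ ?_ (exp_neg_integrableOn_Ioi 0 hε) ?_).2
    · exact Measurable.aestronglyMeasurable (by fun_prop)
    · refine ((exp_neg_integrableOn_Ioi 0 hε).mul_const |b|).mono'
        (Measurable.aestronglyMeasurable (by fun_prop)) ?_
      filter_upwards [ae_restrict_mem measurableSet_Ioi] with t ht
      rw [norm_mul, Real.norm_eq_abs, Real.norm_eq_abs, abs_of_pos (Real.exp_pos _)]
      exact mul_le_mul_of_nonneg_left (abs_sin_mul_div_le b t ht) (Real.exp_pos _).le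
    · exact Measurable.aestronglyMeasurable (by fun_prop)
    · refine Eventually.of_forall fun t b _ => ?_
      rw [norm_mul, Real.norm_eq_abs, Real.norm_eq_abs, abs_of_pos (Real.exp_pos _)]
      exact mul_le_of_le_one_right (Real.exp_pos _).le (Real.abs_cos_le_one _)
    · filter_upwards [ae_restrict_mem measurableSet_Ioi] with t ht b _
      have ht' : t ≠ 0 := ne_of_gt ht
      have := (((hasDerivAt_id b).mul_const t).sin.div_const t).const_mul (Real.exp (-ε * t))
      refine this.congr_deriv ?_
      simp only [id_eq]; field_simp
  have hd2 : ∀ b, HasDerivAt (fun b => Real.arctan (b / ε)) (ε / (ε ^ 2 + b ^ 2)) b := by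
    intro b
    have := ((hasDerivAt_id b).div_const ε).arctan
    refine this.congr_deriv ?_
    have : ε ^ 2 + b ^ 2 ≠ 0 := by positivity
    simp only [id_eq]; field_simp
  have hconst := is_const_of_deriv_eq_zero (f := fun b => f b - Real.arctan (b / ε))
    (fun b => ((hd b).sub (hd2 b)).differentiableAt)
    (fun b => (((hd b).sub (hd2 b)).deriv).trans (sub_self _)) b 0
  have h0 : f 0 = 0 := by simp [f]
  simp only [h0, zero_div, Real.arctan_zero, sub_zero] at hconst
  linarith

theorem IsTest.partialD {v : Plane → ℝ} (hv : IsTest v) (i : Fin 2) : IsTest (partialD i v) := by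
  refine ⟨?_, ?_⟩
  · exact (hv.1.fderiv_right (by simp)).clm_apply contDiff_const
  · exact hv.2.fderiv_apply ℝ _

theorem IsTest.schwartz_partialD {v : Plane → ℝ} (hv : IsTest v) (i : Fin 2) :
    (hv.partialD i).schwartz = ∂_{EuclideanSpace.single i (1 : ℝ)} hv.schwartz := by
  ext z
  rw [SchwartzMap.lineDerivOp_apply_eq_fderiv, IsTest.schwartz_apply]
  have : (hv.schwartz : Plane → ℂ) = Complex.ofRealCLM ∘ v := rfl
  have hd : DifferentiableAt ℝ v z := (hv.1.differentiable (by simp)).differentiableAt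
  rw [this, fderiv_comp _ Complex.ofRealCLM.differentiableAt hd]
  simp [BOZK.partialD]

theorem IsTest.ftReal_partialD {v : Plane → ℝ} (hv : IsTest v) (i : Fin 2) (ξ : Plane) :
    ftReal (BOZK.partialD i v) ξ = 2 * Real.pi * Complex.I * ξ i * ftReal v ξ := by
  rw [(hv.partialD i).ftReal_eq, hv.ftReal_eq, hv.schwartz_partialD,
    SchwartzMap.fourier_lineDerivOp_eq, smul_apply, SchwartzMap.smulLeftCLM_apply_apply
      (by fun_prop)]
  have : inner ℝ ξ (EuclideanSpace.single i (1 : ℝ)) = ξ i := by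
    simp [EuclideanSpace.inner_single_right]
  rw [this]
  simp [mul_assoc]

theorem IsTest.integrable_pow_mul_ftReal {v : Plane → ℝ} (hv : IsTest v) (k : ℕ) :
    Integrable fun ξ => ‖ξ‖ ^ k * ‖ftReal v ξ‖ := by
  rw [hv.ftReal_eq]; exact SchwartzMap.integrable_pow_mul volume _ k

theorem IsTest.continuous_ftReal {v : Plane → ℝ} (hv : IsTest v) : Continuous (ftReal v) := by
  rw [hv.ftReal_eq]; exact SchwartzMap.continuous _

theorem IsTest.fourierInv_ftReal {v : Plane → ℝ} (hv : IsTest v) (z : Plane) :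
    𝓕⁻ (ftReal v) z = v z := by
  rw [hv.ftReal_eq, ← SchwartzMap.fourierInv_coe, FourierTransform.fourierInv_fourier_eq]; rfl

theorem abs_coord_le (ξ : Plane) (i : Fin 2) : |ξ i| ≤ ‖ξ‖ := by
  simpa using PiLp.norm_apply_le ξ i

/-- The odd difference of a test function in `x` over the distance. -/
noncomputable def oddQuot (w : Plane → ℝ) (z : Plane) (t : ℝ) : ℝ :=
  (w !₂[z 0 - t, z 1] - w !₂[z 0 + t, z 1]) / t

theorem IsTest.slice {w : Plane → ℝ} (hw : IsTest w) (y : ℝ) :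
    ContDiff ℝ ∞ (fun t : ℝ => w !₂[t, y]) ∧ HasCompactSupport (fun t : ℝ => w !₂[t, y]) := by
  constructor
  · refine hw.1.comp ?_
    rw [contDiff_euclidean]
    intro i; fin_cases i <;> simp <;> fun_prop
  · obtain ⟨R, hR⟩ := hw.2.isCompact.isBounded.subset_closedBall 0
    refine HasCompactSupport.intro (isCompact_closedBall (0 : ℝ) R) fun t ht => ?_
    by_contra hne
    have := hR (subset_tsupport _ hne)
    apply ht
    rw [mem_closedBall_zero_iff] at this ⊢
    refine le_trans ?_ this
    simpa using PiLp.norm_apply_le !₂[t, y] 0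

/-- The Lipschitz bound controls the quotient near t = 0, and compact support makes it vanish for
large t. This is why the principal value is an absolutely convergent integral. -/
theorem IsTest.integrableOn_oddQuot {w : Plane → ℝ} (hw : IsTest w) (z : Plane) :
    IntegrableOn (oddQuot w z) (Set.Ioi 0) := by
  obtain ⟨hl, hcs⟩ := hw.slice (z 1)
  obtain ⟨C, hC⟩ := (hl.of_le (by simp)).lipschitzWith_of_hasCompactSupport hcs (n := 1) (by simp)
  obtain ⟨R, hR⟩ := hcs.isCompact.isBounded.subset_closedBall 0
  have hbound : ∀ t : ℝ, 0 < t → ‖oddQuot w z t‖ ≤ 2 * C := by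
    intro t ht
    have := hC.dist_le_mul (z 0 - t) (z 0 + t)
    rw [oddQuot, norm_div, Real.norm_eq_abs t, abs_of_pos ht, div_le_iff₀ ht]
    rw [Real.dist_eq, Real.dist_eq] at this
    refine this.trans_eq ?_
    rw [show z 0 - t - (z 0 + t) = -(2 * t) by ring, abs_neg, abs_of_pos (by positivity)]; ring
  have hzero : ∀ t : ℝ, |z 0| + R < t → oddQuot w z t = 0 := by
    intro t ht
    have h0 : ∀ s : ℝ, R < |s| → w !₂[s, z 1] = 0 := by
      intro s hs
      by_contra hne
      have := hR (subset_tsupport _ hne)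
      rw [mem_closedBall_zero_iff, Real.norm_eq_abs] at this
      linarith
    rw [oddQuot, h0, h0]
    · simp
    · have := le_abs_self (z 0 + t); have := neg_abs_le (z 0); linarith
    · have := neg_le_abs (z 0 - t); have := le_abs_self (z 0); linarith
  have hm : Measurable (oddQuot w z) := by
    unfold oddQuot
    have hc := hl.continuous
    have h1 : Continuous fun t : ℝ => w !₂[z 0 - t, z 1] := hc.comp (continuous_const.sub continuous_id)
    have h2 : Continuous fun t : ℝ => w !₂[z 0 + t, z 1] := hc.comp (continuous_const.add continuous_id)
    exact (h1.sub h2).measurable.div measurable_id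
  have hi : IntegrableOn (oddQuot w z) (Set.Ioc 0 (|z 0| + R)) := by
    refine Measure.integrableOn_of_bounded (M := 2 * C) (by simp) hm.aestronglyMeasurable ?_
    filter_upwards [ae_restrict_mem measurableSet_Ioc] with t ht
    exact hbound t ht.1
  refine (integrableOn_congr_fun (f := (Set.Ioc 0 (|z 0| + R)).indicator (oddQuot w z)) ?_ measurableSet_Ioi).1
    (hi.integrable_indicator measurableSet_Ioc).integrableOn
  intro t ht
  by_cases h : t ≤ |z 0| + R
  · rw [Set.indicator_of_mem (show t ∈ Set.Ioc 0 (|z 0| + R) from ⟨ht, h⟩)]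
  · rw [Set.indicator_of_notMem (fun h' => h h'.2), hzero t (not_le.1 h)]

/-- The half-lines s < x − δ and s > x + δ are folded onto t > δ; the kernel is odd, so the two
values of the function are subtracted. -/
theorem IsTest.integral_truncated {w : Plane → ℝ} (hw : IsTest w) (z : Plane) {δ : ℝ} (hδ : 0 < δ) :
    ∫ s in {s : ℝ | δ < |z 0 - s|}, w !₂[s, z 1] / (z 0 - s) = ∫ t in Set.Ioi δ, oddQuot w z t := by
  obtain ⟨hl, hcs⟩ := hw.slice (z 1)
  have hint : Integrable (fun t : ℝ => w !₂[t, z 1]) := hl.continuous.integrable_of_hasCompactSupport hcs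
  have hS : MeasurableSet {t : ℝ | δ < |t|} := measurableSet_lt measurable_const (by fun_prop)
  have hS' : MeasurableSet {s : ℝ | δ < |z 0 - s|} := measurableSet_lt measurable_const (by fun_prop)
  have i1 : IntegrableOn (fun t : ℝ => w !₂[z 0 - t, z 1] / t) (Set.Ioi δ) := by
    refine ((hint.comp_sub_left (z 0)).norm.div_const δ).integrableOn.mono'
      (((hl.continuous.comp (continuous_const.sub continuous_id)).measurable.div
        measurable_id).aestronglyMeasurable) ?_
    filter_upwards [ae_restrict_mem measurableSet_Ioi] with t ht
    have ht' : δ < t := ht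
    rw [norm_div, Real.norm_eq_abs t, abs_of_pos (hδ.trans ht')]
    gcongr
  have i2 : IntegrableOn (fun t : ℝ => w !₂[z 0 + t, z 1] / t) (Set.Ioi δ) := by
    refine ((hint.comp_add_left (z 0)).norm.div_const δ).integrableOn.mono'
      (((hl.continuous.comp (continuous_const.add continuous_id)).measurable.div
        measurable_id).aestronglyMeasurable) ?_
    filter_upwards [ae_restrict_mem measurableSet_Ioi] with t ht
    have ht' : δ < t := ht
    rw [norm_div, Real.norm_eq_abs t, abs_of_pos (hδ.trans ht')]
    gcongr
  have i3 : IntegrableOn (fun t : ℝ => w !₂[z 0 - t, z 1] / t) (Set.Iio (-δ)) := by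
    rw [← (Measure.measurePreserving_neg (volume : Measure ℝ)).integrableOn_comp_preimage
      (MeasurableEquiv.neg ℝ).measurableEmbedding]
    have : (Neg.neg ⁻¹' Set.Iio (-δ) : Set ℝ) = Set.Ioi δ := by ext t; simp
    rw [this]
    refine i2.neg.congr_fun (fun t _ => ?_) measurableSet_Ioi
    simp [div_neg]
  calc _ = ∫ s, {t : ℝ | δ < |t|}.indicator (fun t => w !₂[z 0 - t, z 1] / t) (z 0 - s) := by
        rw [← integral_indicator hS']
        congr 1; ext s
        by_cases h : δ < |z 0 - s|
        · rw [Set.indicator_of_mem (by exact h), Set.indicator_of_mem (by exact h)]; simp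
        · rw [Set.indicator_of_notMem (by exact h), Set.indicator_of_notMem (by exact h)]
    _ = ∫ t in {t : ℝ | δ < |t|}, w !₂[z 0 - t, z 1] / t := by
        rw [integral_sub_left_eq_self (fun s => {t : ℝ | δ < |t|}.indicator
          (fun t => w !₂[z 0 - t, z 1] / t) s), integral_indicator hS]
    _ = (∫ t in Set.Ioi δ, w !₂[z 0 - t, z 1] / t) + ∫ t in Set.Iio (-δ), w !₂[z 0 - t, z 1] / t := by
        have : {t : ℝ | δ < |t|} = Set.Ioi δ ∪ Set.Iio (-δ) := by
          ext t; simp [lt_abs, lt_neg]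
        rw [this, setIntegral_union _ measurableSet_Iio i1 i3]
        rw [Set.disjoint_left]
        intro t h1 h2
        simp only [Set.mem_Ioi, Set.mem_Iio] at h1 h2
        linarith
    _ = (∫ t in Set.Ioi δ, w !₂[z 0 - t, z 1] / t) - ∫ t in Set.Ioi δ, w !₂[z 0 + t, z 1] / t := by
        rw [sub_eq_add_neg, ← integral_neg, ← integral_Iic_eq_integral_Iio,
          ← integral_comp_neg_Ioi]
        congr 2; ext t; simp [div_neg]
    _ = _ := by
        rw [← integral_sub i1 i2]
        simp only [oddQuot, sub_div]

theorem IsTest.tendsto_integral_oddQuot {w : Plane → ℝ} (hw : IsTest w) (z : Plane) :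
    Tendsto (fun δ : ℝ => ∫ t in Set.Ioi δ, oddQuot w z t) (𝓝[>] 0)
      (𝓝 (∫ t in Set.Ioi 0, oddQuot w z t)) := by
  have hi := (integrable_indicator_iff measurableSet_Ioi).2 (hw.integrableOn_oddQuot z)
  simp_rw [← fun δ : ℝ => integral_indicator (f := oddQuot w z) (measurableSet_Ioi (a := δ)) (μ := volume)]
  refine tendsto_integral_filter_of_dominated_convergence
    (fun t => ‖(Set.Ioi 0).indicator (oddQuot w z) t‖) ?_ ?_ hi.norm ?_
  · filter_upwards [self_mem_nhdsWithin] with δ hδ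
    have : (Set.Ioi δ).indicator (oddQuot w z)
        = (Set.Ioi δ).indicator ((Set.Ioi 0).indicator (oddQuot w z)) := by
      rw [Set.indicator_indicator, Set.inter_eq_left.2 (Set.Ioi_subset_Ioi (le_of_lt hδ))]
    rw [this]
    exact hi.aestronglyMeasurable.indicator measurableSet_Ioi
  · filter_upwards [self_mem_nhdsWithin] with δ hδ
    refine Eventually.of_forall fun t => ?_
    exact norm_indicator_le_of_subset (Set.Ioi_subset_Ioi (le_of_lt hδ)) _ _
  · refine Eventually.of_forall fun t => ?_
    rcases le_or_gt t 0 with h | h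
    · refine tendsto_const_nhds.congr' ?_
      filter_upwards [self_mem_nhdsWithin] with δ hδ
      rw [Set.indicator_of_notMem (by simpa using h),
        Set.indicator_of_notMem (by simpa using h.trans (le_of_lt hδ))]
    · refine tendsto_const_nhds.congr' ?_
      filter_upwards [nhdsWithin_le_nhds (Iio_mem_nhds h)] with δ hδ
      rw [Set.indicator_of_mem (by exact h), Set.indicator_of_mem (by exact hδ)]

/-- Abel regularization: the factor e^{−εt} makes Fubini available on the Fourier side, where the
t-integral of sin(bt)/t alone is not absolutely convergent. -/
theorem IsTest.tendsto_integral_exp_mul_oddQuot {w : Plane → ℝ} (hw : IsTest w) (z : Plane) :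
    Tendsto (fun ε : ℝ => ∫ t in Set.Ioi 0, Real.exp (-ε * t) * oddQuot w z t) (𝓝[>] 0)
      (𝓝 (∫ t in Set.Ioi 0, oddQuot w z t)) := by
  have hi := hw.integrableOn_oddQuot z
  refine tendsto_integral_filter_of_dominated_convergence
    (fun t => ‖oddQuot w z t‖) ?_ ?_ hi.norm ?_
  · refine Eventually.of_forall fun ε => ?_
    exact (Continuous.aestronglyMeasurable (by fun_prop)).mul hi.aestronglyMeasurable
  · filter_upwards [self_mem_nhdsWithin] with ε hε
    filter_upwards [ae_restrict_mem measurableSet_Ioi] with t ht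
    rw [norm_mul, Real.norm_eq_abs, abs_of_pos (Real.exp_pos _)]
    refine mul_le_of_le_one_left (norm_nonneg _) (Real.exp_le_one_iff.2 ?_)
    have h1 : 0 < ε := hε
    have h2 : 0 < t := ht
    nlinarith
  · refine Eventually.of_forall fun t => ?_
    have : Continuous fun ε : ℝ => Real.exp (-ε * t) * oddQuot w z t := by fun_prop
    have h := (this.tendsto 0).mono_left (nhdsWithin_le_nhds (s := Set.Ioi 0))
    simpa using h

/-- Fourier inversion at the two shifted points; the difference of the two characters is −2i times a
sine. -/
theorem IsTest.oddQuot_eq_integral {w : Plane → ℝ} (hw : IsTest w) (z : Plane) (t : ℝ) :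
    (oddQuot w z t : ℂ) = ∫ ξ : Plane, Real.fourierChar (inner ℝ ξ z) *
      (ftReal w ξ * (-2 * Complex.I * (Real.sin (2 * Real.pi * ξ 0 * t) / t : ℝ))) := by
  have hint : Integrable (ftReal w) := by
    rw [hw.ftReal_eq]; exact SchwartzMap.integrable _
  have hconv : ∀ x : Plane, Integrable fun ξ => Real.fourierChar (inner ℝ ξ x) • ftReal w ξ := by
    intro x
    have := (Real.fourierIntegral_convergent_iff (μ := volume) (f := ftReal w) (-x)).2 hint
    simpa using this
  have hrep : ∀ x : Plane, (w x : ℂ) = ∫ ξ, Real.fourierChar (inner ℝ ξ x) • ftReal w ξ := by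
    intro x; rw [← hw.fourierInv_ftReal, Real.fourierInv_eq]
  rw [oddQuot]
  push_cast
  rw [hrep, hrep, ← integral_sub (hconv _) (hconv _), ← integral_div]
  congr 1; ext ξ
  have e1 : inner ℝ ξ !₂[z 0 - t, z 1] = inner ℝ ξ z + -(t * ξ 0) := by
    simp [PiLp.inner_apply, Fin.sum_univ_two]; ring
  have e2 : inner ℝ ξ !₂[z 0 + t, z 1] = inner ℝ ξ z + t * ξ 0 := by
    simp [PiLp.inner_apply, Fin.sum_univ_two]; ring
  rw [e1, e2, AddChar.map_add_eq_mul, AddChar.map_add_eq_mul]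
  simp only [Circle.smul_def, smul_eq_mul, Circle.coe_mul]
  have h3 : ((Real.fourierChar (-(t * ξ 0)) : Circle) : ℂ) - (Real.fourierChar (t * ξ 0) : Circle)
      = -2 * Complex.I * (Real.sin (2 * Real.pi * ξ 0 * t) : ℝ) := by
    rw [Real.fourierChar_apply, Real.fourierChar_apply]
    have := Complex.two_sin ((2 * Real.pi * ξ 0 * t : ℝ) : ℂ)
    rw [Complex.ofReal_sin, show -2 * Complex.I * Complex.sin ((2 * Real.pi * ξ 0 * t : ℝ) : ℂ)
      = -(2 * Complex.sin ((2 * Real.pi * ξ 0 * t : ℝ) : ℂ)) * Complex.I by ring, this]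
    rw [show ((2 * Real.pi * -(t * ξ 0) : ℝ) : ℂ) * Complex.I
      = -((2 * Real.pi * ξ 0 * t : ℝ) : ℂ) * Complex.I by push_cast; ring,
      show ((2 * Real.pi * (t * ξ 0) : ℝ) : ℂ) * Complex.I
      = ((2 * Real.pi * ξ 0 * t : ℝ) : ℂ) * Complex.I by push_cast; ring]
    linear_combination (Complex.exp (-((2 * Real.pi * ξ 0 * t : ℝ) : ℂ) * Complex.I)
      - Complex.exp (((2 * Real.pi * ξ 0 * t : ℝ) : ℂ) * Complex.I)) * Complex.I_sq
  have h4 := congrArg (fun x => (Real.fourierChar (inner ℝ ξ z) : ℂ) * ftReal w ξ * x / t) h3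
  simp only at h4
  push_cast at h4 ⊢
  linear_combination h4

/-- Fubini, with the integrable majorant 4π e^{−εt} |ξ| |ŵ(ξ)| coming from |sin(bt)/t| ≤ |b|. -/
theorem IsTest.integral_exp_mul_oddQuot {w : Plane → ℝ} (hw : IsTest w) (z : Plane) {ε : ℝ}
    (hε : 0 < ε) :
    ((∫ t in Set.Ioi 0, Real.exp (-ε * t) * oddQuot w z t : ℝ) : ℂ) =
      ∫ ξ : Plane, Real.fourierChar (inner ℝ ξ z) *
      (ftReal w ξ * (-2 * Complex.I * (Real.arctan (2 * Real.pi * ξ 0 / ε) : ℝ))) := by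
  rw [← integral_complex_ofReal]
  simp_rw [Complex.ofReal_mul, hw.oddQuot_eq_integral, ← integral_const_mul]
  rw [integral_integral_swap]
  · congr 1; ext ξ
    rw [← integral_exp_neg_mul_sin_div hε, ← integral_complex_ofReal, ← integral_const_mul,
      ← integral_const_mul, ← integral_const_mul]
    congr 1; ext t; rw [Complex.ofReal_mul]; ring
  · have hb : Integrable (fun q : ℝ × Plane => Real.exp (-ε * q.1) *
        (4 * Real.pi * (‖q.2‖ ^ 1 * ‖ftReal w q.2‖))) ((volume.restrict (Set.Ioi 0)).prod volume) :=
      (exp_neg_integrableOn_Ioi 0 hε).integrable.mul_prod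
        ((hw.integrable_pow_mul_ftReal 1).const_mul _)
    refine hb.mono' ?_ ?_
    · have := hw.continuous_ftReal.measurable
      have h5 : Continuous fun q : ℝ × Plane => (Real.fourierChar (inner ℝ q.2 z) : ℂ) := by
        have := Real.continuous_fourierChar
        fun_prop
      have h6 := h5.measurable
      unfold Function.uncurry
      exact Measurable.aestronglyMeasurable (by fun_prop)
    · have : ∀ᵐ q : ℝ × Plane ∂((volume.restrict (Set.Ioi 0)).prod volume), 0 < q.1 :=
        Measure.quasiMeasurePreserving_fst.ae (ae_restrict_mem measurableSet_Ioi)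
      filter_upwards [this] with q hq
      simp only [Function.uncurry, norm_mul, Circle.norm_coe, one_mul, Complex.norm_real,
        Complex.norm_I, norm_neg, mul_one]
      have h1 := abs_sin_mul_div_le (2 * Real.pi * q.2 0) q.1 hq
      rw [abs_mul, abs_of_pos Real.two_pi_pos] at h1
      have h2 := abs_coord_le q.2 0
      rw [Real.norm_eq_abs, abs_of_pos (Real.exp_pos _)]
      refine mul_le_mul_of_nonneg_left ?_ (Real.exp_pos _).le
      rw [Real.norm_eq_abs]
      simp only [Complex.norm_ofNat]
      calc _ ≤ ‖ftReal w q.2‖ * (2 * (2 * Real.pi * ‖q.2‖)) := by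
            gcongr
            exact h1.trans (by gcongr)
        _ = _ := by ring

theorem tendsto_arctan_div (b : ℝ) :
    Tendsto (fun ε : ℝ => Real.arctan (b / ε)) (𝓝[>] 0) (𝓝 (Real.pi / 2 * Real.sign b)) := by
  have hinv := tendsto_inv_nhdsGT_zero (𝕜 := ℝ)
  rcases lt_trichotomy b 0 with h | h | h
  · rw [Real.sign_of_neg h, mul_neg_one]
    have : Tendsto (fun ε : ℝ => b / ε) (𝓝[>] 0) atBot := by
      simp_rw [div_eq_mul_inv]; exact hinv.const_mul_atTop_of_neg h
    exact (Real.tendsto_arctan_atBot.mono_right nhdsWithin_le_nhds).comp this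
  · simp [h]
  · rw [Real.sign_of_pos h, mul_one]
    have : Tendsto (fun ε : ℝ => b / ε) (𝓝[>] 0) atTop := by
      simp_rw [div_eq_mul_inv]; exact hinv.const_mul_atTop h
    exact (Real.tendsto_arctan_atTop.mono_right nhdsWithin_le_nhds).comp this

theorem IsTest.integral_oddQuot {w : Plane → ℝ} (hw : IsTest w) (z : Plane) :
    ((∫ t in Set.Ioi 0, oddQuot w z t : ℝ) : ℂ) =
      ∫ ξ : Plane, Real.fourierChar (inner ℝ ξ z) *
      (ftReal w ξ * (-2 * Complex.I * (Real.pi / 2 * Real.sign (2 * Real.pi * ξ 0) : ℝ))) := by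
  have h1 := (Complex.continuous_ofReal.tendsto _).comp (hw.tendsto_integral_exp_mul_oddQuot z)
  refine tendsto_nhds_unique h1 ?_
  have h2 : ∀ᶠ ε : ℝ in 𝓝[>] 0, (∫ ξ : Plane, Real.fourierChar (inner ℝ ξ z) *
      (ftReal w ξ * (-2 * Complex.I * (Real.arctan (2 * Real.pi * ξ 0 / ε) : ℝ)))) =
      ((fun x : ℝ => (x : ℂ)) ∘ fun ε : ℝ => ∫ t in Set.Ioi 0, Real.exp (-ε * t) * oddQuot w z t) ε := by
    filter_upwards [self_mem_nhdsWithin] with ε hε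
    exact (hw.integral_exp_mul_oddQuot z hε).symm
  refine Tendsto.congr' h2 ?_
  have hb := (hw.integrable_pow_mul_ftReal 0).mul_const Real.pi
  refine tendsto_integral_filter_of_dominated_convergence _ ?_ ?_ hb ?_
  · refine Eventually.of_forall fun ε => ?_
    have := hw.continuous_ftReal.measurable
    have h5 : Continuous fun ξ : Plane => (Real.fourierChar (inner ℝ ξ z) : ℂ) := by
      have := Real.continuous_fourierChar
      fun_prop
    have h6 := h5.measurable
    exact Measurable.aestronglyMeasurable (by fun_prop)
  · refine Eventually.of_forall fun ε => Eventually.of_forall fun ξ => ?_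
    simp only [norm_mul, Circle.norm_coe, one_mul, Complex.norm_real,
        Complex.norm_I, norm_neg, mul_one, Complex.norm_ofNat, pow_zero, Real.norm_eq_abs]
    have := (abs_lt.2 ⟨Real.neg_pi_div_two_lt_arctan (2 * Real.pi * ξ 0 / ε),
      Real.arctan_lt_pi_div_two (2 * Real.pi * ξ 0 / ε)⟩).le
    gcongr
    linarith
  · refine Eventually.of_forall fun ξ => ?_
    refine Tendsto.const_mul _ (Tendsto.const_mul _ (Tendsto.const_mul _ ?_))
    exact (Complex.continuous_ofReal.tendsto _).comp (tendsto_arctan_div _)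

/-- The operator `H ∂_x` on test functions is the Fourier multiplier `|2π ξ₀|`. -/
theorem IsTest.hilbertX_partialD {v : Plane → ℝ} (hv : IsTest v) (z : Plane) :
    (hilbertX (BOZK.partialD 0 v) z : ℂ) =
      𝓕⁻ (fun ξ : Plane => ((|2 * Real.pi * ξ 0| : ℝ) : ℂ) * ftReal v ξ) z := by
  have hw := hv.partialD 0
  have hlim : hilbertX (BOZK.partialD 0 v) z
      = 1 / Real.pi * ∫ t in Set.Ioi 0, oddQuot (BOZK.partialD 0 v) z t := by
    refine Tendsto.limUnder_eq ?_
    refine ((hw.tendsto_integral_oddQuot z).const_mul (1 / Real.pi)).congr' ?_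
    filter_upwards [self_mem_nhdsWithin] with δ hδ
    rw [hw.integral_truncated z hδ]
  rw [hlim]
  push_cast
  rw [hw.integral_oddQuot z, ← integral_const_mul, Real.fourierInv_eq]
  congr 1; ext ξ
  rw [hv.ftReal_partialD, Circle.smul_def, smul_eq_mul]
  have hs : Real.sign (2 * Real.pi * ξ 0) * (2 * Real.pi * ξ 0) = |2 * Real.pi * ξ 0| := by
    rcases lt_trichotomy (2 * Real.pi * ξ 0) 0 with h | h | h
    · rw [Real.sign_of_neg h, abs_of_neg h]; ring
    · simp [h]
    · rw [Real.sign_of_pos h, abs_of_pos h]; ring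
  have hpi : (Real.pi : ℂ) ≠ 0 := by exact_mod_cast Real.pi_ne_zero
  rw [← hs]
  push_cast
  field_simp
  linear_combination (-(Real.sign (2 * Real.pi * ξ 0) : ℂ) * ξ 0 * ftReal v ξ) * Complex.I_sq

/-! ### Size and integrability of the anisotropic symbol -/

theorem lintegral_plane_mul {f g : ℝ → ℝ≥0∞} (hf : Measurable f) (hg : Measurable g) :
    ∫⁻ ξ : Plane, f (ξ 0) * g (ξ 1) = (∫⁻ t, f t) * ∫⁻ t, g t := by
  have h1 := EuclideanSpace.volume_preserving_symm_measurableEquiv_toLp (Fin 2)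
  have h2 := volume_preserving_finTwoArrow ℝ
  have h3 := (h2.comp h1).lintegral_comp (f := fun q : ℝ × ℝ => f q.1 * g q.2) (by fun_prop)
  rw [Measure.volume_eq_prod, lintegral_prod_mul hf.aemeasurable hg.aemeasurable] at h3
  exact h3

/-- The symbol `|c| + |α| |2π ξ₀| + (2π ξ₁)²` of the linear part of the equation. -/
noncomputable def symbol (c α : ℝ) (ξ : Plane) : ℝ :=
  |c| + |α| * |2 * Real.pi * ξ 0| + (2 * Real.pi * ξ 1) ^ 2

theorem le_symbol (c α : ℝ) (ξ : Plane) : |c| ≤ symbol c α ξ := by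
  unfold symbol; nlinarith [mul_nonneg (abs_nonneg α) (abs_nonneg (2 * Real.pi * ξ 0)),
    sq_nonneg (2 * Real.pi * ξ 1)]

theorem symbol_pos {c : ℝ} (hc : c ≠ 0) (α : ℝ) (ξ : Plane) : 0 < symbol c α ξ :=
  (abs_pos.2 hc).trans_le (le_symbol c α ξ)

theorem continuous_symbol (c α : ℝ) : Continuous (symbol c α) := by
  unfold symbol; fun_prop

theorem measurable_symbol (c α : ℝ) : Measurable (symbol c α) := (continuous_symbol c α).measurable

theorem lintegral_abs_rpow_le {θ A : ℝ} (hθ : θ < 1) (hA : 0 < A) :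
    ∫⁻ t : ℝ, Set.indicator {t : ℝ | |t| ≤ A} (fun t => ENNReal.ofReal |t| ^ (-θ)) t
      = ENNReal.ofReal (2 / (1 - θ) * A ^ (1 - θ)) := by
  set f : ℝ → ℝ := (Set.Ioc 0 A).indicator fun t => t ^ (-θ)
  have hf1 : IntegrableOn f (Set.Ioi 0) := by
    have : IntegrableOn (fun t : ℝ => t ^ (-θ)) (Set.Ioc 0 A) :=
      (intervalIntegrable_iff_integrableOn_Ioc_of_le hA.le).1
        (intervalIntegral.intervalIntegrable_rpow' (by linarith))
    exact (this.integrable_indicator measurableSet_Ioc).integrableOn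
  have hf2 : ∫ t in Set.Ioi 0, f t = A ^ (1 - θ) / (1 - θ) := by
    have hsub : Set.Ioi (0 : ℝ) ∩ Set.Ioc 0 A = Set.Ioc 0 A := by
      ext t; simp
    rw [setIntegral_indicator measurableSet_Ioc, hsub,
      ← intervalIntegral.integral_of_le hA.le, integral_rpow (Or.inl (by linarith)),
      Real.zero_rpow (by linarith)]
    rw [show -θ + 1 = 1 - θ by ring, sub_zero]
  have hint : Integrable fun t => f |t| := by
    have h1 : IntegrableOn (fun t => f |t|) (Set.Ioi 0) := by
      refine hf1.congr_fun (fun t ht => ?_) measurableSet_Ioi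
      simp only [abs_of_pos (show 0 < t from ht)]
    have h2 : IntegrableOn (fun t => f |t|) (Set.Iio 0) := by
      rw [← (Measure.measurePreserving_neg (volume : Measure ℝ)).integrableOn_comp_preimage
        (MeasurableEquiv.neg ℝ).measurableEmbedding]
      have : (Neg.neg ⁻¹' Set.Iio 0 : Set ℝ) = Set.Ioi 0 := by ext t; simp
      rw [this]
      refine h1.congr_fun (fun t _ => ?_) measurableSet_Ioi
      simp
    rw [← integrableOn_univ, ← Set.Iic_union_Ioi (a := (0 : ℝ)), integrableOn_union]
    exact ⟨Iff.mpr integrableOn_Iic_iff_integrableOn_Iio h2, h1⟩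
  have hfn : ∀ t, 0 ≤ f |t| := fun t => Set.indicator_nonneg (fun s hs => Real.rpow_nonneg hs.1.le _) _
  calc _ = ∫⁻ t : ℝ, ENNReal.ofReal (f |t|) := by
        apply lintegral_congr_ae
        have : ∀ᵐ t : ℝ, t ≠ 0 := by simp [ae_iff]
        filter_upwards [this] with t ht
        have hpos := abs_pos.2 ht
        by_cases h : |t| ≤ A
        · rw [Set.indicator_of_mem (by exact h)]
          simp only [f]
          rw [Set.indicator_of_mem (show |t| ∈ Set.Ioc 0 A from ⟨hpos, h⟩),
            ENNReal.ofReal_rpow_of_pos hpos]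
        · rw [Set.indicator_of_notMem (by exact h)]
          simp only [f]
          rw [Set.indicator_of_notMem (fun h' => h h'.2), ENNReal.ofReal_zero]
    _ = ENNReal.ofReal (∫ t : ℝ, f |t|) :=
        (ofReal_integral_eq_lintegral_ofReal hint (Eventually.of_forall hfn)).symm
    _ = _ := by rw [integral_comp_abs, hf2]; congr 1; ring

/-- The sublevel set lies in a box of sides of order M and √M, and on it the power of the symbol is
dominated by a product of powers of |ξ₀| and |ξ₁|, so the integral factors. -/
theorem lintegral_symbol_rpow_le {c α s : ℝ} (hα : α ≠ 0) (hs0 : 0 < s) (hs : s < 3 / 2) :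
    ∃ C : ℝ, 0 < C ∧ ∀ M : ℝ, 0 < M →
      ∫⁻ ξ, Set.indicator {ξ | symbol c α ξ ≤ M} (fun ξ => ENNReal.ofReal (symbol c α ξ) ^ (-s)) ξ
        ≤ ENNReal.ofReal (C * M ^ (3 / 2 - s)) := by
  set k : ℝ := |α| * (2 * Real.pi)
  have hk : 0 < k := by have := abs_pos.2 hα; positivity
  set l : ℝ := 2 * Real.pi
  have hl : 0 < l := Real.two_pi_pos
  set θ : ℝ := 2 * s / 3
  have hθ0 : 0 < θ := by positivity
  have hθ : θ < 1 := by simp only [θ]; linarith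
  refine ⟨(k ^ (-θ) * l ^ (-θ)) * (2 / (1 - θ)) ^ 2 * (k⁻¹ ^ (1 - θ) * l⁻¹ ^ (1 - θ)), ?_, ?_⟩
  · have : 0 < 1 - θ := by linarith
    positivity
  intro M hM
  set f : ℝ → ℝ≥0∞ := fun t => ENNReal.ofReal (k ^ (-θ)) *
    Set.indicator {t : ℝ | |t| ≤ M / k} (fun t => ENNReal.ofReal |t| ^ (-θ)) t
  set g : ℝ → ℝ≥0∞ := fun t => ENNReal.ofReal (l ^ (-θ)) *
    Set.indicator {t : ℝ | |t| ≤ √M / l} (fun t => ENNReal.ofReal |t| ^ (-θ)) t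
  have hms : ∀ A : ℝ, Measurable (Set.indicator {t : ℝ | |t| ≤ A} (fun t => ENNReal.ofReal |t| ^ (-θ))) :=
    fun A => Measurable.indicator (by fun_prop) (measurableSet_le (by fun_prop) measurable_const)
  have hfm : Measurable f := (hms _).const_mul _
  have hgm : Measurable g := (hms _).const_mul _
  calc _ ≤ ∫⁻ ξ : Plane, f (ξ 0) * g (ξ 1) := by
        refine lintegral_mono fun ξ => ?_
        by_cases h : symbol c α ξ ≤ M
        · rw [Set.indicator_of_mem (by exact h)]
          have hX : k * |ξ 0| = |α| * |2 * Real.pi * ξ 0| := by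
            rw [abs_mul, abs_of_pos Real.two_pi_pos]; simp only [k]; ring
          have hY : (l * |ξ 1|) ^ 2 = (2 * Real.pi * ξ 1) ^ 2 := by
            rw [mul_pow, sq_abs]; simp only [l]; ring
          have hsum : k * |ξ 0| + (l * |ξ 1|) ^ 2 ≤ symbol c α ξ := by
            rw [hX, hY]; unfold symbol; linarith [abs_nonneg c]
          have h0 : |ξ 0| ≤ M / k := by
            rw [le_div_iff₀ hk]; nlinarith [sq_nonneg (l * |ξ 1|)]
          have h1 : |ξ 1| ≤ √M / l := by
            rw [le_div_iff₀ hl]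
            apply Real.le_sqrt_of_sq_le
            have : 0 ≤ k * |ξ 0| := by positivity
            nlinarith
          simp only [f, g]
          rw [Set.indicator_of_mem (by exact h0), Set.indicator_of_mem (by exact h1)]
          -- The weights 2/3 and 1/3 give both coordinates the exponent 2/3. After raising to −s,
          -- each carries the exponent −θ = −2s/3, integrable at 0 exactly because s < 3/2.
          have hgeo : (k * |ξ 0|) ^ (2 / 3 : ℝ) * (l * |ξ 1|) ^ (2 / 3 : ℝ) ≤ symbol c α ξ := by
            have := Real.geom_mean_le_arith_mean2_weighted (w₁ := 2 / 3) (w₂ := 1 / 3)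
              (p₁ := k * |ξ 0|) (p₂ := (l * |ξ 1|) ^ 2) (by norm_num) (by norm_num) (by positivity)
              (by positivity) (by norm_num)
            rw [← Real.rpow_natCast, ← Real.rpow_mul (by positivity)] at this
            norm_num at this
            have h3 : 0 ≤ k * |ξ 0| := by positivity
            have h4 : 0 ≤ (l * |ξ 1|) ^ 2 := by positivity
            linarith
          have e : ∀ x : ℝ, 0 < k → ∀ m : ℝ, 0 < m → ENNReal.ofReal (m ^ (-θ)) * ENNReal.ofReal |x| ^ (-θ)
              = ENNReal.ofReal ((m * |x|) ^ (2 / 3 : ℝ)) ^ (-s) := by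
            intro x _ m hm
            have hmx : 0 ≤ m * |x| := by positivity
            rw [← ENNReal.ofReal_rpow_of_nonneg hmx (by norm_num : (0 : ℝ) ≤ 2 / 3), ← ENNReal.rpow_mul,
              ENNReal.ofReal_mul hm.le, ENNReal.mul_rpow_of_ne_top ENNReal.ofReal_ne_top
              ENNReal.ofReal_ne_top, ← ENNReal.ofReal_rpow_of_pos hm]
            have : (2 / 3 : ℝ) * -s = -θ := by simp only [θ]; ring
            rw [this]
          rw [e _ hk _ hk, e _ hk _ hl, ← ENNReal.mul_rpow_of_ne_top ENNReal.ofReal_ne_top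
            ENNReal.ofReal_ne_top, ← ENNReal.ofReal_mul (by positivity)]
          rw [ENNReal.rpow_neg, ENNReal.rpow_neg, ENNReal.inv_le_inv]
          exact ENNReal.rpow_le_rpow (ENNReal.ofReal_le_ofReal hgeo) hs0.le
        · rw [Set.indicator_of_notMem (by exact h)]; exact zero_le
    _ = (∫⁻ t, f t) * ∫⁻ t, g t := lintegral_plane_mul hfm hgm
    _ = _ := by
        simp only [f, g]
        rw [lintegral_const_mul _ (hms _), lintegral_const_mul _ (hms _),
          lintegral_abs_rpow_le hθ (by positivity), lintegral_abs_rpow_le hθ (by positivity)]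
        have h1θ : 0 < 1 - θ := by linarith
        rw [← ENNReal.ofReal_mul (by positivity), ← ENNReal.ofReal_mul (by positivity),
          ← ENNReal.ofReal_mul (by positivity)]
        congr 1
        have hsq : √M ^ (1 - θ) = M ^ (1 / 2 * (1 - θ)) := by
          rw [Real.sqrt_eq_rpow, ← Real.rpow_mul hM.le]
        rw [div_eq_mul_inv M, div_eq_mul_inv √M, Real.mul_rpow hM.le (inv_nonneg.2 hk.le),
          Real.mul_rpow (Real.sqrt_nonneg M) (inv_nonneg.2 hl.le), hsq]
        have : M ^ (3 / 2 - s) = M ^ (1 - θ) * M ^ (1 / 2 * (1 - θ)) := by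
          rw [← Real.rpow_add hM]; congr 1; simp only [θ]; ring
        rw [this]; ring

/-- The symbol dominates the isotropic weight of order one. -/
theorem exists_le_symbol {c α : ℝ} (hc : c ≠ 0) (hα : α ≠ 0) :
    ∃ κ : ℝ, 0 < κ ∧ ∀ ξ, κ * (1 + ‖ξ‖) ≤ symbol c α ξ ∧
      κ * ((1 + |ξ 0|) + (1 + |ξ 1|) ^ 2) ≤ symbol c α ξ := by
  have h1 := abs_pos.2 hc
  have h2 := abs_pos.2 hα
  have hpi := Real.pi_gt_three
  -- Since (1 + |ξ₁|)² ≤ 2 + 2|ξ₁|², the constant terms add up to 3κ, which |c|/4 leaves room for.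
  set κ := min (min (|c| / 4) |α|) 1
  have hκ : 0 < κ := by positivity
  have k1 : κ ≤ |c| / 4 := (min_le_left _ _).trans (min_le_left _ _)
  have k2 : κ ≤ |α| := (min_le_left _ _).trans (min_le_right _ _)
  have k3 : κ ≤ 1 := min_le_right _ _
  have key : ∀ ξ : Plane, κ * ((1 + |ξ 0|) + (1 + |ξ 1|) ^ 2) ≤ symbol c α ξ := by
    intro ξ
    have a0 := abs_nonneg (ξ 0)
    have a1 := abs_nonneg (ξ 1)
    have e0 : |ξ 0| ≤ |2 * Real.pi * ξ 0| := by
      rw [abs_mul, abs_of_pos Real.two_pi_pos]; nlinarith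
    have e1 : 2 * |ξ 1| ^ 2 ≤ (2 * Real.pi * ξ 1) ^ 2 := by
      rw [mul_pow, ← sq_abs (ξ 1)]
      have : (2 : ℝ) ≤ (2 * Real.pi) ^ 2 := by nlinarith
      nlinarith [sq_nonneg |ξ 1|]
    have b1 : κ * |ξ 0| ≤ |α| * |2 * Real.pi * ξ 0| := mul_le_mul k2 e0 a0 h2.le
    have b2 : κ * (2 * |ξ 1| ^ 2) ≤ (2 * Real.pi * ξ 1) ^ 2 := by
      nlinarith [sq_nonneg |ξ 1|]
    have b3 : κ * (1 + |ξ 1|) ^ 2 ≤ κ * (2 + 2 * |ξ 1| ^ 2) := by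
      apply mul_le_mul_of_nonneg_left _ hκ.le
      nlinarith [sq_nonneg (1 - |ξ 1|)]
    unfold symbol
    nlinarith
  refine ⟨κ, hκ, fun ξ => ⟨le_trans ?_ (key ξ), key ξ⟩⟩
  apply mul_le_mul_of_nonneg_left _ hκ.le
  have hn : ‖ξ‖ ≤ |ξ 0| + |ξ 1| := by
    rw [EuclideanSpace.norm_eq, Fin.sum_univ_two]
    apply Real.sqrt_le_iff.2
    constructor
    · positivity
    · simp only [Real.norm_eq_abs]; nlinarith [mul_nonneg (abs_nonneg (ξ 0)) (abs_nonneg (ξ 1))]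
  nlinarith [abs_nonneg (ξ 1), sq_nonneg |ξ 1|]

/-- By the weighted geometric mean, a⁻² is at most a constant times (1+|ξ₀|)^{−4/3} (1+|ξ₁|)^{−4/3},
and 4/3 > 1. -/
theorem memLp_inv_symbol {c α : ℝ} (hc : c ≠ 0) (hα : α ≠ 0) :
    MemLp (fun ξ => (symbol c α ξ)⁻¹) 2 := by
  obtain ⟨κ, hκ, hle⟩ := exists_le_symbol hc hα
  have hm : Measurable fun ξ => (symbol c α ξ)⁻¹ := (measurable_symbol c α).inv
  refine ⟨hm.aestronglyMeasurable, ?_⟩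
  rw [eLpNorm_lt_top_iff_lintegral_rpow_enorm_lt_top (by norm_num) (by norm_num)]
  have hint : ∫⁻ t : ℝ, ENNReal.ofReal ((1 + |t|) ^ (-(4 / 3) : ℝ)) < ⊤ := by
    have := integrable_one_add_norm (E := ℝ) (μ := volume) (r := 4 / 3) (by norm_num)
    exact this.lintegral_lt_top
  have hfm : Measurable fun t : ℝ => ENNReal.ofReal ((1 + |t|) ^ (-(4 / 3) : ℝ)) := by fun_prop
  calc _ ≤ ∫⁻ ξ : Plane, ENNReal.ofReal (κ⁻¹ ^ 2) * (ENNReal.ofReal ((1 + |ξ 0|) ^ (-(4 / 3) : ℝ)) *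
        ENNReal.ofReal ((1 + |ξ 1|) ^ (-(4 / 3) : ℝ))) := by
        refine lintegral_mono fun ξ => ?_
        have hp := symbol_pos hc α ξ
        rw [← ENNReal.ofReal_mul (by positivity), ← ENNReal.ofReal_mul (by positivity),
          Real.enorm_eq_ofReal (by positivity), ENNReal.ofReal_rpow_of_nonneg (by positivity) (by norm_num)]
        apply ENNReal.ofReal_le_ofReal
        have hg : κ * ((1 + |ξ 0|) ^ (2 / 3 : ℝ) * (1 + |ξ 1|) ^ (2 / 3 : ℝ)) ≤ symbol c α ξ := by
          refine le_trans (mul_le_mul_of_nonneg_left ?_ hκ.le) (hle ξ).2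
          have := Real.geom_mean_le_arith_mean2_weighted (w₁ := 2 / 3) (w₂ := 1 / 3)
              (p₁ := 1 + |ξ 0|) (p₂ := (1 + |ξ 1|) ^ 2) (by norm_num) (by norm_num) (by positivity)
              (by positivity) (by norm_num)
          rw [← Real.rpow_natCast, ← Real.rpow_mul (by positivity)] at this
          norm_num at this
          have h3 : 0 ≤ |ξ 0| := by positivity
          have h4 : 0 ≤ (1 + |ξ 1|) ^ 2 := by positivity
          linarith
        have h2 := inv_anti₀ (by positivity) hg
        have h3 := pow_le_pow_left₀ (by positivity) h2 2
        have h4 : ((symbol c α ξ)⁻¹) ^ (ENNReal.toReal 2) = ((symbol c α ξ)⁻¹) ^ 2 := by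
          rw [← Real.rpow_natCast]; norm_num
        rw [h4]
        refine h3.trans_eq ?_
        rw [mul_inv, mul_inv, mul_pow, mul_pow, ← Real.rpow_neg (by positivity),
          ← Real.rpow_neg (by positivity), ← Real.rpow_natCast (_ ^ _), ← Real.rpow_natCast (_ ^ _),
          ← Real.rpow_mul (by positivity), ← Real.rpow_mul (by positivity)]
        norm_num
    _ = ENNReal.ofReal (κ⁻¹ ^ 2) * ((∫⁻ t : ℝ, ENNReal.ofReal ((1 + |t|) ^ (-(4 / 3) : ℝ))) *
          ∫⁻ t : ℝ, ENNReal.ofReal ((1 + |t|) ^ (-(4 / 3) : ℝ))) := by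
        rw [lintegral_const_mul _ (by fun_prop), lintegral_plane_mul hfm hfm]
    _ < ⊤ := ENNReal.mul_lt_top ENNReal.ofReal_lt_top (ENNReal.mul_lt_top hint hint)

/-! ### Multipliers on L² and the smoothing operators -/

theorem lintegral_enorm_sq (f : L2) : ∫⁻ z, ‖f z‖ₑ ^ 2 = ‖f‖ₑ ^ 2 := by
  rw [Lp.enorm_def, eLpNorm_eq_lintegral_rpow_enorm_toReal (by norm_num) (by norm_num),
    ← ENNReal.rpow_natCast, ← ENNReal.rpow_mul]
  norm_num

theorem enorm_fourierInv (f : L2) : ‖(𝓕⁻ f : L2)‖ₑ = ‖f‖ₑ := by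
  have := Lp.norm_fourier_eq (𝓕⁻ f : L2)
  rw [FourierTransform.fourier_fourierInv_eq] at this
  rw [← ofReal_norm, ← ofReal_norm, this]

/-- Bounded measurable real functions, the multipliers of `L²`. -/
def IsBddMult (m : Plane → ℝ) : Prop := Measurable m ∧ ∃ C, ∀ ξ, |m ξ| ≤ C

theorem IsBddMult.memLp {m : Plane → ℝ} (hm : IsBddMult m) (h : L2) :
    MemLp (fun ξ => (m ξ : ℂ) * h ξ) 2 := by
  obtain ⟨hm, C, hC⟩ := hm
  refine (Lp.memLp h).of_le_mul (c := C) ?_ ?_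
  · exact (Complex.measurable_ofReal.comp hm).aestronglyMeasurable.mul (Lp.aestronglyMeasurable h)
  · refine Eventually.of_forall fun ξ => ?_
    rw [norm_mul, Complex.norm_real]
    exact mul_le_mul_of_nonneg_right (hC ξ) (norm_nonneg _)

/-- Multiplication by a bounded function on `L²`. -/
noncomputable def mulOp (m : Plane → ℝ) (hm : IsBddMult m) : L2 →L[ℂ] L2 :=
  LinearMap.mkContinuous
    { toFun := fun h => (hm.memLp h).toLp _
      map_add' := fun f g => by
        apply Lp.ext
        filter_upwards [(hm.memLp (f + g)).coeFn_toLp, (hm.memLp f).coeFn_toLp,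
          (hm.memLp g).coeFn_toLp, Lp.coeFn_add f g, Lp.coeFn_add ((hm.memLp f).toLp _)
          ((hm.memLp g).toLp _)] with z h1 h2 h3 h4 h5
        rw [h1, h5, Pi.add_apply, h2, h3, h4, Pi.add_apply]; ring
      map_smul' := fun r f => by
        apply Lp.ext
        filter_upwards [(hm.memLp (r • f)).coeFn_toLp, (hm.memLp f).coeFn_toLp,
          Lp.coeFn_smul r f, Lp.coeFn_smul r ((hm.memLp f).toLp _)] with z h1 h2 h3 h4
        rw [h1, RingHom.id_apply, h4, Pi.smul_apply, h2, h3, Pi.smul_apply, smul_eq_mul,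
          smul_eq_mul]; ring }
    hm.2.choose fun h => by
      apply Lp.norm_le_mul_norm_of_ae_le_mul
      filter_upwards [(hm.memLp h).coeFn_toLp] with z h1
      simp only [LinearMap.coe_mk, AddHom.coe_mk]
      rw [h1, norm_mul, Complex.norm_real]
      exact mul_le_mul_of_nonneg_right (hm.2.choose_spec z) (norm_nonneg _)

theorem mulOp_ae (m : Plane → ℝ) (hm : IsBddMult m) (h : L2) :
    mulOp m hm h =ᵐ[volume] fun ξ => (m ξ : ℂ) * h ξ :=
  (hm.memLp h).coeFn_toLp

theorem isBddMult_symbol_rpow {c : ℝ} (hc : c ≠ 0) (α : ℝ) {s : ℝ} (hs : 0 ≤ s) :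
    IsBddMult fun ξ => symbol c α ξ ^ (-s / 2) := by
  refine ⟨(measurable_symbol c α).pow_const _, |c| ^ (-s / 2), fun ξ => ?_⟩
  have hp := symbol_pos hc α ξ
  rw [abs_of_pos (Real.rpow_pos_of_pos hp _)]
  exact Real.rpow_le_rpow_of_nonpos (abs_pos.2 hc) (le_symbol c α ξ) (by linarith)

/-- Multiplication by the power `-s / 2` of the symbol. -/
noncomputable def mulSymbol {c : ℝ} (hc : c ≠ 0) (α : ℝ) {s : ℝ} (hs : 0 ≤ s) : L2 →L[ℂ] L2 :=
  mulOp _ (isBddMult_symbol_rpow hc α hs)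

/-- The smoothing operator of order `s`, the Fourier multiplier with symbol
`(symbol c α) ^ (-s / 2)`. -/
noncomputable def smoothing {c : ℝ} (hc : c ≠ 0) (α : ℝ) {s : ℝ} (hs : 0 ≤ s) : L2 →L[ℂ] L2 :=
  (Lp.fourierTransformₗᵢ Plane ℂ).symm.toContinuousLinearEquiv.toContinuousLinearMap ∘L
    mulSymbol hc α hs

theorem smoothing_apply {c : ℝ} (hc : c ≠ 0) (α : ℝ) {s : ℝ} (hs : 0 ≤ s) (h : L2) :
    smoothing hc α hs h = (𝓕⁻ (mulSymbol hc α hs h) : L2) := rfl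

theorem mulSymbol_ae {c : ℝ} (hc : c ≠ 0) (α : ℝ) {s : ℝ} (hs : 0 ≤ s) (h : L2) :
    mulSymbol hc α hs h =ᵐ[volume] fun ξ => ((symbol c α ξ ^ (-s / 2) : ℝ) : ℂ) * h ξ :=
  mulOp_ae _ _ h

theorem mulSymbol_add {c : ℝ} (hc : c ≠ 0) (α : ℝ) {s t r : ℝ} (hs : 0 ≤ s) (ht : 0 ≤ t)
    (hr : 0 ≤ r) (h : s + t = r) (f : L2) :
    mulSymbol hc α hs (mulSymbol hc α ht f) = mulSymbol hc α hr f := by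
  apply Lp.ext
  filter_upwards [mulSymbol_ae hc α hs (mulSymbol hc α ht f), mulSymbol_ae hc α ht f,
    mulSymbol_ae hc α hr f] with ξ h1 h2 h3
  rw [h1, h2, h3, ← mul_assoc, ← Complex.ofReal_mul, ← Real.rpow_add (symbol_pos hc α ξ), ← h]
  congr 3; ring

theorem smoothing_add {c : ℝ} (hc : c ≠ 0) (α : ℝ) {s t r : ℝ} (hs : 0 ≤ s) (ht : 0 ≤ t)
    (hr : 0 ≤ r) (h : s + t = r) (f : L2) :
    smoothing hc α hs (mulSymbol hc α ht f) = smoothing hc α hr f := by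
  rw [smoothing_apply, smoothing_apply, mulSymbol_add hc α hs ht hr h]

theorem inner_mulSymbol {c : ℝ} (hc : c ≠ 0) (α : ℝ) {s : ℝ} (hs : 0 ≤ s) (f g : L2) :
    inner ℂ f (mulSymbol hc α hs g) = inner ℂ (mulSymbol hc α hs f) g := by
  rw [L2.inner_def, L2.inner_def]
  apply integral_congr_ae
  filter_upwards [mulSymbol_ae hc α hs f, mulSymbol_ae hc α hs g] with ξ h1 h2
  rw [h1, h2]
  simp; ring

theorem enorm_symbol_rpow {c : ℝ} (hc : c ≠ 0) (α s : ℝ) (ξ : Plane) :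
    ‖((symbol c α ξ ^ (-s / 2) : ℝ) : ℂ)‖ₑ ^ 2 = ENNReal.ofReal (symbol c α ξ) ^ (-s) := by
  have hp := symbol_pos hc α ξ
  rw [← ofReal_norm, Complex.norm_real, Real.norm_eq_abs, abs_of_pos (Real.rpow_pos_of_pos hp _),
    ← ENNReal.ofReal_rpow_of_pos hp, ← ENNReal.rpow_natCast, ← ENNReal.rpow_mul]
  congr 1; push_cast; ring

/-! ### The anisotropic Sobolev embedding -/

/-- Distributional estimate for the smoothing operator: low frequencies are bounded, high
frequencies are estimated in `L²`. -/
theorem volume_lt_smoothing_le {c α s C M l : ℝ} (hc : c ≠ 0) (hs0 : 0 ≤ s) (hl : 0 < l)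
    (hC : ∫⁻ ξ, Set.indicator {ξ | symbol c α ξ ≤ M}
      (fun ξ => ENNReal.ofReal (symbol c α ξ) ^ (-s)) ξ ≤ ENNReal.ofReal C)
    (hCl : C ≤ (l / 2) ^ 2) {h : L2} (hh : ‖h‖ₑ ≤ 1) :
    volume {z | l < ‖smoothing hc α hs0 h z‖} ≤ ENNReal.ofReal (4 / l ^ 2) *
      ∫⁻ ξ, Set.indicator {ξ | M < symbol c α ξ}
        (fun ξ => ENNReal.ofReal (symbol c α ξ) ^ (-s) * ‖h ξ‖ₑ ^ 2) ξ := by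
  set u := mulSymbol hc α hs0 h
  have hu := mulSymbol_ae hc α hs0 h
  set A := {ξ | symbol c α ξ ≤ M}
  have hA : MeasurableSet A := measurableSet_le (measurable_symbol c α) measurable_const
  have m1 : MemLp (A.indicator u) 2 := (Lp.memLp u).indicator hA
  have m2 : MemLp (Aᶜ.indicator u) 2 := (Lp.memLp u).indicator hA.compl
  have hmeas : Measurable fun ξ => ((symbol c α ξ ^ (-s / 2) : ℝ) : ℂ) :=
    Complex.measurable_ofReal.comp ((measurable_symbol c α).pow_const _)
  -- Cauchy–Schwarz on the low frequencies: a^{−s} has integral at most (l/2)² there, so the inverse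
  -- transform of this part is bounded by l/2 everywhere.
  have hL1 : ∫⁻ ξ, ‖A.indicator u ξ‖ₑ ≤ ENNReal.ofReal (l / 2) := by
    calc _ = ∫⁻ ξ, ((A.indicator (fun ξ => ‖((symbol c α ξ ^ (-s / 2) : ℝ) : ℂ)‖ₑ))
          * (fun ξ => ‖h ξ‖ₑ)) ξ := by
          apply lintegral_congr_ae
          filter_upwards [hu] with ξ h1
          by_cases hξ : ξ ∈ A
          · rw [Set.indicator_of_mem hξ, Pi.mul_apply, Set.indicator_of_mem hξ, h1, enorm_mul]
          · rw [Set.indicator_of_notMem hξ, Pi.mul_apply, Set.indicator_of_notMem hξ]; simp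
      _ ≤ (∫⁻ ξ, A.indicator (fun ξ => ‖((symbol c α ξ ^ (-s / 2) : ℝ) : ℂ)‖ₑ) ξ ^ (2 : ℝ)) ^ (1 / 2 : ℝ)
          * (∫⁻ ξ, ‖h ξ‖ₑ ^ (2 : ℝ)) ^ (1 / 2 : ℝ) := by
          refine ENNReal.lintegral_mul_le_Lp_mul_Lq volume Real.HolderConjugate.two_two ?_ ?_
          · exact (hmeas.enorm.indicator hA).aemeasurable
          · exact (Lp.aestronglyMeasurable h).enorm
      _ ≤ (ENNReal.ofReal C) ^ (1 / 2 : ℝ) * 1 := by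
          gcongr
          · refine le_trans (lintegral_mono fun ξ => ?_) hC
            by_cases hξ : ξ ∈ A
            · rw [Set.indicator_of_mem hξ, Set.indicator_of_mem (by exact hξ), ← enorm_symbol_rpow hc]
              norm_cast
            · rw [Set.indicator_of_notMem hξ]; simp
          · have := lintegral_enorm_sq h
            have e : ∫⁻ ξ, ‖h ξ‖ₑ ^ (2 : ℝ) = ‖h‖ₑ ^ 2 := by rw [← this]; norm_cast
            rw [e]
            exact ENNReal.rpow_le_one (pow_le_one₀ (by simp) hh) (by norm_num)
      _ ≤ ENNReal.ofReal (l / 2) := by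
          rw [mul_one]
          calc _ ≤ (ENNReal.ofReal ((l / 2) ^ 2)) ^ (1 / 2 : ℝ) := by gcongr
            _ = _ := by
              rw [ENNReal.ofReal_pow (by positivity), ← ENNReal.rpow_natCast, ← ENNReal.rpow_mul]
              norm_num
  have hi : Integrable (A.indicator u) :=
    ⟨m1.1, (hL1.trans_lt ENNReal.ofReal_lt_top)⟩
  have hsum : u = m1.toLp _ + m2.toLp _ := by
    rw [← MemLp.toLp_add m1 m2]
    apply Lp.ext
    filter_upwards [(m1.add m2).coeFn_toLp] with ξ h1
    rw [h1, Set.indicator_self_add_compl]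
  -- Where the sum exceeds l, the high-frequency part is at least l/2; Plancherel and Chebyshev then
  -- bound the measure of that set.
  have hle : ∀ᵐ z, l < ‖smoothing hc α hs0 h z‖ → ENNReal.ofReal ((l / 2) ^ 2)
      ≤ ‖(𝓕⁻ (m2.toLp _) : L2) z‖ₑ ^ 2 := by
    have hE : smoothing hc α hs0 h = (𝓕⁻ (m1.toLp _) : L2) + 𝓕⁻ (m2.toLp _) := by
      rw [smoothing_apply, ← FourierTransform.fourierInv_add, ← hsum]
    rw [hE]
    filter_upwards [lp_fourierInv_ae_eq hi m1, Lp.coeFn_add (𝓕⁻ (m1.toLp _) : L2) (𝓕⁻ (m2.toLp _))]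
      with z h1 h2 hlt
    rw [h2, Pi.add_apply, h1] at hlt
    have h3 : ‖𝓕⁻ (A.indicator u) z‖ ≤ l / 2 := by
      refine (norm_fourierInv_le _ _).trans ?_
      rw [integral_norm_eq_lintegral_enorm m1.1]
      exact ENNReal.toReal_le_of_le_ofReal (by positivity) hL1
    have h4 := norm_add_le (𝓕⁻ (A.indicator u) z) ((𝓕⁻ (m2.toLp _) : L2) z)
    rw [← ofReal_norm, ← ENNReal.ofReal_pow (norm_nonneg _)]
    apply ENNReal.ofReal_le_ofReal
    have : l / 2 ≤ ‖(𝓕⁻ (m2.toLp _) : L2) z‖ := by linarith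
    gcongr
  have hL2 : ∫⁻ z, ‖(𝓕⁻ (m2.toLp _) : L2) z‖ₑ ^ 2 = ∫⁻ ξ, Set.indicator {ξ | M < symbol c α ξ}
        (fun ξ => ENNReal.ofReal (symbol c α ξ) ^ (-s) * ‖h ξ‖ₑ ^ 2) ξ := by
    rw [lintegral_enorm_sq, enorm_fourierInv, ← lintegral_enorm_sq]
    apply lintegral_congr_ae
    filter_upwards [m2.coeFn_toLp, hu] with ξ h1 h2
    have hAc : Aᶜ = {ξ | M < symbol c α ξ} := by ext; simp [A]
    rw [h1, hAc]
    by_cases hξ : M < symbol c α ξ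
    · rw [Set.indicator_of_mem (by exact hξ), Set.indicator_of_mem (by exact hξ), h2, enorm_mul, mul_pow,
        enorm_symbol_rpow hc]
    · rw [Set.indicator_of_notMem (by exact hξ), Set.indicator_of_notMem (by exact hξ)]; simp
  rw [← hL2]
  have hch := mul_meas_ge_le_lintegral₀ (μ := volume)
    (f := fun z => ‖(𝓕⁻ (m2.toLp _) : L2) z‖ₑ ^ 2)
    ((Lp.aestronglyMeasurable _).enorm.pow_const 2) (ENNReal.ofReal ((l / 2) ^ 2))
  have hmono : volume {z | l < ‖smoothing hc α hs0 h z‖}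
      ≤ volume {z | ENNReal.ofReal ((l / 2) ^ 2) ≤ ‖(𝓕⁻ (m2.toLp _) : L2) z‖ₑ ^ 2} :=
    measure_mono_ae (by filter_upwards [hle] with z hz using hz)
  calc _ = ENNReal.ofReal (4 / l ^ 2) * (ENNReal.ofReal ((l / 2) ^ 2) *
        volume {z | l < ‖smoothing hc α hs0 h z‖}) := by
        rw [← mul_assoc, ← ENNReal.ofReal_mul (by positivity)]
        have : 4 / l ^ 2 * (l / 2) ^ 2 = 1 := by field_simp; norm_num
        rw [this, ENNReal.ofReal_one, one_mul]
    _ ≤ _ := by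
        gcongr
        exact (mul_le_mul_right hmono _).trans hch

theorem lintegral_Ioi_indicator_rpow {Λ r : ℝ} (hΛ : 0 < Λ) (hr : -1 < r) :
    ∫⁻ l in Set.Ioi (0 : ℝ), (Set.Iio Λ).indicator (fun l => ENNReal.ofReal (l ^ r)) l
      = ENNReal.ofReal (Λ ^ (r + 1) / (r + 1)) := by
  rw [setLIntegral_indicator measurableSet_Iio]
  have : Set.Iio Λ ∩ Set.Ioi 0 = Set.Ioo 0 Λ := by ext; simp [and_comm]
  rw [this, ← restrict_Ioo_eq_restrict_Ioc.symm.trans rfl]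
  have hi : IntegrableOn (fun t : ℝ => t ^ r) (Set.Ioc 0 Λ) :=
    (intervalIntegrable_iff_integrableOn_Ioc_of_le hΛ.le).1
      (intervalIntegral.intervalIntegrable_rpow' hr)
  rw [← ofReal_integral_eq_lintegral_ofReal hi, ← intervalIntegral.integral_of_le hΛ.le,
    integral_rpow (Or.inl hr), Real.zero_rpow (by linarith), sub_zero]
  filter_upwards [ae_restrict_mem measurableSet_Ioc] with t ht
  exact Real.rpow_nonneg ht.1.le _

/-- Layer-cake formula with a frequency cutoff that depends on the level l. After exchanging the
integrals, the integral over levels gives a^s, which cancels the a^{−s} of the multiplier and leaves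
the L² norm of h. -/
theorem exists_lintegral_smoothing_le_of_enorm_le_one {c α s : ℝ} (hc : c ≠ 0) (hα : α ≠ 0)
    (hs0 : 0 < s) (hs : s < 3 / 2) :
    ∃ C : ℝ≥0∞, C ≠ ⊤ ∧ ∀ h : L2, ‖h‖ₑ ≤ 1 →
      ∫⁻ z, ‖smoothing hc α hs0.le h z‖ₑ ^ (6 / (3 - 2 * s)) ≤ C := by
  obtain ⟨D, hD, hbound⟩ := lintegral_symbol_rpow_le (c := c) hα hs0 hs
  set q : ℝ := 6 / (3 - 2 * s)
  have h3 : 0 < 3 - 2 * s := by linarith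
  have hq : 2 < q := by rw [lt_div_iff₀ h3]; linarith
  set K : ℝ := q * (4 * ((4 * D) ^ ((q - 2) / 2) / (q - 2)))
  refine ⟨ENNReal.ofReal K, ENNReal.ofReal_ne_top, fun h hh => ?_⟩
  set f := smoothing hc α hs0.le h
  set Λ : Plane → ℝ := fun ξ => (4 * D * symbol c α ξ ^ (3 / 2 - s)) ^ (1 / 2 : ℝ)
  have hΛ : ∀ ξ, 0 < Λ ξ := fun ξ => by have := symbol_pos hc α ξ; positivity
  have hΛm : Measurable Λ := by
    have := measurable_symbol c α
    simp only [Λ]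
    fun_prop
  set W : Plane → ℝ≥0∞ := fun ξ => ENNReal.ofReal (symbol c α ξ) ^ (-s) * ‖h ξ‖ₑ ^ 2
  have hWm : Measurable W := by
    have h1 := measurable_symbol c α
    have h2 := (Lp.stronglyMeasurable h).measurable
    fun_prop
  have hpt : ∀ l : ℝ, 0 < l → volume {z | l < ‖f z‖} * ENNReal.ofReal (l ^ (q - 1)) ≤
      ∫⁻ ξ, 4 * (W ξ * (Set.Iio (Λ ξ)).indicator (fun l => ENNReal.ofReal (l ^ (q - 3))) l) := by
    intro l hl
    -- The cutoff solves D M^{3/2−s} = (l/2)², the largest for which the low frequencies are known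
    -- to contribute at most l/2.
    set M : ℝ := ((l / 2) ^ 2 / D) ^ (1 / (3 / 2 - s))
    have hM : 0 < M := by positivity
    have hMp : D * M ^ (3 / 2 - s) = (l / 2) ^ 2 := by
      rw [← Real.rpow_mul (by positivity), one_div, inv_mul_cancel₀ (by linarith), Real.rpow_one]
      field_simp
    have hv := volume_lt_smoothing_le (c := c) (α := α) hc hs0.le hl (hbound M hM) hMp.le hh
    calc _ ≤ (ENNReal.ofReal (4 / l ^ 2) * ∫⁻ ξ, Set.indicator {ξ | M < symbol c α ξ} W ξ)
          * ENNReal.ofReal (l ^ (q - 1)) := mul_le_mul_left hv _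
      _ = 4 * ENNReal.ofReal (l ^ (q - 3)) * ∫⁻ ξ, Set.indicator {ξ | M < symbol c α ξ} W ξ := by
          rw [mul_right_comm, ← ENNReal.ofReal_mul (by positivity)]
          congr 1
          rw [show (4 : ℝ≥0∞) = ENNReal.ofReal 4 by norm_num, ← ENNReal.ofReal_mul (by norm_num)]
          congr 1
          rw [show q - 1 = (q - 3) + (2 : ℕ) by push_cast; ring, Real.rpow_add_natCast hl.ne']
          field_simp
      _ = ∫⁻ ξ, 4 * ENNReal.ofReal (l ^ (q - 3)) * Set.indicator {ξ | M < symbol c α ξ} W ξ := by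
          rw [lintegral_const_mul]
          exact hWm.indicator (measurableSet_lt measurable_const (measurable_symbol c α))
      _ ≤ _ := by
          refine lintegral_mono fun ξ => ?_
          by_cases hξ : M < symbol c α ξ
          · have hlt : l < Λ ξ := by
              have h1 : M ^ (3 / 2 - s) < symbol c α ξ ^ (3 / 2 - s) :=
                Real.rpow_lt_rpow hM.le hξ (by linarith)
              have h2 : l ^ 2 < 4 * D * symbol c α ξ ^ (3 / 2 - s) := by nlinarith
              simp only [Λ]
              rw [← Real.sqrt_eq_rpow]
              exact Real.lt_sqrt_of_sq_lt h2
            rw [Set.indicator_of_mem (by exact hξ), Set.indicator_of_mem (by exact hlt)]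
            apply le_of_eq; ring
          · rw [Set.indicator_of_notMem (by exact hξ)]; simp
  have hf : AEStronglyMeasurable f := Lp.aestronglyMeasurable f
  calc ∫⁻ z, ‖f z‖ₑ ^ q = ∫⁻ z, ENNReal.ofReal (‖f z‖ ^ q) := by
        congr 1; ext z
        rw [← ofReal_norm, ENNReal.ofReal_rpow_of_nonneg (norm_nonneg _) (by linarith)]
    _ = ENNReal.ofReal q * ∫⁻ l in Set.Ioi 0, volume {z | l < ‖f z‖} * ENNReal.ofReal (l ^ (q - 1)) :=
        lintegral_rpow_eq_lintegral_meas_lt_mul volume (Eventually.of_forall fun z => norm_nonneg _)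
          hf.norm.aemeasurable (by linarith)
    _ ≤ ENNReal.ofReal q * ∫⁻ l in Set.Ioi (0 : ℝ), ∫⁻ ξ, 4 * (W ξ *
          (Set.Iio (Λ ξ)).indicator (fun l => ENNReal.ofReal (l ^ (q - 3))) l) := by
        gcongr ENNReal.ofReal q * ?_
        exact setLIntegral_mono' measurableSet_Ioi fun l hl => hpt l hl
    _ = ENNReal.ofReal q * ∫⁻ ξ, ∫⁻ l in Set.Ioi (0 : ℝ), 4 * (W ξ *
          (Set.Iio (Λ ξ)).indicator (fun l => ENNReal.ofReal (l ^ (q - 3))) l) := by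
        rw [lintegral_lintegral_swap]
        apply Measurable.aemeasurable
        have hset : MeasurableSet {p : ℝ × Plane | p.1 < Λ p.2} :=
          measurableSet_lt measurable_fst (hΛm.comp measurable_snd)
        have hg : Measurable fun p : ℝ × Plane => ENNReal.ofReal (p.1 ^ (q - 3)) := by fun_prop
        have hind := hg.indicator hset
        exact ((hWm.comp measurable_snd).mul hind).const_mul 4
    _ = ENNReal.ofReal q * ∫⁻ ξ, ENNReal.ofReal (4 * ((4 * D) ^ ((q - 2) / 2) / (q - 2))) * ‖h ξ‖ₑ ^ 2 := by
        congr 2; ext ξ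
        have hp := symbol_pos hc α ξ
        have hmi : Measurable ((Set.Iio (Λ ξ)).indicator (fun l => ENNReal.ofReal (l ^ (q - 3)))) :=
          Measurable.indicator (by fun_prop) measurableSet_Iio
        rw [lintegral_const_mul _ (hmi.const_mul _), lintegral_const_mul _ hmi,
          lintegral_Ioi_indicator_rpow (hΛ ξ) (by linarith)]
        -- Here q = 6/(3−2s) is forced: Λ^{q−2} carries the power (3/2−s)(q−2)/2 of the symbol, and
        -- this equals s.
        have he : Λ ξ ^ (q - 3 + 1) = (4 * D) ^ ((q - 2) / 2) * symbol c α ξ ^ s := by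
          simp only [Λ]
          rw [← Real.rpow_mul (by positivity), Real.mul_rpow (by positivity) (by positivity),
            ← Real.rpow_mul hp.le]
          congr 2
          · ring
          · simp only [q]; field_simp; ring
        rw [he]
        simp only [W]
        have hneg : ENNReal.ofReal (symbol c α ξ) ^ (-s) = ENNReal.ofReal (symbol c α ξ ^ (-s)) :=
          ENNReal.ofReal_rpow_of_pos hp
        have h4 : (4 : ℝ≥0∞) = ENNReal.ofReal 4 := by norm_num
        have hq2 : 0 < q - 2 := by linarith
        have hq3 : q - 3 + 1 = q - 2 := by ring
        rw [hneg, mul_right_comm, h4, ← ENNReal.ofReal_mul (by positivity), ← mul_assoc,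
          ← ENNReal.ofReal_mul (by positivity), hq3]
        congr 2
        rw [Real.rpow_neg hp.le]
        have : symbol c α ξ ^ s ≠ 0 := (Real.rpow_pos_of_pos hp s).ne'
        field_simp
    _ ≤ ENNReal.ofReal K := by
        rw [lintegral_const_mul]
        · rw [lintegral_enorm_sq, ← mul_assoc, ← ENNReal.ofReal_mul (by linarith)]
          exact mul_le_of_le_one_right (zero_le) (pow_le_one₀ (by simp) hh)
        · have h2 := (Lp.stronglyMeasurable h).measurable
          fun_prop

/-- The anisotropic Sobolev embedding: the smoothing operator of order `s` maps `L²` to `L^q`,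
`1/q = 1/2 - s/3`. -/
theorem exists_lintegral_smoothing_le {c α s : ℝ} (hc : c ≠ 0) (hα : α ≠ 0)
    (hs0 : 0 < s) (hs : s < 3 / 2) :
    ∃ C : ℝ≥0∞, C ≠ ⊤ ∧ ∀ h : L2,
      ∫⁻ z, ‖smoothing hc α hs0.le h z‖ₑ ^ (6 / (3 - 2 * s)) ≤ C * ‖h‖ₑ ^ (6 / (3 - 2 * s)) := by
  obtain ⟨C, hC, hb⟩ := exists_lintegral_smoothing_le_of_enorm_le_one hc hα hs0 hs
  refine ⟨C, hC, fun h => ?_⟩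
  have hq : 0 < 6 / (3 - 2 * s) := div_pos (by norm_num) (by linarith)
  rcases eq_or_ne h 0 with rfl | hne
  · rw [map_zero]
    have : ∫⁻ z, ‖((0 : L2) : Plane → ℂ) z‖ₑ ^ (6 / (3 - 2 * s)) = 0 := by
      rw [lintegral_eq_zero_iff' ((Lp.aestronglyMeasurable _).enorm.pow_const _)]
      filter_upwards [Lp.coeFn_zero ℂ 2 (volume : Measure Plane)] with z hz
      rw [hz]; simp [hq]
    rw [this]; exact zero_le
  · have hn : (‖h‖ : ℂ) ≠ 0 := by simpa using hne
    set g : L2 := (‖h‖ : ℂ)⁻¹ • h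
    have hg : ‖g‖ₑ ≤ 1 := by
      rw [← ofReal_norm, norm_smul, norm_inv, Complex.norm_real, norm_norm,
        inv_mul_cancel₀ (norm_ne_zero_iff.2 hne)]; simp
    have hh : h = (‖h‖ : ℂ) • g := by simp only [g]; rw [smul_smul, mul_inv_cancel₀ hn, one_smul]
    calc _ = ∫⁻ z, ‖h‖ₑ ^ (6 / (3 - 2 * s)) * ‖smoothing hc α hs0.le g z‖ₑ ^ (6 / (3 - 2 * s)) := by
          have e : smoothing hc α hs0.le h = (‖h‖ : ℂ) • smoothing hc α hs0.le g := by
            rw [← map_smul, ← hh]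
          rw [e]
          apply lintegral_congr_ae
          filter_upwards [Lp.coeFn_smul (‖h‖ : ℂ) (smoothing hc α hs0.le g)] with z hz
          rw [hz, Pi.smul_apply, enorm_smul, ENNReal.mul_rpow_of_nonneg _ _ hq.le]
          congr 2
          rw [← ofReal_norm, ← ofReal_norm, Complex.norm_real, norm_norm]
      _ ≤ _ := by
          rw [lintegral_const_mul'' _ ((Lp.aestronglyMeasurable _).enorm.pow_const _), mul_comm]
          exact mul_le_mul_left (hb g hg) _

/-! ### The energy space and the equation on the Fourier side -/

theorem exists_symbol_le (c α : ℝ) : ∃ C : ℝ, 0 ≤ C ∧ ∀ ξ, symbol c α ξ ≤ C * (1 + ‖ξ‖ ^ 2) := by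
  refine ⟨|c| + |α| * (2 * Real.pi) + (2 * Real.pi) ^ 2, by positivity, fun ξ => ?_⟩
  have h0 := abs_coord_le ξ 0
  have h1 := abs_coord_le ξ 1
  have e0 : |2 * Real.pi * ξ 0| ≤ 2 * Real.pi * (1 + ‖ξ‖ ^ 2) := by
    rw [abs_mul, abs_of_pos Real.two_pi_pos]
    gcongr
    nlinarith [sq_nonneg (‖ξ‖ - 1)]
  have e1 : (2 * Real.pi * ξ 1) ^ 2 ≤ (2 * Real.pi) ^ 2 * (1 + ‖ξ‖ ^ 2) := by
    rw [mul_pow, ← sq_abs (ξ 1)]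
    gcongr
    nlinarith [abs_nonneg (ξ 1)]
  have e2 : |α| * |2 * Real.pi * ξ 0| ≤ |α| * (2 * Real.pi * (1 + ‖ξ‖ ^ 2)) :=
    mul_le_mul_of_nonneg_left e0 (abs_nonneg _)
  unfold symbol
  nlinarith [mul_nonneg (abs_nonneg c) (sq_nonneg ‖ξ‖)]

/-- Multiplication by a measurable function of quadratic growth keeps transforms of test
functions in every `L^p`. -/
theorem IsTest.memLp_mul_ftReal {v : Plane → ℝ} (hv : IsTest v) {m : Plane → ℝ}
    (hm : Measurable m) {C : ℝ} (hC : ∀ ξ, |m ξ| ≤ C * (1 + ‖ξ‖ ^ 2)) (p : ℝ≥0∞) :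
    MemLp (fun ξ => (m ξ : ℂ) * ftReal v ξ) p := by
  rw [hv.ftReal_eq]
  have hg : (fun ξ : Plane => ((1 + ‖ξ‖ ^ 2 : ℝ))).HasTemperateGrowth := by fun_prop
  refine ((SchwartzMap.smulLeftCLM ℂ (fun ξ : Plane => ((1 + ‖ξ‖ ^ 2 : ℝ)))
    (𝓕 hv.schwartz)).memLp p).of_le_mul (c := C) ?_ ?_
  · exact (Complex.measurable_ofReal.comp hm).aestronglyMeasurable.mul
      (SchwartzMap.continuous _).aestronglyMeasurable
  · refine Eventually.of_forall fun ξ => ?_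
    rw [SchwartzMap.smulLeftCLM_apply_apply hg, norm_mul, norm_smul, Complex.norm_real, ← mul_assoc]
    refine mul_le_mul_of_nonneg_right ?_ (norm_nonneg _)
    rw [Real.norm_of_nonneg (by positivity : (0 : ℝ) ≤ 1 + ‖ξ‖ ^ 2)]
    exact hC ξ

theorem IsTest.memLp_symbol_mul_ftReal {v : Plane → ℝ} (hv : IsTest v) {c : ℝ} (hc : c ≠ 0)
    (α : ℝ) (p : ℝ≥0∞) : MemLp (fun ξ => (symbol c α ξ : ℂ) * ftReal v ξ) p := by
  obtain ⟨C, -, hC⟩ := exists_symbol_le c α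
  refine hv.memLp_mul_ftReal (measurable_symbol c α) (C := C) (fun ξ => ?_) p
  rw [abs_of_pos (symbol_pos hc α ξ)]
  exact hC ξ

theorem IsTest.memLp_sqrt_symbol_mul_ftReal {v : Plane → ℝ} (hv : IsTest v) {c : ℝ} (hc : c ≠ 0)
    (α : ℝ) (p : ℝ≥0∞) :
    MemLp (fun ξ => ((symbol c α ξ ^ (1 / 2 : ℝ) : ℝ) : ℂ) * ftReal v ξ) p := by
  obtain ⟨C, hC0, hC⟩ := exists_symbol_le c α
  refine hv.memLp_mul_ftReal ((measurable_symbol c α).pow_const _) (C := 1 + C) (fun ξ => ?_) p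
  have hp := symbol_pos hc α ξ
  rw [abs_of_pos (Real.rpow_pos_of_pos hp _), ← Real.sqrt_eq_rpow]
  refine (Real.sqrt_le_iff.2 ⟨by positivity, ?_⟩ : √(symbol c α ξ) ≤ 1 + symbol c α ξ).trans ?_
  · nlinarith
  · nlinarith [hC ξ, sq_nonneg ‖ξ‖]

theorem IsTest.memLp {v : Plane → ℝ} (hv : IsTest v) (p : ℝ≥0∞) :
    MemLp (fun z => (v z : ℂ)) p := by
  have := hv.schwartz.memLp p
  exact this

theorem MemZ.memLp {φ : Plane → ℝ} (h : MemZ φ) : MemLp (fun z => (φ z : ℂ)) 2 := by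
  obtain ⟨u, hu, hm, -⟩ := h 1 one_pos
  have := hm.add (hu.memLp 2)
  refine this.ae_eq (Eventually.of_forall fun z => ?_)
  simp

theorem IsTest.fourier_toLp {v : Plane → ℝ} (hv : IsTest v) :
    (𝓕 ((hv.memLp 2).toLp _) : L2) =ᵐ[volume] ftReal v :=
  lp_fourier_ae_eq (memLp_one_iff_integrable.1 (hv.memLp 1)) (hv.memLp 2)

/-- For `φ` in the energy space, `(symbol)^{1/2} φ̂` is square integrable. -/
theorem MemZ.memLp_sqrt_symbol {φ : Plane → ℝ} (h : MemZ φ) {c : ℝ} (hc : c ≠ 0) (α : ℝ) :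
    MemLp (fun ξ => ((symbol c α ξ ^ (1 / 2 : ℝ) : ℝ) : ℂ) * (𝓕 (h.memLp.toLp _) : L2) ξ) 2 := by
  -- Any finite bound would do: φ differs by a function of finite Z-norm from a test function, whose
  -- transform decays rapidly.
  obtain ⟨u, hu, hm, hz⟩ := h 1 one_pos
  set f : L2 := 𝓕 (hm.toLp _)
  have hsm : Measurable fun ξ => ((symbol c α ξ ^ (1 / 2 : ℝ) : ℝ) : ℂ) :=
    Complex.measurable_ofReal.comp ((measurable_symbol c α).pow_const _)
  have h1 : MemLp (fun ξ => ((symbol c α ξ ^ (1 / 2 : ℝ) : ℝ) : ℂ) * f ξ) 2 := by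
    refine ⟨hsm.aestronglyMeasurable.mul (Lp.aestronglyMeasurable f), ?_⟩
    rw [eLpNorm_lt_top_iff_lintegral_rpow_enorm_lt_top (by norm_num) (by norm_num)]
    have hfm := (Lp.stronglyMeasurable f).measurable
    have hz' := hz.trans ENNReal.one_lt_top
    rw [zNormSq, ENNReal.add_lt_top, ENNReal.add_lt_top] at hz'
    obtain ⟨⟨-, z1⟩, z0⟩ := hz'
    have zz : ∫⁻ ξ, ‖f ξ‖ₑ ^ 2 < ⊤ := by
      rw [lintegral_enorm_sq]; simp
    calc _ = ∫⁻ ξ : Plane, ((ENNReal.ofReal |c| * ‖f ξ‖ₑ ^ 2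
          + ENNReal.ofReal |α| * (‖2 * Real.pi * ξ 0‖ₑ * ‖f ξ‖ₑ ^ 2))
          + ‖2 * Real.pi * ξ 1‖ₑ ^ 2 * ‖f ξ‖ₑ ^ 2) := by
          congr 1; ext ξ
          have hp := symbol_pos hc α ξ
          have e1 : ‖((symbol c α ξ ^ (1 / 2 : ℝ) : ℝ) : ℂ)‖ₑ ^ 2 = ENNReal.ofReal (symbol c α ξ) := by
            rw [← ofReal_norm, Complex.norm_real, Real.norm_of_nonneg (by positivity),
              ← ENNReal.ofReal_pow (by positivity), ← Real.rpow_natCast, ← Real.rpow_mul hp.le]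
            norm_num
          have e2 : ENNReal.ofReal (symbol c α ξ) = ENNReal.ofReal |c| +
              ENNReal.ofReal |α| * ‖2 * Real.pi * ξ 0‖ₑ + ‖2 * Real.pi * ξ 1‖ₑ ^ 2 := by
            rw [symbol, ENNReal.ofReal_add (by positivity) (by positivity),
              ENNReal.ofReal_add (by positivity) (by positivity), ENNReal.ofReal_mul (by positivity),
              ← sq_abs, ENNReal.ofReal_pow (by positivity)]
            simp only [← Real.norm_eq_abs, ofReal_norm]
          have e3 : ‖((symbol c α ξ ^ (1 / 2 : ℝ) : ℝ) : ℂ) * f ξ‖ₑ ^ (ENNReal.toReal 2)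
              = ‖((symbol c α ξ ^ (1 / 2 : ℝ) : ℝ) : ℂ)‖ₑ ^ 2 * ‖f ξ‖ₑ ^ 2 := by
            rw [← mul_pow, ← enorm_mul, ← ENNReal.rpow_natCast]; norm_num
          rw [e3, e1, e2]; ring
      _ = ENNReal.ofReal |c| * (∫⁻ ξ, ‖f ξ‖ₑ ^ 2)
          + ENNReal.ofReal |α| * (∫⁻ ξ : Plane, ‖2 * Real.pi * ξ 0‖ₑ * ‖f ξ‖ₑ ^ 2)
          + ∫⁻ ξ : Plane, ‖2 * Real.pi * ξ 1‖ₑ ^ 2 * ‖f ξ‖ₑ ^ 2 := by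
          have m0 : Measurable fun ξ : Plane => ‖2 * Real.pi * ξ 0‖ₑ := by fun_prop
          rw [lintegral_add_left (by fun_prop), lintegral_add_left (by fun_prop),
            lintegral_const_mul _ (by fun_prop), lintegral_const_mul _ (by fun_prop)]
      _ < ⊤ := ENNReal.add_lt_top.2 ⟨ENNReal.add_lt_top.2
          ⟨ENNReal.mul_lt_top ENNReal.ofReal_lt_top zz, ENNReal.mul_lt_top ENNReal.ofReal_lt_top z0⟩, z1⟩
  refine (h1.add (hu.memLp_sqrt_symbol_mul_ftReal hc α 2)).ae_eq ?_
  have hsum : (h.memLp.toLp _ : L2) = hm.toLp _ + (hu.memLp 2).toLp _ := by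
    rw [← MemLp.toLp_add]
    apply Lp.ext
    filter_upwards [h.memLp.coeFn_toLp, (hm.add (hu.memLp 2)).coeFn_toLp] with z e1 e2
    rw [e1, e2]; simp
  have hsum2 : (𝓕 (h.memLp.toLp _) : L2) = f + 𝓕 ((hu.memLp 2).toLp _) := by
    rw [hsum, FourierTransform.fourier_add]
  rw [hsum2]
  filter_upwards [Lp.coeFn_add f (𝓕 ((hu.memLp 2).toLp _)), hu.fourier_toLp] with ξ e1 e2
  rw [e1, Pi.add_apply, Pi.add_apply, e2]; ring

theorem integral_mul_eq_fourier {φ : Plane → ℝ} (hφ : MemLp (fun z => (φ z : ℂ)) 2) {w : Plane → ℝ}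
    {M : Plane → ℂ} (h1 : MemLp M 1) (h2 : MemLp M 2) (hw : ∀ z, (w z : ℂ) = 𝓕⁻ M z) :
    ((∫ z, φ z * w z : ℝ) : ℂ) = ∫ ξ, starRingEnd ℂ ((𝓕 (hφ.toLp _) : L2) ξ) * M ξ := by
  rw [← integral_mul_fourierInv hφ (memLp_one_iff_integrable.1 h1) h2, ← integral_complex_ofReal]
  congr 1; ext z; rw [← hw]; push_cast; rfl

theorem integrable_star_mul (f : L2) {M : Plane → ℂ} (h2 : MemLp M 2) :
    Integrable fun ξ => starRingEnd ℂ (f ξ) * M ξ :=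
  (Lp.memLp f).star.integrable_mul h2

/-- The equation on the Fourier side, tested with real test functions. -/
theorem IsSolitaryWave.exists_weak_fourier {c α ε : ℝ} (hε : ε = 1 ∨ ε = -1) (hαε : α * ε < 0)
    (hcα : c * α < 0) {p : ℚ} {φ : Plane → ℝ} (h : IsSolitaryWave c α ε p φ) :
    ∃ κ : ℝ, ∀ v, IsTest v →
      ∫ ξ, starRingEnd ℂ ((𝓕 (h.memZ.memLp.toLp _) : L2) ξ) * ((symbol c α ξ : ℂ) * ftReal v ξ) =
        κ * ∫ z, (ratPow (p + 1) (φ z) : ℂ) * v z := by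
  -- Multiplication by ε = ±1 gives the three linear terms a common sign, since cε = |c|, αε = −|α|
  -- and ε² = 1.
  refine ⟨ε * (1 / ((p : ℝ) + 1)), fun v hv => ?_⟩
  have hweak := h.weak v hv
  set f : L2 := 𝓕 (h.memZ.memLp.toLp _)
  set G : Plane → ℂ := fun ξ => starRingEnd ℂ (f ξ)
  have hb0 : ∀ ξ : Plane, |(1 : ℝ)| ≤ 1 * (1 + ‖ξ‖ ^ 2) := fun ξ => by
    rw [abs_one]; nlinarith [sq_nonneg ‖ξ‖]
  have hb1 : ∀ ξ : Plane, |(|2 * Real.pi * ξ 0|)| ≤ 2 * Real.pi * (1 + ‖ξ‖ ^ 2) := fun ξ => by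
    have h0 := abs_coord_le ξ 0
    rw [abs_abs, abs_mul, abs_of_pos Real.two_pi_pos]
    gcongr
    nlinarith [sq_nonneg (‖ξ‖ - 1)]
  have hb2 : ∀ ξ : Plane, |-(2 * Real.pi * ξ 1) ^ 2| ≤ (2 * Real.pi) ^ 2 * (1 + ‖ξ‖ ^ 2) := fun ξ => by
    have h1 := abs_coord_le ξ 1
    rw [abs_neg, abs_pow, sq_abs, mul_pow, ← sq_abs (ξ 1)]
    gcongr
    nlinarith [abs_nonneg (ξ 1)]
  have m0 := fun q => hv.memLp_mul_ftReal measurable_const hb0 q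
  have m1 := fun q => hv.memLp_mul_ftReal (by fun_prop) hb1 q
  have m2 := fun q => hv.memLp_mul_ftReal (by fun_prop) hb2 q
  have e0 := integral_mul_eq_fourier h.memZ.memLp (w := v) (m0 1) (m0 2) (fun z => by
    simp only [Complex.ofReal_one, one_mul]; exact (hv.fourierInv_ftReal z).symm)
  have e1 := integral_mul_eq_fourier h.memZ.memLp (m1 1) (m1 2) hv.hilbertX_partialD
  have e2 := integral_mul_eq_fourier h.memZ.memLp (w := partialD 1 (partialD 1 v)) (m2 1) (m2 2)
    (fun z => by
      rw [← ((hv.partialD 1).partialD 1).fourierInv_ftReal z]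
      refine congrArg (fun M : Plane → ℂ => 𝓕⁻ M z) (funext fun ξ => ?_)
      rw [(hv.partialD 1).ftReal_partialD, hv.ftReal_partialD]
      push_cast
      linear_combination ((2 * Real.pi * ξ 1) ^ 2 * ftReal v ξ) * Complex.I_sq)
  have i0 := integrable_star_mul f (m0 2)
  have i1 := integrable_star_mul f (m1 2)
  have i2 := integrable_star_mul f (m2 2)
  have e3 : ((∫ z, ratPow (p + 1) (φ z) * v z : ℝ) : ℂ) = ∫ z, (ratPow (p + 1) (φ z) : ℂ) * v z := by
    rw [← integral_complex_ofReal]; congr 1; ext z; push_cast; rfl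
  have hc := congrArg (fun x : ℝ => (x : ℂ)) hweak
  push_cast at hc
  rw [e0, e1, e2, e3] at hc
  have hsplit : ∫ ξ, G ξ * ((symbol c α ξ : ℂ) * ftReal v ξ) =
      (|c| : ℝ) * (∫ ξ, G ξ * (((1 : ℝ) : ℂ) * ftReal v ξ))
      + (|α| : ℝ) * (∫ ξ : Plane, G ξ * (((|2 * Real.pi * ξ 0| : ℝ) : ℂ) * ftReal v ξ))
      - ∫ ξ : Plane, G ξ * (((-(2 * Real.pi * ξ 1) ^ 2 : ℝ) : ℂ) * ftReal v ξ) := by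
    rw [← integral_const_mul, ← integral_const_mul, ← integral_add (i0.const_mul _) (i1.const_mul _),
      ← integral_sub (by exact (i0.const_mul _).add (i1.const_mul _)) i2]
    congr 1; ext ξ
    simp only [symbol]; push_cast; ring
  rw [hsplit]
  rcases hε with rfl | rfl
  · have hα : α < 0 := by linarith
    have hc0 : 0 < c := by nlinarith
    rw [abs_of_neg hα, abs_of_pos hc0]
    push_cast at hc ⊢
    linear_combination -hc
  · have hα : 0 < α := by linarith
    have hc0 : c < 0 := by nlinarith
    rw [abs_of_pos hα, abs_of_neg hc0]
    push_cast at hc ⊢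
    linear_combination hc

/-! ### Potentials as operators on two scales -/

/-- A potential in `L^{3/2}` defines a bounded sesquilinear form between the spaces of orders `s`
and `t`, `s + t = 2`. -/
theorem exists_lintegral_potential_le {c α s t : ℝ} (hc : c ≠ 0) (hα : α ≠ 0)
    (hs0 : 0 < s) (hs : s < 3 / 2) (ht0 : 0 < t) (ht : t < 3 / 2) (hst : s + t = 2) :
    ∃ C : ℝ≥0∞, C ≠ ⊤ ∧ ∀ V : Plane → ℝ, AEStronglyMeasurable V volume → ∀ f g : L2,
      ∫⁻ z, ‖V z‖ₑ * (‖smoothing hc α hs0.le f z‖ₑ * ‖smoothing hc α ht0.le g z‖ₑ) ≤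
        C * (∫⁻ z, ‖V z‖ₑ ^ (3 / 2 : ℝ)) ^ (2 / 3 : ℝ) * (‖f‖ₑ * ‖g‖ₑ) := by
  obtain ⟨C, hC, hCb⟩ := exists_lintegral_smoothing_le (c := c) hc hα hs0 hs
  obtain ⟨D, hD, hDb⟩ := exists_lintegral_smoothing_le (c := c) hc hα ht0 ht
  have h3s : 0 < 3 - 2 * s := by linarith
  have h3t : 0 < 3 - 2 * t := by linarith
  set q : ℝ := 6 / (3 - 2 * s)
  set r : ℝ := 6 / (3 - 2 * t)
  have hq : 0 < q := by positivity
  have hr : 0 < r := by positivity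
  have hqi : 1 / q = (3 - 2 * s) / 6 := by simp only [q]; field_simp
  have hri : 1 / r = (3 - 2 * t) / 6 := by simp only [r]; field_simp
  refine ⟨C ^ (1 / q) * D ^ (1 / r), ENNReal.mul_ne_top (by finiteness) (by finiteness),
    fun V hV f g => ?_⟩
  set u := smoothing hc α hs0.le f
  set w := smoothing hc α ht0.le g
  -- Hölder with three factors: 2/3 + (1/2 − s/3) + (1/2 − t/3) = 1 is the condition s + t = 2.
  have hH := ENNReal.lintegral_prod_norm_pow_le (μ := volume) (Finset.univ : Finset (Fin 3))
    (f := ![fun z => ‖V z‖ₑ ^ (3 / 2 : ℝ), fun z => ‖u z‖ₑ ^ q, fun z => ‖w z‖ₑ ^ r])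
    (p := ![2 / 3, 1 / q, 1 / r]) (by
      intro i _
      fin_cases i
      · exact hV.enorm.pow_const _
      · exact (Lp.aestronglyMeasurable u).enorm.pow_const _
      · exact (Lp.aestronglyMeasurable w).enorm.pow_const _)
    (by
      rw [Fin.sum_univ_three]
      simp only [Matrix.cons_val_zero, Matrix.cons_val_one, Matrix.cons_val]
      rw [hqi, hri]; linarith)
    (by
      intro i _
      fin_cases i
      · show (0 : ℝ) ≤ 2 / 3
        norm_num
      · simpa using hq.le
      · simpa using hr.le)
  simp only [Fin.prod_univ_three, Matrix.cons_val_zero, Matrix.cons_val_one, Matrix.cons_val,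
    ← ENNReal.rpow_mul] at hH
  rw [mul_one_div_cancel hq.ne', mul_one_div_cancel hr.ne'] at hH
  norm_num only at hH
  simp only [ENNReal.rpow_one] at hH
  calc _ = ∫⁻ z, ‖V z‖ₑ * ‖u z‖ₑ * ‖w z‖ₑ := by simp_rw [mul_assoc]
    _ ≤ _ := hH
    _ ≤ (∫⁻ z, ‖V z‖ₑ ^ (3 / 2 : ℝ)) ^ (2 / 3 : ℝ) * (C * ‖f‖ₑ ^ q) ^ (1 / q)
        * (D * ‖g‖ₑ ^ r) ^ (1 / r) := by
        gcongr
        · exact hCb f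
        · exact hDb g
    _ = _ := by
        rw [ENNReal.mul_rpow_of_nonneg _ _ (by positivity : 0 ≤ 1 / q),
          ENNReal.mul_rpow_of_nonneg _ _ (by positivity : 0 ≤ 1 / r), ← ENNReal.rpow_mul,
          ← ENNReal.rpow_mul, mul_one_div_cancel hq.ne', mul_one_div_cancel hr.ne',
          ENNReal.rpow_one, ENNReal.rpow_one]
        ring

/-- Riesz representation of a bounded sesquilinear form. Formally the operator is a^{−t/2} 𝓕 V 𝓕⁻¹
a^{−s/2}, acting on the frequency side; the smallness of V enters through η. -/
theorem exists_potential_operator {c α s t : ℝ} (hc : c ≠ 0)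
    (hs0 : 0 < s) (ht0 : 0 < t) {V : Plane → ℝ} (hV : AEStronglyMeasurable V volume) {η : ℝ}
    (hη : 0 ≤ η)
    (hb : ∀ f g : L2, ∫⁻ z, ‖V z‖ₑ * (‖smoothing hc α hs0.le f z‖ₑ * ‖smoothing hc α ht0.le g z‖ₑ) ≤
        ENNReal.ofReal η * (‖f‖ₑ * ‖g‖ₑ)) :
    ∃ T : L2 →L[ℂ] L2, ‖T‖ ≤ η ∧ ∀ f g : L2,
      (Integrable fun z =>
        starRingEnd ℂ (smoothing hc α hs0.le f z) * V z * smoothing hc α ht0.le g z) ∧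
      inner ℂ (T f) g =
      ∫ z, starRingEnd ℂ (smoothing hc α hs0.le f z) * V z * smoothing hc α ht0.le g z := by
  set E := smoothing hc α hs0.le
  set F := smoothing hc α ht0.le
  have hint : ∀ f g : L2, Integrable fun z => starRingEnd ℂ (E f z) * V z * F g z := by
    intro f g
    refine ⟨?_, ?_⟩
    · exact ((Complex.continuous_conj.comp_aestronglyMeasurable (Lp.aestronglyMeasurable (E f))).mul
        (Complex.continuous_ofReal.comp_aestronglyMeasurable hV)).mul (Lp.aestronglyMeasurable (F g))
    · refine lt_of_le_of_lt (le_trans (le_of_eq ?_) (hb f g)) (by finiteness)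
      congr 1; ext z
      rw [enorm_mul, enorm_mul, RCLike.enorm_conj, ← ofReal_norm (V z : ℂ), Complex.norm_real, ofReal_norm]
      ring
  let B : L2 →ₗ⋆[ℂ] L2 →ₗ[ℂ] ℂ := LinearMap.mk₂'ₛₗ (starRingEnd ℂ) (RingHom.id ℂ)
    (fun f g => ∫ z, starRingEnd ℂ (E f z) * V z * F g z)
    (fun f f' g => by
      rw [← integral_add (hint _ _) (hint _ _)]
      apply integral_congr_ae
      rw [map_add]
      filter_upwards [Lp.coeFn_add (E f) (E f')] with z hz
      rw [hz, Pi.add_apply, map_add]; ring)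
    (fun r f g => by
      rw [smul_eq_mul, ← integral_const_mul]
      apply integral_congr_ae
      rw [map_smul]
      filter_upwards [Lp.coeFn_smul r (E f)] with z hz
      rw [hz, Pi.smul_apply, smul_eq_mul, map_mul]; ring)
    (fun f g g' => by
      rw [← integral_add (hint _ _) (hint _ _)]
      apply integral_congr_ae
      rw [map_add]
      filter_upwards [Lp.coeFn_add (F g) (F g')] with z hz
      rw [hz, Pi.add_apply]; ring)
    (fun r f g => by
      rw [RingHom.id_apply, smul_eq_mul, ← integral_const_mul]
      apply integral_congr_ae
      rw [map_smul]
      filter_upwards [Lp.coeFn_smul r (F g)] with z hz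
      rw [hz, Pi.smul_apply, smul_eq_mul]; ring)
  have hB : ∀ f g, ‖B f g‖ ≤ η * ‖f‖ * ‖g‖ := by
    intro f g
    have h1 : ‖B f g‖ₑ ≤ ENNReal.ofReal (η * ‖f‖ * ‖g‖) := by
      refine (enorm_integral_le_lintegral_enorm _).trans (le_trans (le_of_eq ?_) ((hb f g).trans_eq ?_))
      · congr 1; ext z
        rw [enorm_mul, enorm_mul, RCLike.enorm_conj, ← ofReal_norm (V z : ℂ), Complex.norm_real, ofReal_norm]
        ring
      · rw [← ofReal_norm, ← ofReal_norm, ← ENNReal.ofReal_mul (norm_nonneg _),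
          ← ENNReal.ofReal_mul hη, mul_assoc]
    rw [← ofReal_norm] at h1
    exact (ENNReal.ofReal_le_ofReal_iff (by positivity)).1 h1
  let Bc := B.mkContinuous₂ η hB
  refine ⟨InnerProductSpace.continuousLinearMapOfBilin Bc, ?_, fun f g => ?_⟩
  · refine ContinuousLinearMap.opNorm_le_bound _ hη fun f => ?_
    set Tf := InnerProductSpace.continuousLinearMapOfBilin Bc f with hTf
    have h1 : ‖Tf‖ * ‖Tf‖ ≤ η * ‖f‖ * ‖Tf‖ := by
      have h2 : inner ℂ Tf Tf = B f Tf := InnerProductSpace.continuousLinearMapOfBilin_apply Bc f Tf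
      have h3 := hB f Tf
      rw [← h2, inner_self_eq_norm_sq_to_K, norm_pow] at h3
      simpa [sq] using h3
    rcases (norm_nonneg Tf).eq_or_lt with h0 | h0
    · rw [← h0]; positivity
    · exact le_of_mul_le_mul_right h1 h0
  · exact ⟨hint f g, InnerProductSpace.continuousLinearMapOfBilin_apply Bc f g⟩

/-- Regularity for an integral equation with a small operator that acts on two scales. -/
theorem exists_eq_of_two_scales {E : Type*} [NormedAddCommGroup E] [NormedSpace ℂ E]
    [CompleteSpace E] {T S J : E →L[ℂ] E} (hT : ‖T‖ < 1) (hS : ‖S‖ < 1)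
    (hTJ : ∀ k, T (J k) = J (S k)) {h f : E} (hh : h = T h + J f) : ∃ k, h = J k := by
  -- The Neumann series solves k − S k = f. By the intertwining relation J k satisfies the same
  -- equation as h, so h − J k is fixed by the contraction T and vanishes.
  set U := Units.oneSub S hS
  set k := (↑U⁻¹ : E →L[ℂ] E) f
  have hk : k - S k = f := by
    have h1 : ((U : E →L[ℂ] E) * (↑U⁻¹ : E →L[ℂ] E)) f = f := by rw [Units.mul_inv]; rfl
    simpa [U] using h1
  refine ⟨k, ?_⟩
  have h1 : h - J k = T (h - J k) := by
    rw [map_sub, hTJ, ← sub_eq_zero]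
    have h2 : J k - J (S k) = J f := by rw [← map_sub, hk]
    rw [← h2] at hh
    nth_rw 1 [hh]
    abel
  by_contra hne
  have hpos : 0 < ‖h - J k‖ := norm_pos_iff.2 (sub_ne_zero.2 hne)
  have h2 := T.le_opNorm (h - J k)
  rw [← h1] at h2
  nlinarith

/-! ### The critical regularity step -/

theorem exists_tail_lt {φ : Plane → ℝ} (hφ : Measurable φ) {r : ℝ}
    (hf : ∫⁻ z, ‖φ z‖ₑ ^ r < ⊤) {δ : ℝ≥0∞} (hδ : 0 < δ) :
    ∃ R : ℝ, 1 ≤ R ∧ ∫⁻ z, {z | R < |φ z|}.indicator (fun z => ‖φ z‖ₑ ^ r) z < δ := by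
  have hm : ∀ R : ℝ, MeasurableSet {z | R < |φ z|} := fun R =>
    measurableSet_lt measurable_const (by fun_prop)
  have ht : Tendsto (fun n : ℕ => ∫⁻ z, {z | (n : ℝ) < |φ z|}.indicator (fun z => ‖φ z‖ₑ ^ r) z) atTop
      (𝓝 (∫⁻ _ : Plane, 0)) := by
    refine tendsto_lintegral_of_dominated_convergence (fun z => ‖φ z‖ₑ ^ r) ?_ ?_ hf.ne ?_
    · intro n; exact Measurable.indicator (by fun_prop) (hm n)
    · intro n; exact Eventually.of_forall fun z => Set.indicator_le_self _ _ _
    · refine Eventually.of_forall fun z => tendsto_const_nhds.congr' ?_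
      obtain ⟨N, hN⟩ := exists_nat_ge |φ z|
      filter_upwards [eventually_ge_atTop N] with n hn
      rw [Set.indicator_of_notMem]
      exact not_lt.2 (hN.trans (by exact_mod_cast hn))
  rw [lintegral_zero] at ht
  obtain ⟨n, hn, hn1⟩ := ((ht.eventually_lt_const hδ).and (eventually_ge_atTop 1)).exists
  exact ⟨n, by exact_mod_cast hn1, hn⟩

/-- Since a^{−1/2} a^{1/2} = 1, test functions are in the range of the smoothing operator of order
one; this lets the weak equation be read as an inner product in L². -/
theorem IsTest.smoothing_toLp {v : Plane → ℝ} (hv : IsTest v) {c : ℝ} (hc : c ≠ 0) (α : ℝ) :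
    mulSymbol hc α zero_le_one ((hv.memLp_sqrt_symbol_mul_ftReal hc α 2).toLp _)
      = (𝓕 ((hv.memLp 2).toLp _) : L2) ∧
    smoothing hc α zero_le_one ((hv.memLp_sqrt_symbol_mul_ftReal hc α 2).toLp _)
      = (hv.memLp 2).toLp _ := by
  have h1 : mulSymbol hc α zero_le_one ((hv.memLp_sqrt_symbol_mul_ftReal hc α 2).toLp _)
      = (𝓕 ((hv.memLp 2).toLp _) : L2) := by
    apply Lp.ext
    filter_upwards [mulSymbol_ae hc α zero_le_one ((hv.memLp_sqrt_symbol_mul_ftReal hc α 2).toLp _),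
      (hv.memLp_sqrt_symbol_mul_ftReal hc α 2).coeFn_toLp, hv.fourier_toLp] with ξ e1 e2 e3
    rw [e1, e2, e3, ← mul_assoc, ← Complex.ofReal_mul, ← Real.rpow_add (symbol_pos hc α ξ)]
    norm_num
  refine ⟨h1, ?_⟩
  rw [smoothing_apply, h1, FourierTransform.fourierInv_fourier_eq]

/-- The critical regularity step: a solution in the energy space with a nonlinearity of power at
most five belongs to `L^{10}`. -/
theorem lintegral_ten_lt_top {c α : ℝ} (hc : c ≠ 0) (hα : α ≠ 0) {φ F : Plane → ℝ}
    (hφ : Measurable φ) (hF : Measurable F) {q : ℝ} (hq1 : 1 ≤ q) (hq5 : q ≤ 5)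
    (hFφ : ∀ z, |F z| = |φ z| ^ q) {h : L2}
    (hh : smoothing hc α zero_le_one h =ᵐ[volume] fun z => (φ z : ℂ)) {κ : ℝ}
    (hweak : ∀ v, IsTest v → ∫ ξ, starRingEnd ℂ (h ξ) *
      (((symbol c α ξ ^ (1 / 2 : ℝ) : ℝ) : ℂ) * ftReal v ξ) = κ * ∫ z, (F z : ℂ) * v z) :
    ∫⁻ z, ‖φ z‖ₑ ^ (10 : ℝ) < ⊤ := by
  have hφ2 : MemLp (fun z => (φ z : ℂ)) 2 := (Lp.memLp _).ae_eq hh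
  have hφ6 : ∫⁻ z, ‖φ z‖ₑ ^ (6 : ℝ) < ⊤ := by
    obtain ⟨C, hC, hb⟩ := exists_lintegral_smoothing_le (s := 1) hc hα one_pos (by norm_num)
    refine lt_of_le_of_lt (le_trans (le_of_eq ?_) (hb h)) (by finiteness)
    apply lintegral_congr_ae
    filter_upwards [hh] with z hz
    rw [hz, ← ofReal_norm (φ z : ℂ), Complex.norm_real, ofReal_norm]; norm_num
  obtain ⟨C₁, hC₁, hb₁⟩ := exists_lintegral_potential_le (c := c) (α := α) (s := 1) (t := 1) hc hα
    one_pos (by norm_num) one_pos (by norm_num) (by norm_num)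
  -- The orders (1, 1) belong to the energy space. Shifting by 1/5 keeps the sum 2, and order 6/5
  -- corresponds to the exponent 6/(3 − 12/5) = 10.
  obtain ⟨C₂, hC₂, hb₂⟩ := exists_lintegral_potential_le (c := c) (α := α) (s := 6 / 5) (t := 4 / 5)
    hc hα (by norm_num) (by norm_num) (by norm_num) (by norm_num) (by norm_num)
  set η : ℝ := 1 / (2 * (|κ| + 1))
  have hη : 0 < η := by positivity
  have hκη : |κ| * η < 1 := by
    simp only [η]; rw [mul_one_div, div_lt_one (by positivity)]; linarith [abs_nonneg κ]
  -- The L^{3/2} norm wanted for the potential, small enough for both scales at once; the summand 1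
  -- keeps the denominator positive.
  set D : ℝ≥0∞ := (ENNReal.ofReal η / (C₁ + C₂ + 1))
  have hDpos : 0 < D := ENNReal.div_pos (by simpa using hη) (by finiteness)
  have hDtop : D ≠ ⊤ := (ENNReal.div_lt_top (by simp) (by simp)).ne
  obtain ⟨R, hR1, hR⟩ := exists_tail_lt hφ hφ6
    (δ := D ^ (3 / 2 : ℝ)) (ENNReal.rpow_pos hDpos hDtop)
  set A : Set Plane := {z | R < |φ z|}
  have hA : MeasurableSet A := measurableSet_lt measurable_const (by fun_prop)
  -- On {|φ| > R} with R ≥ 1, the quotient has size |φ|^{q−1} ≤ |φ|⁴ as q ≤ 5, so its L^{3/2} norm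
  -- is controlled by the tail of the L⁶ norm of φ. The remainder is at most R^{q−1}|φ|, hence in
  -- L².
  set V : Plane → ℝ := A.indicator fun z => F z / φ z
  set ρ : Plane → ℝ := Aᶜ.indicator F
  have hVm : Measurable V := (hF.div hφ).indicator hA
  have hρm : Measurable ρ := hF.indicator hA.compl
  have hsplit : ∀ z, F z = V z * φ z + ρ z := by
    intro z
    by_cases hz : z ∈ A
    · have hne : φ z ≠ 0 := by
        intro h0
        have : R < |φ z| := hz
        rw [h0, abs_zero] at this; linarith
      simp only [V, ρ]
      rw [Set.indicator_of_mem hz, Set.indicator_of_notMem (by simpa using hz), div_mul_cancel₀ _ hne,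
        add_zero]
    · simp only [V, ρ]
      rw [Set.indicator_of_notMem hz, Set.indicator_of_mem (by simpa using hz)]; ring
  have hVn : (∫⁻ z, ‖V z‖ₑ ^ (3 / 2 : ℝ)) ^ (2 / 3 : ℝ) ≤ D := by
    have h1 : ∫⁻ z, ‖V z‖ₑ ^ (3 / 2 : ℝ) ≤ D ^ (3 / 2 : ℝ) := by
      refine le_trans (lintegral_mono fun z => ?_) hR.le
      by_cases hz : z ∈ A
      · simp only [V]
        rw [Set.indicator_of_mem hz, Set.indicator_of_mem (by exact hz)]
        have hz' : R < |φ z| := hz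
        have hpos : 0 < |φ z| := by linarith
        have h2 : |F z / φ z| ≤ |φ z| ^ (4 : ℝ) := by
          rw [abs_div, hFφ, div_le_iff₀ hpos]
          nth_rw 3 [← Real.rpow_one |φ z|]
          rw [← Real.rpow_add hpos]
          exact Real.rpow_le_rpow_of_exponent_le (by linarith) (by linarith)
        rw [Real.enorm_eq_ofReal_abs, Real.enorm_eq_ofReal_abs]
        calc _ ≤ ENNReal.ofReal (|φ z| ^ (4 : ℝ)) ^ (3 / 2 : ℝ) := by gcongr
          _ = _ := by
            rw [← ENNReal.ofReal_rpow_of_pos hpos, ← ENNReal.rpow_mul]; norm_num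
      · simp only [V]
        rw [Set.indicator_of_notMem hz, Set.indicator_of_notMem (by exact hz)]; simp
    calc _ ≤ (D ^ (3 / 2 : ℝ)) ^ (2 / 3 : ℝ) := by gcongr
      _ = D := by rw [← ENNReal.rpow_mul]; norm_num
  have hCD : ∀ C : ℝ≥0∞, C ≤ C₁ + C₂ + 1 → C * D ≤ ENNReal.ofReal η := by
    intro C hC
    calc _ ≤ (C₁ + C₂ + 1) * D := mul_le_mul_left hC _
      _ ≤ _ := ENNReal.mul_div_le
  have hVs : AEStronglyMeasurable V volume := hVm.aestronglyMeasurable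
  obtain ⟨T, hTn, hT⟩ := exists_potential_operator (c := c) (α := α) hc one_pos one_pos hVs hη.le
    (fun f g => (hb₁ V hVs f g).trans (mul_le_mul_left ((mul_le_mul_right hVn _).trans
      (hCD C₁ (by rw [add_assoc]; exact le_self_add))) _))
  obtain ⟨S, hSn, hS⟩ := exists_potential_operator (c := c) (α := α) (s := 6 / 5) (t := 4 / 5) hc
    (by norm_num) (by norm_num) hVs hη.le
    (fun f g => (hb₂ V hVs f g).trans (mul_le_mul_left ((mul_le_mul_right hVn _).trans
      (hCD C₂ (by rw [add_comm C₁, add_assoc]; exact le_self_add))) _))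
  have hρ2 : MemLp (fun z => (ρ z : ℂ)) 2 := by
    refine hφ2.of_le_mul (c := R ^ (q - 1)) (Complex.measurable_ofReal.comp hρm).aestronglyMeasurable ?_
    refine Eventually.of_forall fun z => ?_
    rw [Complex.norm_real, Complex.norm_real, Real.norm_eq_abs, Real.norm_eq_abs]
    by_cases hz : z ∈ A
    · simp only [ρ]
      rw [Set.indicator_of_notMem (by simpa using hz), abs_zero]; positivity
    · simp only [ρ]
      rw [Set.indicator_of_mem (by simpa using hz), hFφ]
      have hz' : |φ z| ≤ R := not_lt.1 hz
      rcases (abs_nonneg (φ z)).eq_or_lt with h0 | h0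
      · rw [← h0, Real.zero_rpow (by linarith), mul_zero]
      · calc |φ z| ^ q = |φ z| ^ (q - 1) * |φ z| := by
              nth_rw 3 [← Real.rpow_one |φ z|]
              rw [← Real.rpow_add h0]; congr 1; ring
          _ ≤ _ := by gcongr
  have p15 : (0 : ℝ) ≤ 1 / 5 := by norm_num
  have p45 : (0 : ℝ) ≤ 4 / 5 := by norm_num
  have p65 : (0 : ℝ) ≤ 6 / 5 := by norm_num
  set J := mulSymbol hc α p15
  set r : L2 := hρ2.toLp _
  -- The source term κ a^{−1/2} ρ̂ has to lie in the range of J = a^{−1/10}, and 1/2 = 1/10 + 2/5.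
  set f : L2 := (κ : ℂ) • mulSymbol hc α p45 (𝓕 r : L2)
  have hJf : J f = (κ : ℂ) • mulSymbol hc α zero_le_one (𝓕 r : L2) := by
    simp only [f, J]
    rw [map_smul, mulSymbol_add hc α p15 p45 zero_le_one (by norm_num)]
  -- Formally both sides are κ a^{−1/2} 𝓕 V 𝓕⁻¹ a^{−3/5}: J moves from the right factor of T to the
  -- left factor of S.
  have hTJ : ∀ k, ((κ : ℂ) • T) (J k) = J (((κ : ℂ) • S) k) := by
    intro k
    rw [smul_apply, smul_apply, map_smul]
    congr 1
    refine ext_inner_right ℂ fun g => ?_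
    rw [← inner_mulSymbol, (hT _ _).2, (hS _ _).2]
    simp only [J]
    rw [smoothing_add hc α zero_le_one p15 p65 (by norm_num),
      smoothing_add hc α p45 p15 zero_le_one (by norm_num)]
  have hnorm : ∀ U : L2 →L[ℂ] L2, ‖U‖ ≤ η → ‖(κ : ℂ) • U‖ < 1 := by
    intro U hU
    rw [norm_smul, Complex.norm_real, Real.norm_eq_abs]
    exact (mul_le_mul_of_nonneg_left hU (abs_nonneg κ)).trans_lt hκη
  have hfix : h = ((κ : ℂ) • T) h + J f := by
    -- Paired with a^{1/2} v̂, the defect d reproduces the weak equation for v, so it pairs to zero;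
    -- these pairings determine a^{1/2} d, and a does not vanish.
    set d : L2 := h - (((κ : ℂ) • T) h + J f)
    have hd0 : ∀ v (hv : IsTest v), inner ℂ d ((hv.memLp_sqrt_symbol_mul_ftReal hc α 2).toLp _) = 0 := by
      intro v hv
      set g : L2 := (hv.memLp_sqrt_symbol_mul_ftReal hc α 2).toLp _ with hg
      obtain ⟨g1, g2⟩ := hv.smoothing_toLp hc α
      have e1 : inner ℂ h g = κ * ∫ z, (F z : ℂ) * v z := by
        rw [← hweak v hv, L2.inner_def]
        apply integral_congr_ae
        filter_upwards [(hv.memLp_sqrt_symbol_mul_ftReal hc α 2).coeFn_toLp] with ξ hξ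
        rw [hg, hξ]; simp [mul_comm]
      obtain ⟨hi, e2⟩ := hT h g
      have hae : (fun z => starRingEnd ℂ (smoothing hc α one_pos.le h z) * V z
          * smoothing hc α one_pos.le g z) =ᵐ[volume] fun z => ((V z * φ z : ℝ) : ℂ) * v z := by
        rw [hg, g2]
        filter_upwards [hh, (hv.memLp 2).coeFn_toLp] with z a1 a2
        rw [a1, a2]; simp [mul_comm]
      rw [integral_congr_ae hae] at e2
      have hi' := hi.congr hae
      have e3 : inner ℂ (mulSymbol hc α zero_le_one (𝓕 r : L2)) g = ∫ z, (ρ z : ℂ) * v z := by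
        rw [← inner_mulSymbol, hg, g1, Lp.inner_fourier_eq, L2.inner_def]
        apply integral_congr_ae
        filter_upwards [hρ2.coeFn_toLp, (hv.memLp 2).coeFn_toLp] with z a1 a2
        rw [a1, a2]; simp [mul_comm]
      have hi2 : Integrable fun z => (ρ z : ℂ) * v z := hρ2.integrable_mul (hv.memLp 2)
      have e4 : ∫ z, (F z : ℂ) * v z = (∫ z, ((V z * φ z : ℝ) : ℂ) * v z) + ∫ z, (ρ z : ℂ) * v z := by
        rw [← integral_add hi' hi2]
        congr 1; ext z
        rw [hsplit z]; push_cast; ring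
      simp only [d]
      rw [hJf, inner_sub_left, inner_add_left, smul_apply, inner_smul_left, inner_smul_left, e1, e2, e3, e4]
      simp; ring
    have hG := ae_eq_zero_of_integral_ftReal
      (G := fun ξ => starRingEnd ℂ (d ξ) * ((symbol c α ξ ^ (1 / 2 : ℝ) : ℝ) : ℂ))
      (fun v hv => by
        have := integrable_star_mul d (hv.memLp_sqrt_symbol_mul_ftReal hc α 2)
        simpa only [mul_assoc] using this)
      (fun v hv => by
        rw [← hd0 v hv, L2.inner_def]
        apply integral_congr_ae
        filter_upwards [(hv.memLp_sqrt_symbol_mul_ftReal hc α 2).coeFn_toLp] with ξ hξ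
        rw [hξ]; simp; ring)
    have hd : d = 0 := by
      rw [Lp.eq_zero_iff_ae_eq_zero]
      filter_upwards [hG] with ξ hξ
      have hp : symbol c α ξ ^ (1 / 2 : ℝ) ≠ 0 := (Real.rpow_pos_of_pos (symbol_pos hc α ξ) _).ne'
      have hp' : ((symbol c α ξ ^ (1 / 2 : ℝ) : ℝ) : ℂ) ≠ 0 := by exact_mod_cast hp
      have := (mul_eq_zero.1 hξ).resolve_right hp'
      simpa using this
    exact sub_eq_zero.1 hd
  obtain ⟨k, hk⟩ := exists_eq_of_two_scales (hnorm T hTn) (hnorm S hSn) hTJ hfix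
  obtain ⟨C, hC, hb⟩ := exists_lintegral_smoothing_le (c := c) (s := 6 / 5) hc hα
    (by norm_num) (by norm_num)
  have hfin := (hb k).trans_lt (ENNReal.mul_lt_top hC.lt_top
    (ENNReal.rpow_lt_top_of_nonneg (by norm_num) (by simp)))
  refine lt_of_le_of_lt (le_of_eq ?_) hfin
  apply lintegral_congr_ae
  rw [hk] at hh
  simp only [J] at hh
  rw [smoothing_add hc α zero_le_one p15 p65 (by norm_num)] at hh
  filter_upwards [hh] with z hz
  rw [hz, ← ofReal_norm (φ z : ℂ), Complex.norm_real, ofReal_norm]; norm_num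

/-! ### Square integrability of the nonlinearity -/

theorem measurable_ratPow (q : ℚ) : Measurable (ratPow q) := by
  have hs : Measurable Real.sign := by
    unfold Real.sign
    exact Measurable.ite measurableSet_Iio measurable_const
      (Measurable.ite measurableSet_Ioi measurable_const measurable_const)
  unfold ratPow oddRoot
  cases q.num with
  | ofNat n => simp only [Int.ofNat_eq_natCast, zpow_natCast]; fun_prop
  | negSucc n => simp only [zpow_negSucc]; fun_prop

theorem abs_ratPow {q : ℚ} (hq : 0 < q) (x : ℝ) : |ratPow q x| = |x| ^ (q : ℝ) := by
  have hnum : 0 < q.num := Rat.num_pos.2 hq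
  have hden : (q.den : ℝ) ≠ 0 := by exact_mod_cast q.den_ne_zero
  have hq' : (0 : ℝ) < q := by exact_mod_cast hq
  have hcast : (q : ℝ) = q.num / q.den := Rat.cast_def q
  rcases eq_or_ne x 0 with rfl | hx
  · rw [abs_zero, Real.zero_rpow hq'.ne']
    simp [ratPow, oddRoot, zero_zpow _ hnum.ne']
  · have h1 : |oddRoot q.den x| = |x| ^ (1 / (q.den : ℝ)) := by
      rw [oddRoot, abs_mul, abs_of_nonneg (Real.rpow_nonneg (abs_nonneg x) _)]
      rcases lt_or_gt_of_ne hx with h | h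
      · rw [Real.sign_of_neg h]; simp
      · rw [Real.sign_of_pos h]; simp
    rw [ratPow, abs_zpow, h1, ← Real.rpow_intCast, ← Real.rpow_mul (abs_nonneg x), hcast]
    congr 1; ring

theorem ratPow_natCast_add_one (p : ℕ) (x : ℝ) : ratPow ((p : ℚ) + 1) x = x ^ (p + 1) := by
  have h : ((p : ℚ) + 1) = ((p + 1 : ℕ) : ℚ) := by push_cast; rfl
  rw [h, ratPow, Rat.den_natCast, Rat.num_natCast, zpow_natCast, oddRoot]
  congr 1
  simp only [Nat.cast_one, div_one, Real.rpow_one]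
  rcases lt_trichotomy x 0 with h | h | h
  · rw [Real.sign_of_neg h, abs_of_neg h]; ring
  · simp [h]
  · rw [Real.sign_of_pos h, abs_of_pos h]; ring

/-- For powers `p ≤ 4` the nonlinearity of a solitary wave is square integrable. -/
theorem IsSolitaryWave.memLp_ratPow {c α ε : ℝ} (hε : ε = 1 ∨ ε = -1) (hαε : α * ε < 0)
    (hcα : c * α < 0) {p : ℚ} (hp : 0 < p) (hp4 : p ≤ 4) {φ : Plane → ℝ}
    (h : IsSolitaryWave c α ε p φ) : MemLp (fun z => ratPow (p + 1) (φ z)) 2 volume := by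
  have hα : α ≠ 0 := by rintro rfl; simp at hαε
  have hc : c ≠ 0 := by rintro rfl; simp at hcα
  obtain ⟨κ, hκ⟩ := h.exists_weak_fourier hε hαε hcα
  set f : L2 := h.memZ.memLp.toLp _
  -- A measurable representative, as `lintegral_ten_lt_top` needs measurability and not only almost
  -- everywhere measurability.
  set φ₀ : Plane → ℝ := fun z => (f z).re
  have hφ₀m : Measurable φ₀ := Complex.measurable_re.comp (Lp.stronglyMeasurable f).measurable
  have hae : φ =ᵐ[volume] φ₀ := by
    filter_upwards [h.memZ.memLp.coeFn_toLp] with z hz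
    simp only [φ₀, f]; rw [hz, Complex.ofReal_re]
  set g : L2 := (h.memZ.memLp_sqrt_symbol hc α).toLp _
  have hg := (h.memZ.memLp_sqrt_symbol hc α).coeFn_toLp
  have hp1 : 0 < p + 1 := by linarith
  have hq1 : (1 : ℝ) ≤ ((p + 1 : ℚ) : ℝ) := by
    have : (0 : ℝ) < p := by exact_mod_cast hp
    push_cast; linarith
  have hq5 : ((p + 1 : ℚ) : ℝ) ≤ 5 := by
    have : (p : ℝ) ≤ 4 := by exact_mod_cast hp4
    push_cast; linarith
  have hsm : smoothing hc α zero_le_one g =ᵐ[volume] fun z => (φ₀ z : ℂ) := by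
    have h1 : mulSymbol hc α zero_le_one g = (𝓕 f : L2) := by
      apply Lp.ext
      filter_upwards [mulSymbol_ae hc α zero_le_one g, hg] with ξ e1 e2
      rw [e1, e2, ← mul_assoc, ← Complex.ofReal_mul, ← Real.rpow_add (symbol_pos hc α ξ)]
      norm_num
      rfl
    rw [smoothing_apply, h1, FourierTransform.fourierInv_fourier_eq]
    filter_upwards [h.memZ.memLp.coeFn_toLp] with z hz
    simp only [φ₀, f]; rw [hz, Complex.ofReal_re]
  have h10 := lintegral_ten_lt_top hc hα hφ₀m ((measurable_ratPow (p + 1)).comp hφ₀m) hq1 hq5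
    (fun z => abs_ratPow hp1 _) hsm (κ := κ) (fun v hv => by
      have e1 : ∫ z, ((ratPow (p + 1) ∘ φ₀) z : ℂ) * v z = ∫ z, (ratPow (p + 1) (φ z) : ℂ) * v z := by
        apply integral_congr_ae
        filter_upwards [hae] with z hz
        rw [Function.comp_apply, hz]
      rw [e1, ← hκ v hv]
      apply integral_congr_ae
      filter_upwards [hg] with ξ hξ
      rw [hξ, map_mul, Complex.conj_ofReal]
      have hsq : ((symbol c α ξ : ℝ) : ℂ) = ((symbol c α ξ ^ (1 / 2 : ℝ) : ℝ) : ℂ)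
          * ((symbol c α ξ ^ (1 / 2 : ℝ) : ℝ) : ℂ) := by
        rw [← Complex.ofReal_mul, ← Real.rpow_add (symbol_pos hc α ξ)]; norm_num
      rw [hsq]; ring)
  have h2 : ∫⁻ z, ‖φ₀ z‖ₑ ^ (2 : ℝ) < ⊤ := by
    have := lintegral_enorm_sq f
    have hfin : ∫⁻ z, ‖f z‖ₑ ^ 2 < ⊤ := by rw [this]; simp
    refine lt_of_le_of_lt (lintegral_mono fun z => ?_) hfin
    rw [← ENNReal.rpow_natCast]
    refine ENNReal.rpow_le_rpow ?_ (by norm_num)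
    rw [← ofReal_norm, ← ofReal_norm]
    exact ENNReal.ofReal_le_ofReal (Complex.abs_re_le_norm _)
  have hF₀ : MemLp (fun z => ratPow (p + 1) (φ₀ z)) 2 volume := by
    refine ⟨((measurable_ratPow (p + 1)).comp hφ₀m).aestronglyMeasurable, ?_⟩
    rw [eLpNorm_lt_top_iff_lintegral_rpow_enorm_lt_top (by norm_num) (by norm_num)]
    refine lt_of_le_of_lt (lintegral_mono fun z => ?_) (by
      rw [lintegral_add_left (f := fun z => ‖φ₀ z‖ₑ ^ (2 : ℝ)) (by fun_prop)]
      exact ENNReal.add_lt_top.2 ⟨h2, h10⟩)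
    rw [Real.enorm_eq_ofReal_abs, Real.enorm_eq_ofReal_abs, abs_ratPow hp1,
      ← ENNReal.ofReal_rpow_of_nonneg (abs_nonneg _) (by linarith), ← ENNReal.rpow_mul]
    have e2 : ENNReal.toReal 2 = 2 := by norm_num
    rw [e2]
    -- Since 2 ≤ 2(p+1) ≤ 10, the power 2(p+1) is dominated by the sum of the second and the tenth
    -- powers.
    rcases le_total (ENNReal.ofReal |φ₀ z|) 1 with hle | hle
    · exact (ENNReal.rpow_le_rpow_of_exponent_ge hle (by linarith)).trans le_self_add
    · exact (ENNReal.rpow_le_rpow_of_exponent_le hle (by linarith)).trans le_add_self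
  refine hF₀.ae_eq ?_
  filter_upwards [hae] with z hz
  rw [hz]

/-- If the nonlinearity is square integrable then the equation holds almost everywhere on the
Fourier side. -/
theorem IsSolitaryWave.exists_fourier_eq {c α ε : ℝ} (hε : ε = 1 ∨ ε = -1) (hαε : α * ε < 0)
    (hcα : c * α < 0) {p : ℚ} {φ : Plane → ℝ} (h : IsSolitaryWave c α ε p φ)
    (hF : MemLp (fun z => (ratPow (p + 1) (φ z) : ℂ)) 2 volume) :
    ∃ κ : ℝ, (𝓕 (h.memZ.memLp.toLp _) : L2) =ᵐ[volume]
      fun ξ => κ * ((symbol c α ξ)⁻¹ : ℝ) * (𝓕 (hF.toLp _) : L2) ξ := by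
  have hc : c ≠ 0 := by rintro rfl; simp at hcα
  obtain ⟨κ, hκ⟩ := h.exists_weak_fourier hε hαε hcα
  refine ⟨κ, ?_⟩
  set f : L2 := 𝓕 (h.memZ.memLp.toLp _)
  set g : L2 := 𝓕 (hF.toLp _)
  have hft : ∀ v, IsTest v → ∀ q, MemLp (ftReal v) q volume := fun v hv q => by
    rw [hv.ftReal_eq]; exact SchwartzMap.memLp _ q volume
  have i1 : ∀ v (hv : IsTest v), Integrable fun ξ =>
      starRingEnd ℂ (f ξ) * ((symbol c α ξ : ℂ) * ftReal v ξ) :=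
    fun v hv => integrable_star_mul f (hv.memLp_symbol_mul_ftReal hc α 2)
  have i2 : ∀ v (hv : IsTest v), Integrable fun ξ => starRingEnd ℂ (g ξ) * ftReal v ξ :=
    fun v hv => integrable_star_mul g (hft v hv 2)
  have e : ∀ v (ξ : Plane), (starRingEnd ℂ (f ξ) * symbol c α ξ - κ * starRingEnd ℂ (g ξ)) * ftReal v ξ
      = starRingEnd ℂ (f ξ) * ((symbol c α ξ : ℂ) * ftReal v ξ)
        - κ * (starRingEnd ℂ (g ξ) * ftReal v ξ) := fun v ξ => by ring
  have hG := ae_eq_zero_of_integral_ftReal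
    (G := fun ξ => starRingEnd ℂ (f ξ) * symbol c α ξ - κ * starRingEnd ℂ (g ξ))
    (fun v hv => by
      simp_rw [e]
      exact (i1 v hv).sub ((i2 v hv).const_mul _))
    (fun v hv => by
      simp_rw [e]
      rw [integral_sub (i1 v hv) ((i2 v hv).const_mul _), integral_const_mul, hκ v hv]
      have := integral_mul_eq_fourier (φ := fun z => ratPow (p + 1) (φ z)) hF (w := v)
        (hft v hv 1) (hft v hv 2) (fun z => (hv.fourierInv_ftReal z).symm)
      rw [← this, ← integral_complex_ofReal]
      simp)
  filter_upwards [hG] with ξ hξ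
  have hp : ((symbol c α ξ : ℝ) : ℂ) ≠ 0 := by exact_mod_cast (symbol_pos hc α ξ).ne'
  have h2 : starRingEnd ℂ (f ξ) * symbol c α ξ = κ * starRingEnd ℂ (g ξ) := sub_eq_zero.1 hξ
  have h3 := congrArg (starRingEnd ℂ) h2
  simp only [map_mul, Complex.conj_conj, Complex.conj_ofReal] at h3
  rw [mul_right_comm, ← h3]
  push_cast
  field_simp

/-! ### Continuity and decay at infinity -/

theorem integrable_of_eq_inv_symbol_mul {c α : ℝ} (hc : c ≠ 0) (hα : α ≠ 0) {f g : L2} {κ : ℝ}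
    (h : f =ᵐ[volume] fun ξ => κ * ((symbol c α ξ)⁻¹ : ℝ) * g ξ) : Integrable f := by
  have h1 : MemLp (fun ξ => (((symbol c α ξ)⁻¹ : ℝ) : ℂ)) 2 := (memLp_inv_symbol hc hα).ofReal
  have h2 := (h1.integrable_mul (Lp.memLp g)).const_mul (κ : ℂ)
  refine h2.congr ?_
  filter_upwards [h] with ξ hξ
  rw [hξ]; simp [mul_assoc]

theorem tendsto_fourierInv_cocompact (f : Plane → ℂ) :
    Tendsto (𝓕⁻ f) (cocompact Plane) (𝓝 0) := by
  rw [Real.fourierInv_eq_fourier_comp_neg]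
  exact tendsto_integral_exp_inner_smul_cocompact _

/-- The representative is the real part of the inverse Fourier integral of φ̂; Riemann–Lebesgue
gives the limit at infinity. -/
theorem exists_continuous_of_integrable_fourier {φ : Plane → ℝ}
    (hφ : MemLp (fun z => (φ z : ℂ)) 2) (hi : Integrable (𝓕 (hφ.toLp _) : L2)) :
    ∃ ψ : Plane → ℝ, φ =ᵐ[volume] ψ ∧ Continuous ψ ∧ MemLp ψ ⊤ volume ∧
        Tendsto ψ (cocompact Plane) (𝓝 0) := by
  set u : L2 := 𝓕 (hφ.toLp _)
  have hc : Continuous fun z => (𝓕⁻ (u : Plane → ℂ) z).re := Complex.continuous_re.comp (continuous_fourierInv hi)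
  refine ⟨fun z => (𝓕⁻ (u : Plane → ℂ) z).re, ?_, hc, ?_, ?_⟩
  · have h1 := lp_fourierInv_ae_eq hi (Lp.memLp u)
    rw [Lp.toLp_coeFn, FourierTransform.fourierInv_fourier_eq] at h1
    filter_upwards [h1, hφ.coeFn_toLp] with z a1 a2
    rw [← a1, a2, Complex.ofReal_re]
  · refine memLp_top_of_bound hc.aestronglyMeasurable (∫ v, ‖u v‖) (Eventually.of_forall fun z => ?_)
    exact (Complex.abs_re_le_norm _).trans (norm_fourierInv_le _ _)
  · have := (Complex.continuous_re.tendsto 0).comp (tendsto_fourierInv_cocompact u)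
    rw [Complex.zero_re] at this; exact this

theorem IsSolitaryWave.exists_continuous {c α ε : ℝ} (hε : ε = 1 ∨ ε = -1) (hαε : α * ε < 0)
    (hcα : c * α < 0) {p : ℚ} (hp : 0 < p) (hp4 : p < 4) {φ : Plane → ℝ}
    (h : IsSolitaryWave c α ε p φ) :
    ∃ ψ : Plane → ℝ, φ =ᵐ[volume] ψ ∧ Continuous ψ ∧ MemLp ψ ⊤ volume ∧
        Tendsto ψ (cocompact Plane) (𝓝 0) := by
  have hα : α ≠ 0 := by rintro rfl; simp at hαε
  have hc : c ≠ 0 := by rintro rfl; simp at hcα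
  obtain ⟨κ, hκ⟩ := h.exists_fourier_eq hε hαε hcα (h.memLp_ratPow hε hαε hcα hp hp4.le).ofReal
  exact exists_continuous_of_integrable_fourier h.memZ.memLp
    (integrable_of_eq_inv_symbol_mul hc hα hκ)

/-! ### Weighted decay, convolution and the Leibniz rule -/

/-- `u` is continuous, and `(1 + |ξ|)^N u` is bounded and integrable. -/
structure HasDecay (N : ℕ) (u : Plane → ℂ) : Prop where
  continuous : Continuous u
  integrable_weight : Integrable fun ξ => (1 + ‖ξ‖) ^ N * ‖u ξ‖
  bounded : ∃ C, ∀ ξ, (1 + ‖ξ‖) ^ N * ‖u ξ‖ ≤ C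

/-- The convolution of complex functions on the plane. -/
noncomputable def conv (u v : Plane → ℂ) (ξ : Plane) : ℂ := ∫ t, u t * v (ξ - t)

theorem conv_eq (u v : Plane → ℂ) :
    conv u v = convolution u v (ContinuousLinearMap.mul ℂ ℂ) volume := rfl

theorem one_le_weight (ξ : Plane) : 1 ≤ 1 + ‖ξ‖ := le_add_of_nonneg_right (norm_nonneg ξ)

namespace HasDecay

variable {N M : ℕ} {u v : Plane → ℂ}

theorem of_le (hu : HasDecay N u) (hv : Continuous v) {C : ℝ}
    (h : ∀ ξ, (1 + ‖ξ‖) ^ M * ‖v ξ‖ ≤ C * ((1 + ‖ξ‖) ^ N * ‖u ξ‖)) : HasDecay M v := by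
  obtain ⟨B, hB⟩ := hu.bounded
  refine ⟨hv, ?_, |C| * B, fun ξ => ?_⟩
  · refine (hu.integrable_weight.const_mul C).mono' (by fun_prop) (Eventually.of_forall fun ξ => ?_)
    rw [Real.norm_of_nonneg (by positivity)]
    exact h ξ
  · refine (h ξ).trans ?_
    have h0 : 0 ≤ (1 + ‖ξ‖) ^ N * ‖u ξ‖ := by positivity
    exact mul_le_mul (le_abs_self C) (hB ξ) h0 (abs_nonneg C)

theorem mono (hu : HasDecay N u) (h : M ≤ N) : HasDecay M u :=
  hu.of_le hu.continuous (C := 1) fun ξ => by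
    rw [one_mul]
    gcongr
    exact one_le_weight ξ

theorem integrable (hu : HasDecay N u) : Integrable u := by
  have := (hu.mono (Nat.zero_le N)).integrable_weight
  simp only [pow_zero, one_mul] at this
  exact (integrable_norm_iff hu.continuous.aestronglyMeasurable).1 this

theorem exists_norm_le (hu : HasDecay N u) : ∃ C, ∀ ξ, ‖u ξ‖ ≤ C := by
  simpa using (hu.mono (Nat.zero_le N)).bounded

theorem memLp_two (hu : HasDecay N u) : MemLp u 2 := by
  obtain ⟨C, hC⟩ := hu.exists_norm_le
  rw [memLp_two_iff_integrable_sq_norm hu.continuous.aestronglyMeasurable]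
  refine (hu.integrable.norm.const_mul C).mono' (by have := hu.continuous; fun_prop) (Eventually.of_forall fun ξ => ?_)
  rw [Real.norm_of_nonneg (by positivity), sq]
  exact mul_le_mul_of_nonneg_right (hC ξ) (norm_nonneg _)

theorem add (hu : HasDecay N u) (hv : HasDecay N v) : HasDecay N fun ξ => u ξ + v ξ := by
  obtain ⟨B, hB⟩ := hu.bounded
  obtain ⟨C, hC⟩ := hv.bounded
  have h : ∀ ξ, (1 + ‖ξ‖) ^ N * ‖u ξ + v ξ‖
      ≤ (1 + ‖ξ‖) ^ N * ‖u ξ‖ + (1 + ‖ξ‖) ^ N * ‖v ξ‖ := fun ξ => by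
    rw [← mul_add]; gcongr; exact norm_add_le _ _
  have hc := hu.continuous.add hv.continuous
  refine ⟨hc, ?_, B + C, fun ξ => (h ξ).trans (add_le_add (hB ξ) (hC ξ))⟩
  refine (hu.integrable_weight.add hv.integrable_weight).mono'
    (by have := hu.continuous; have := hv.continuous; fun_prop) (Eventually.of_forall fun ξ => ?_)
  rw [Real.norm_of_nonneg (by positivity)]
  exact h ξ

theorem const_mul (hu : HasDecay N u) (a : ℂ) : HasDecay N fun ξ => a * u ξ :=
  hu.of_le (hu.continuous.const_mul a) (C := ‖a‖) fun ξ => by rw [norm_mul]; exact (by ring : _ = _).le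

theorem coord_mul (hu : HasDecay (N + 1) u) (i : Fin 2) :
    HasDecay N fun ξ => (ξ i : ℂ) * u ξ :=
  hu.of_le (by have := hu.continuous; fun_prop) (C := 1) fun ξ => by
    have h : |ξ i| ≤ 1 + ‖ξ‖ := (abs_coord_le ξ i).trans (by linarith)
    rw [norm_mul, Complex.norm_real, Real.norm_eq_abs, one_mul, pow_succ, mul_assoc]
    gcongr

/-- The symbol dominates 1 + |ξ|, so its inverse pays for one more weight; this is the gain in each
round of the bootstrap. -/
theorem inv_symbol_mul {c α : ℝ} (hc : c ≠ 0) (hα : α ≠ 0) (hu : HasDecay N u) :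
    HasDecay (N + 1) fun ξ => (((symbol c α ξ)⁻¹ : ℝ) : ℂ) * u ξ := by
  obtain ⟨κ, hκ, hle⟩ := exists_le_symbol hc hα
  have hcs : Continuous fun ξ => (symbol c α ξ)⁻¹ :=
    (continuous_symbol c α).inv₀ fun ξ => (symbol_pos hc α ξ).ne'
  refine hu.of_le (by have := hu.continuous; fun_prop) (C := κ⁻¹) fun ξ => ?_
  have hs := symbol_pos hc α ξ
  rw [norm_mul, Complex.norm_real, Real.norm_of_nonneg (inv_nonneg.2 hs.le), pow_succ]
  have h1 : (1 + ‖ξ‖) * (symbol c α ξ)⁻¹ ≤ κ⁻¹ := by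
    rw [← div_eq_mul_inv, div_le_iff₀ hs, inv_mul_eq_div, le_div_iff₀ hκ, mul_comm]
    exact (hle ξ).1
  calc (1 + ‖ξ‖) ^ N * (1 + ‖ξ‖) * ((symbol c α ξ)⁻¹ * ‖u ξ‖)
      = ((1 + ‖ξ‖) * (symbol c α ξ)⁻¹) * ((1 + ‖ξ‖) ^ N * ‖u ξ‖) := by ring
    _ ≤ _ := by gcongr

theorem integrable_conv (hu : HasDecay N u) (hv : HasDecay M v) (ξ : Plane) :
    Integrable fun t => u t * v (ξ - t) := by
  obtain ⟨C, hC⟩ := hv.exists_norm_le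
  have h1 := hu.continuous
  have h2 := hv.continuous
  exact hu.integrable.mul_bdd (c := C) (by fun_prop) (Eventually.of_forall fun t => hC _)

/-- The weight is submultiplicative, 1 + |ξ| ≤ (1 + |t|)(1 + |ξ−t|), so the weighted convolution is
bounded by the convolution of the weighted factors, one taken in L¹ and the other in L¹ or L^∞. -/
theorem conv (hu : HasDecay N u) (hv : HasDecay N v) : HasDecay N (conv u v) := by
  have h1 := hu.continuous
  have h2 := hv.continuous
  obtain ⟨C, hC⟩ := hv.exists_norm_le
  obtain ⟨B, hB⟩ := hv.bounded
  have hc : Continuous (BOZK.conv u v) := by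
    rw [conv_eq]
    refine BddAbove.continuous_convolution_right_of_integrable _ ⟨C, ?_⟩ hu.integrable h2
    rintro _ ⟨x, rfl⟩
    exact hC x
  have hi : ∀ ξ, Integrable fun t => (1 + ‖t‖) ^ N * ‖u t‖ * ((1 + ‖ξ - t‖) ^ N * ‖v (ξ - t)‖) :=
    fun ξ => hu.integrable_weight.mul_bdd (c := B) (by fun_prop) (Eventually.of_forall fun t => by
      rw [Real.norm_of_nonneg (by positivity)]; exact hB _)
  have hle : ∀ ξ, (1 + ‖ξ‖) ^ N * ‖BOZK.conv u v ξ‖ ≤ ∫ t, (1 + ‖t‖) ^ N * ‖u t‖ *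
      ((1 + ‖ξ - t‖) ^ N * ‖v (ξ - t)‖) := fun ξ => by
    refine (mul_le_mul_of_nonneg_left (norm_integral_le_integral_norm _) (by positivity)).trans ?_
    rw [← integral_const_mul]
    refine integral_mono ((hu.integrable_conv hv ξ).norm.const_mul _) (hi ξ) fun t => ?_
    have hw : 1 + ‖ξ‖ ≤ (1 + ‖t‖) * (1 + ‖ξ - t‖) := by
      have := norm_add_le t (ξ - t)
      rw [add_sub_cancel] at this
      nlinarith [norm_nonneg t, norm_nonneg (ξ - t)]
    calc (1 + ‖ξ‖) ^ N * ‖u t * v (ξ - t)‖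
        ≤ ((1 + ‖t‖) * (1 + ‖ξ - t‖)) ^ N * (‖u t‖ * ‖v (ξ - t)‖) := by
          rw [norm_mul]; gcongr
      _ = _ := by rw [mul_pow]; ring
  refine ⟨hc, ?_, (∫ t, (1 + ‖t‖) ^ N * ‖u t‖) * B, fun ξ => (hle ξ).trans ?_⟩
  · refine (hu.integrable_weight.integrable_convolution (ContinuousLinearMap.mul ℝ ℝ)
      hv.integrable_weight).mono' (by fun_prop) (Eventually.of_forall fun ξ => ?_)
    rw [Real.norm_of_nonneg (by positivity)]
    exact hle ξ
  · rw [← integral_mul_const]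
    refine integral_mono (hi ξ) (hu.integrable_weight.mul_const B) fun t => ?_
    exact mul_le_mul_of_nonneg_left (hB _) (by positivity)

theorem memLp_two_fourierInv (hu : HasDecay N u) : MemLp (𝓕⁻ u) 2 :=
  (Lp.memLp (𝓕⁻ (hu.memLp_two.toLp u) : L2)).ae_eq (lp_fourierInv_ae_eq hu.integrable hu.memLp_two)

theorem integrable_fourierInv_mul (hu : HasDecay N u) (hv : HasDecay M v) :
    Integrable fun z => 𝓕⁻ u z * 𝓕⁻ v z :=
  hu.memLp_two_fourierInv.integrable_mul hv.memLp_two_fourierInv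

theorem fourierInv_conv (hu : HasDecay N u) (hv : HasDecay M v) (z : Plane) :
    𝓕⁻ (BOZK.conv u v) z = 𝓕⁻ u z * 𝓕⁻ v z := by
  simp only [Real.fourierInv_eq_fourier_neg]
  exact Real.fourier_mul_convolution_eq hu.integrable hv.integrable (-z)

/-- The Leibniz rule on the Fourier side: ξ = t + (ξ − t) under the integral. -/
theorem coord_mul_conv (hu : HasDecay (N + 1) u) (hv : HasDecay (N + 1) v) (i : Fin 2) (ξ : Plane) :
    (ξ i : ℂ) * BOZK.conv u v ξ = BOZK.conv (fun η => (η i : ℂ) * u η) v ξ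
      + BOZK.conv u (fun η => (η i : ℂ) * v η) ξ := by
  unfold BOZK.conv
  rw [← integral_const_mul, ← integral_add ((hu.coord_mul i).integrable_conv hv ξ)
    (hu.integrable_conv (hv.coord_mul i) ξ)]
  refine integral_congr_ae (Eventually.of_forall fun t => ?_)
  simp only [PiLp.sub_apply, Complex.ofReal_sub]
  ring

theorem pow_coord_mul (hu : ∀ N, HasDecay N u) (i : Fin 2) (n : ℕ) :
    ∀ N, HasDecay N fun ξ => (ξ i : ℂ) ^ n * u ξ := by
  induction n with
  | zero => simpa using hu
  | succ n ih => intro N; simpa only [pow_succ', mul_assoc] using (ih (N + 1)).coord_mul i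

end HasDecay

theorem fourierInv_add {u v : Plane → ℂ} (hu : Integrable u) (hv : Integrable v) (z : Plane) :
    𝓕⁻ (fun ξ => u ξ + v ξ) z = 𝓕⁻ u z + 𝓕⁻ v z := by
  simp only [Real.fourierInv_eq_fourier_neg, Real.fourier_eq]
  rw [← integral_add ((Real.fourierIntegral_convergent_iff _).2 hu)
    ((Real.fourierIntegral_convergent_iff _).2 hv)]
  simp only [smul_add]

/-- Iterating the Leibniz rule reduces to n = 0, where the inverse transform is a product of two L²
functions. This gets integrability in space without any smoothness of u and v. -/
theorem integrable_fourierInv_pow_coord_mul_conv {u v : Plane → ℂ} (hu : ∀ N, HasDecay N u)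
    (hv : ∀ N, HasDecay N v) (i : Fin 2) (n : ℕ) :
    Integrable (𝓕⁻ fun ξ => (ξ i : ℂ) ^ n * conv u v ξ) := by
  induction n generalizing u v with
  | zero =>
    simp only [pow_zero, one_mul]
    exact ((hu 0).integrable_fourierInv_mul (hv 0)).congr
      (Eventually.of_forall fun z => ((hu 0).fourierInv_conv (hv 0) z).symm)
  | succ n ih =>
    have hu' := fun N => (hu (N + 1)).coord_mul i
    have hv' := fun N => (hv (N + 1)).coord_mul i
    have e : (fun ξ : Plane => (ξ i : ℂ) ^ (n + 1) * conv u v ξ) = fun ξ =>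
        (ξ i : ℂ) ^ n * conv (fun η => (η i : ℂ) * u η) v ξ
        + (ξ i : ℂ) ^ n * conv u (fun η => (η i : ℂ) * v η) ξ := by
      ext ξ
      rw [pow_succ, mul_assoc, (hu 1).coord_mul_conv (hv 1), mul_add]
    rw [e]
    refine ((ih hu' hv).add (ih hu hv')).congr (Eventually.of_forall fun z => ?_)
    exact (fourierInv_add
      (HasDecay.pow_coord_mul (fun N => (hu' N).conv (hv N)) i n 0).integrable
      (HasDecay.pow_coord_mul (fun N => (hu N).conv (hv' N)) i n 0).integrable z).symm

/-- If all the functions `𝓕⁻ (ξ_i^m W)` are integrable, so is `𝓕⁻ ((1 + (2π ξ_i)²)^n W)`. -/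
theorem integrable_fourierInv_bessel_pow_mul {W : Plane → ℂ} (i : Fin 2) (n : ℕ)
    (hW : ∀ N, HasDecay N W) (h : ∀ m, Integrable (𝓕⁻ fun ξ => (ξ i : ℂ) ^ m * W ξ)) :
    (∀ N, HasDecay N fun ξ => (((1 + (2 * Real.pi * ξ i) ^ 2) ^ n : ℝ) : ℂ) * W ξ) ∧
    Integrable (𝓕⁻ fun ξ => (((1 + (2 * Real.pi * ξ i) ^ 2) ^ n : ℝ) : ℂ) * W ξ) := by
  induction n generalizing W with
  | zero => simpa using ⟨hW, by simpa using h 0⟩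
  | succ n ih =>
    have hd : ∀ m N, HasDecay N fun ξ => (ξ i : ℂ) ^ m * W ξ :=
      HasDecay.pow_coord_mul hW i
    set a : ℂ := (2 * Real.pi) ^ 2
    -- One Bessel factor is absorbed into W, which becomes W + (2π)² ξ_i² W and satisfies the same
    -- hypotheses.
    have e : ∀ m, (fun ξ : Plane => (ξ i : ℂ) ^ m * (W ξ + a * ((ξ i : ℂ) ^ 2 * W ξ)))
        = fun ξ => (ξ i : ℂ) ^ m * W ξ + a * ((ξ i : ℂ) ^ (m + 2) * W ξ) := fun m => by
      ext ξ; ring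
    have hW' : ∀ N, HasDecay N fun ξ => W ξ + a * ((ξ i : ℂ) ^ 2 * W ξ) :=
      fun N => (hW N).add ((hd 2 N).const_mul a)
    have e2 : (fun ξ : Plane => (((1 + (2 * Real.pi * ξ i) ^ 2) ^ (n + 1) : ℝ) : ℂ) * W ξ)
        = fun ξ => (((1 + (2 * Real.pi * ξ i) ^ 2) ^ n : ℝ) : ℂ)
          * (W ξ + a * ((ξ i : ℂ) ^ 2 * W ξ)) := by
      ext ξ; push_cast; simp only [a]; ring
    rw [e2]
    refine ih hW' fun m => ?_
    rw [e]
    refine ((h m).add ((h (m + 2)).const_mul a)).congr (Eventually.of_forall fun z => ?_)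
    rw [fourierInv_add (hd m 0).integrable ((hd (m + 2) 0).const_mul a).integrable]
    simp only [Pi.add_apply, Real.fourierInv_eq]
    rw [← integral_const_mul]
    simp only [mul_smul_comm]

/-- Convolution powers: `convPow u n` is the convolution of `n + 1` copies of `u`. -/
noncomputable def convPow (u : Plane → ℂ) : ℕ → Plane → ℂ
  | 0 => u
  | n + 1 => conv u (convPow u n)

theorem HasDecay.convPow {N : ℕ} {u : Plane → ℂ} (hu : HasDecay N u) (n : ℕ) :
    HasDecay N (convPow u n) := by
  induction n with
  | zero => exact hu
  | succ n ih => exact hu.conv ih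

theorem HasDecay.fourierInv_convPow {N : ℕ} {u : Plane → ℂ} (hu : HasDecay N u) (n : ℕ) (z : Plane) :
    𝓕⁻ (BOZK.convPow u n) z = 𝓕⁻ u z ^ (n + 1) := by
  induction n with
  | zero => simp [BOZK.convPow]
  | succ n ih => rw [BOZK.convPow, hu.fourierInv_conv (hu.convPow n), ih]; ring

/-! ### Multipliers that are Fourier transforms of finite measures -/

/-- A multiplier that is an average of characters preserves the integrability of the inverse
Fourier transform. -/
theorem integrable_fourierInv_average_mul {Ω : Type*} [MeasurableSpace Ω] {P : Measure Ω}
    [SigmaFinite P] {h : Ω → ℂ} (hh : Integrable h P) {τ : Ω → Plane} (hτ : Measurable τ)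
    {U : Plane → ℂ} (hU : Integrable U) (hU' : Integrable (𝓕⁻ U)) :
    Integrable (𝓕⁻ fun ξ => (∫ w, h w * Complex.exp ((2 * Real.pi * inner ℝ (τ w) ξ : ℝ) * Complex.I) ∂P)
      * U ξ) := by
  have hcont := continuous_fourierInv hU
  -- Multiplying U by a character translates its inverse transform, so the product corresponds to an
  -- average of translates. All translates have the same L¹ norm, and h is integrable.
  have e : ∀ z, (𝓕⁻ fun ξ => (∫ w, h w * Complex.exp ((2 * Real.pi * inner ℝ (τ w) ξ : ℝ) * Complex.I) ∂P)
      * U ξ) z = ∫ w, h w * 𝓕⁻ U (z + τ w) ∂P := fun z => by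
    have h1 : ∀ w, h w * 𝓕⁻ U (z + τ w) = ∫ ξ, h w *
        (Complex.exp ((2 * Real.pi * inner ℝ ξ z : ℝ) * Complex.I) *
          (Complex.exp ((2 * Real.pi * inner ℝ (τ w) ξ : ℝ) * Complex.I) * U ξ)) := fun w => by
      rw [Real.fourierInv_eq', integral_const_mul]
      congr 1
      refine integral_congr_ae (Eventually.of_forall fun ξ => ?_)
      simp only [smul_eq_mul]
      rw [← mul_assoc, ← Complex.exp_add, inner_add_right, real_inner_comm ξ (τ w)]
      congr 2
      push_cast; ring
    simp_rw [h1]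
    rw [integral_integral_swap, Real.fourierInv_eq']
    · refine integral_congr_ae (Eventually.of_forall fun ξ => ?_)
      simp only [smul_eq_mul]
      rw [← integral_mul_const, ← integral_const_mul]
      refine integral_congr_ae (Eventually.of_forall fun w => ?_)
      simp only
      ring
    · have h2 := (hh.mul_prod hU)
      refine h2.mono ?_ (Eventually.of_forall fun x => ?_)
      · have a1 : AEStronglyMeasurable (fun x : Ω × Plane => h x.1) (P.prod volume) :=
          hh.aestronglyMeasurable.comp_fst
        have a2 : AEStronglyMeasurable (fun x : Ω × Plane => U x.2) (P.prod volume) :=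
          hU.aestronglyMeasurable.comp_snd
        have a3 : Measurable fun x : Ω × Plane =>
          Complex.exp ((2 * Real.pi * inner ℝ x.2 z : ℝ) * Complex.I) := by fun_prop
        have a4 : Measurable fun x : Ω × Plane =>
          Complex.exp ((2 * Real.pi * inner ℝ (τ x.1) x.2 : ℝ) * Complex.I) := by fun_prop
        exact a1.mul (a3.aestronglyMeasurable.mul (a4.aestronglyMeasurable.mul a2))
      · simp only [Function.uncurry, norm_mul, Complex.norm_exp_ofReal_mul_I, one_mul, le_refl]
  have hint : Integrable (fun x : Plane × Ω => h x.2 * 𝓕⁻ U (x.1 + τ x.2)) (volume.prod P) := by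
    have hm : AEStronglyMeasurable (fun x : Plane × Ω => h x.2 * 𝓕⁻ U (x.1 + τ x.2))
        (volume.prod P) := by
      have a1 : AEStronglyMeasurable (fun x : Plane × Ω => h x.2) (volume.prod P) :=
        hh.aestronglyMeasurable.comp_snd
      have a2 : Measurable fun x : Plane × Ω => 𝓕⁻ U (x.1 + τ x.2) :=
        hcont.measurable.comp (by fun_prop)
      exact a1.mul a2.aestronglyMeasurable
    rw [integrable_prod_iff' hm]
    refine ⟨Eventually.of_forall fun w => (hU'.comp_add_right (τ w)).const_mul (h w), ?_⟩
    simp_rw [norm_mul, integral_const_mul]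
    simp_rw [integral_add_right_eq_self (fun z => ‖𝓕⁻ U z‖)]
    exact hh.norm.mul_const _
  exact hint.integral_prod_left.congr (Eventually.of_forall fun z => (e z).symm)

/-- Fourier inversion for e^{−2π|ξ|}, whose transform, computed on the two half-lines, is the Cauchy
density. -/
theorem integral_cauchy_exp (y : ℝ) :
    ∫ x : ℝ, ((Real.pi⁻¹ * (1 + x ^ 2)⁻¹ : ℝ) : ℂ) * Complex.exp ((2 * Real.pi * x * y : ℝ) * Complex.I)
      = (Real.exp (-(2 * Real.pi * |y|)) : ℝ) := by
  set g : ℝ → ℂ := fun ξ => (Real.exp (-(2 * Real.pi * |ξ|)) : ℝ)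
  have hgc : Continuous g := by fun_prop
  have hpi := Real.pi_pos
  have hr : ∀ x : ℝ, ((-(2 * Real.pi) * (1 + x * Complex.I) : ℂ)).re < 0 := fun x => by
    simp; positivity
  have hl : ∀ x : ℝ, 0 < ((2 * Real.pi * (1 - x * Complex.I) : ℂ)).re := fun x => by
    simp [hpi]
  have er : ∀ x : ℝ, Set.EqOn (fun ξ : ℝ => Complex.exp ((-(2 * Real.pi) * (1 + x * Complex.I)) * ξ))
      (fun ξ => Complex.exp ((-2 * Real.pi * ξ * x : ℝ) * Complex.I) * g ξ) (Set.Ioi 0) :=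
    fun x ξ hξ => by
      simp only [g, abs_of_pos (Set.mem_Ioi.1 hξ), Complex.ofReal_exp, ← Complex.exp_add]
      congr 1; push_cast; ring
  have el : ∀ x : ℝ, Set.EqOn (fun ξ : ℝ => Complex.exp ((2 * Real.pi * (1 - x * Complex.I)) * ξ))
      (fun ξ => Complex.exp ((-2 * Real.pi * ξ * x : ℝ) * Complex.I) * g ξ) (Set.Iic 0) :=
    fun x ξ hξ => by
      simp only [g, abs_of_nonpos (Set.mem_Iic.1 hξ), Complex.ofReal_exp, ← Complex.exp_add]
      congr 1; push_cast; ring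
  have ir := fun x => (integrableOn_exp_mul_complex_Ioi (hr x) 0).congr_fun (er x) measurableSet_Ioi
  have il := fun x => (integrableOn_exp_mul_complex_Iic (hl x) 0).congr_fun (el x) measurableSet_Iic
  have hgi : Integrable g := by
    have := (il 0).union (ir 0)
    rw [Set.Iic_union_Ioi, integrableOn_univ] at this
    simpa using this
  have hF : 𝓕 g = fun x : ℝ => ((Real.pi⁻¹ * (1 + x ^ 2)⁻¹ : ℝ) : ℂ) := by
    ext x
    rw [Real.fourier_real_eq_integral_exp_smul]
    simp only [smul_eq_mul]
    rw [← intervalIntegral.integral_Iic_add_Ioi (il x) (ir x),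
      ← setIntegral_congr_fun measurableSet_Iic (el x),
      ← setIntegral_congr_fun measurableSet_Ioi (er x),
      integral_exp_mul_complex_Iic (hl x), integral_exp_mul_complex_Ioi (hr x)]
    have hp : (Real.pi : ℂ) ≠ 0 := by exact_mod_cast hpi.ne'
    have h1 : (1 + x * Complex.I : ℂ) ≠ 0 := fun h => by simpa using congrArg Complex.re h
    have h2 : (1 - x * Complex.I : ℂ) ≠ 0 := fun h => by simpa using congrArg Complex.re h
    have h3 : (1 + x ^ 2 : ℂ) = (1 + x * Complex.I) * (1 - x * Complex.I) := by
      ring_nf; simp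
    push_cast
    rw [h3]
    simp only [mul_zero, Complex.exp_zero]
    field_simp
    ring
  have hFi : Integrable (𝓕 g) := by
    rw [hF]
    exact (integrable_inv_one_add_sq.const_mul _).ofReal
  have := congrFun (hgc.fourierInv_fourier_eq hgi hFi) y
  rw [hF, Real.fourierInv_eq'] at this
  rw [show ((Real.exp (-(2 * Real.pi * |y|)) : ℝ) : ℂ) = g y from rfl, ← this]
  refine integral_congr_ae (Eventually.of_forall fun x => ?_)
  simp only [smul_eq_mul, RCLike.inner_apply, conj_trivial]
  rw [mul_comm]
  congr 3
  push_cast; ring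

/-- The characteristic function of the standard Gaussian; the scale √(2t) produces variance 2t,
hence the exponent t(2πy)². -/
theorem integral_gaussian_exp {t : ℝ} (ht : 0 ≤ t) (y : ℝ) :
    ∫ x : ℝ, Complex.exp ((2 * Real.pi * (√(2 * t) * x * y) : ℝ) * Complex.I)
        ∂(ProbabilityTheory.gaussianReal 0 1)
      = (Real.exp (-(t * (2 * Real.pi * y) ^ 2)) : ℝ) := by
  have h := ProbabilityTheory.charFun_gaussianReal (μ := 0) (v := 1) (2 * Real.pi * √(2 * t) * y)
  rw [charFun_apply_real] at h
  have hs : ((√(2 * t) : ℝ) : ℂ) ^ 2 = 2 * t := by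
    rw [← Complex.ofReal_pow, Real.sq_sqrt (by positivity)]; push_cast; ring
  rw [Complex.ofReal_exp]
  convert h using 2
  · ext x; congr 1; push_cast; ring
  · push_cast
    linear_combination (2 * Real.pi ^ 2 * y ^ 2 : ℂ) * hs

theorem inner_single_one (i : Fin 2) (a : ℝ) (ξ : Plane) :
    inner ℝ (a • EuclideanSpace.single i (1 : ℝ) : Plane) ξ = a * ξ i := by
  rw [real_inner_smul_left, EuclideanSpace.inner_single_left]; simp

theorem integrable_mul_exp_inner {Ω : Type*} [MeasurableSpace Ω] {P : Measure Ω} {h : Ω → ℂ}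
    (hh : Integrable h P) {τ : Ω → Plane} (hτ : Measurable τ) (ξ : Plane) :
    Integrable (fun w => h w * Complex.exp ((2 * Real.pi * inner ℝ (τ w) ξ : ℝ) * Complex.I)) P :=
  hh.mul_bdd (c := 1) (by fun_prop)
    (Eventually.of_forall fun w => (Complex.norm_exp_ofReal_mul_I _).le)

/-- Write 1/a = ∫₀^∞ e^{−ta} dt. The factor e^{−t|α||2πξ₀|} is the characteristic function of a
Cauchy variable and e^{−t(2πξ₁)²} that of a Gaussian, so 1/a is an average of characters; e^{−t|c|}
makes the total mass finite. -/
theorem integrable_fourierInv_inv_symbol_mul {c : ℝ} (hc : c ≠ 0) (α : ℝ) {U : Plane → ℂ}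
    (hU : Integrable U) (hU' : Integrable (𝓕⁻ U)) :
    Integrable (𝓕⁻ fun ξ => (((symbol c α ξ)⁻¹ : ℝ) : ℂ) * U ξ) := by
  set γ := ProbabilityTheory.gaussianReal 0 1
  set h : ℝ × ℝ × ℝ → ℂ := fun w => (Real.exp (-(|c| * w.1)) : ℝ) *
    (((Real.pi⁻¹ * (1 + w.2.1 ^ 2)⁻¹ : ℝ) : ℂ) * 1)
  -- The components of w are the time t, a Cauchy variable to be scaled by |α|t, and a Gaussian one
  -- to be scaled by √(2t).
  set τ : ℝ × ℝ × ℝ → Plane := fun w => (|α| * w.1 * w.2.1) • EuclideanSpace.single 0 (1 : ℝ)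
    + (√(2 * w.1) * w.2.2) • EuclideanSpace.single 1 (1 : ℝ)
  have hτ : Measurable τ := by fun_prop
  have hcp : 0 < |c| := abs_pos.2 hc
  have hh : Integrable h ((volume.restrict (Set.Ioi 0)).prod (volume.prod γ)) := by
    refine Integrable.mul_prod (f := fun t : ℝ => ((Real.exp (-(|c| * t)) : ℝ) : ℂ))
      (g := fun w : ℝ × ℝ => ((Real.pi⁻¹ * (1 + w.1 ^ 2)⁻¹ : ℝ) : ℂ) * 1) ?_
      (Integrable.mul_prod (f := fun x : ℝ => ((Real.pi⁻¹ * (1 + x ^ 2)⁻¹ : ℝ) : ℂ))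
        (g := fun _ : ℝ => (1 : ℂ)) ?_ (integrable_const _))
    · have := integrableOn_exp_mul_Ioi (neg_lt_zero.2 hcp) 0
      simp only [neg_mul] at this
      exact Integrable.ofReal this
    · exact (integrable_inv_one_add_sq.const_mul _).ofReal
  have e : ∀ ξ, (((symbol c α ξ)⁻¹ : ℝ) : ℂ) = ∫ w, h w *
      Complex.exp ((2 * Real.pi * inner ℝ (τ w) ξ : ℝ) * Complex.I)
        ∂((volume.restrict (Set.Ioi 0)).prod (volume.prod γ)) := fun ξ => by
    rw [integral_prod _ (integrable_mul_exp_inner hh hτ ξ)]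
    have h1 : ∀ t ∈ Set.Ioi (0 : ℝ), ∫ w : ℝ × ℝ, h (t, w) *
        Complex.exp ((2 * Real.pi * inner ℝ (τ (t, w)) ξ : ℝ) * Complex.I) ∂(volume.prod γ)
        = (Real.exp (-(symbol c α ξ) * t) : ℝ) := fun t ht => by
      have ht : 0 < t := ht
      have h2 : ∀ w : ℝ × ℝ, h (t, w) *
        Complex.exp ((2 * Real.pi * inner ℝ (τ (t, w)) ξ : ℝ) * Complex.I)
        = (Real.exp (-(|c| * t)) : ℝ) * ((((Real.pi⁻¹ * (1 + w.1 ^ 2)⁻¹ : ℝ) : ℂ) *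
            Complex.exp ((2 * Real.pi * w.1 * (|α| * t * ξ 0) : ℝ) * Complex.I)) *
          Complex.exp ((2 * Real.pi * (√(2 * t) * w.2 * ξ 1) : ℝ) * Complex.I)) := fun w => by
        simp only [h, τ, inner_add_left, inner_single_one]
        rw [mul_assoc (((Real.pi⁻¹ * (1 + w.1 ^ 2)⁻¹ : ℝ) : ℂ)), ← Complex.exp_add]
        rw [mul_assoc, mul_one]
        congr 3
        push_cast; ring
      simp_rw [h2]
      rw [integral_const_mul, integral_prod_mul (fun x : ℝ => ((Real.pi⁻¹ * (1 + x ^ 2)⁻¹ : ℝ) : ℂ) *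
            Complex.exp ((2 * Real.pi * x * (|α| * t * ξ 0) : ℝ) * Complex.I))
          (fun x : ℝ => Complex.exp ((2 * Real.pi * (√(2 * t) * x * ξ 1) : ℝ) * Complex.I)),
        integral_cauchy_exp, integral_gaussian_exp ht.le, ← Complex.ofReal_mul,
        ← Complex.ofReal_mul, ← Real.exp_add, ← Real.exp_add]
      congr 2
      rw [abs_mul, abs_mul, abs_abs, abs_of_pos ht, symbol, abs_mul, abs_of_pos Real.two_pi_pos]
      ring
    rw [setIntegral_congr_fun measurableSet_Ioi h1, integral_complex_ofReal,
      integral_exp_mul_Ioi (neg_lt_zero.2 (symbol_pos hc α ξ))]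
    simp
  simp_rw [e]
  exact integrable_fourierInv_average_mul hh hτ hU hU'

/-- The Gamma integral represents B^{−s} as an average of e^{−tB} with B = 1 + (2πξ_i)², and
e^{−t(2πξ_i)²} is an average of characters by the Gaussian formula. -/
theorem integrable_fourierInv_bessel_neg_mul (i : Fin 2) {s : ℝ} (hs : 0 < s) {U : Plane → ℂ}
    (hU : Integrable U) (hU' : Integrable (𝓕⁻ U)) :
    Integrable (𝓕⁻ fun ξ => (((1 + (2 * Real.pi * ξ i) ^ 2) ^ (-s) : ℝ) : ℂ) * U ξ) := by
  set γ := ProbabilityTheory.gaussianReal 0 1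
  have hg := Real.Gamma_pos_of_pos hs
  set h : ℝ × ℝ → ℂ := fun w => (((Real.Gamma s)⁻¹ * (w.1 ^ (s - 1) * Real.exp (-(1 * w.1))) : ℝ) : ℂ) * 1
  set τ : ℝ × ℝ → Plane := fun w => (√(2 * w.1) * w.2) • EuclideanSpace.single i (1 : ℝ)
  have hτ : Measurable τ := by fun_prop
  have hh : Integrable h ((volume.restrict (Set.Ioi 0)).prod γ) := by
    refine Integrable.mul_prod (f := fun t : ℝ =>
        (((Real.Gamma s)⁻¹ * (t ^ (s - 1) * Real.exp (-(1 * t))) : ℝ) : ℂ))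
      (g := fun _ : ℝ => (1 : ℂ)) (Integrable.ofReal (Integrable.const_mul ?_ _)) (integrable_const _)
    -- A function that is not integrable has integral 0 by convention, but the Gamma integral is
    -- positive.
    by_contra hn
    have := integral_undef hn
    rw [Real.integral_rpow_mul_exp_neg_mul_Ioi hs one_pos] at this
    simp [hg.ne'] at this
  have e : ∀ ξ : Plane, (((1 + (2 * Real.pi * ξ i) ^ 2) ^ (-s) : ℝ) : ℂ) = ∫ w, h w *
      Complex.exp ((2 * Real.pi * inner ℝ (τ w) ξ : ℝ) * Complex.I)
        ∂((volume.restrict (Set.Ioi 0)).prod γ) := fun ξ => by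
    have hb : 0 < 1 + (2 * Real.pi * ξ i) ^ 2 := by positivity
    rw [integral_prod _ (integrable_mul_exp_inner hh hτ ξ)]
    have h1 : ∀ t ∈ Set.Ioi (0 : ℝ), ∫ w : ℝ, h (t, w) *
        Complex.exp ((2 * Real.pi * inner ℝ (τ (t, w)) ξ : ℝ) * Complex.I) ∂γ
        = (((Real.Gamma s)⁻¹ * (t ^ (s - 1) *
            Real.exp (-((1 + (2 * Real.pi * ξ i) ^ 2) * t))) : ℝ) : ℂ) := fun t ht => by
      have ht : 0 < t := ht
      simp only [h, τ, inner_single_one]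
      rw [integral_const_mul, integral_gaussian_exp ht.le, mul_one, ← Complex.ofReal_mul,
        mul_assoc, mul_assoc, ← Real.exp_add]
      congr 4
      ring_nf
    rw [setIntegral_congr_fun measurableSet_Ioi h1, integral_complex_ofReal, integral_const_mul,
      Real.integral_rpow_mul_exp_neg_mul_Ioi hs hb, Real.rpow_neg hb.le, one_div, Real.inv_rpow hb.le]
    congr 1
    field_simp
  simp_rw [e]
  exact integrable_fourierInv_average_mul hh hτ hU hU'

/-! ### Bessel derivatives and regularity for integer powers -/

theorem memLp_of_integrable_of_bounded {g : Plane → ℝ} (hg : Integrable g) {C : ℝ}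
    (hC : ∀ z, ‖g z‖ ≤ C) {r : ℝ≥0∞} (hr : 1 ≤ r) : MemLp g r volume := by
  rcases eq_or_ne r ⊤ with rfl | htop
  · exact memLp_top_of_bound hg.aestronglyMeasurable C (Eventually.of_forall hC)
  have hr0 : r ≠ 0 := (zero_lt_one.trans_le hr).ne'
  have h1 : 1 ≤ r.toReal := by
    rw [← ENNReal.toReal_one]; exact ENNReal.toReal_mono htop hr
  rw [← integrable_norm_rpow_iff hg.aestronglyMeasurable hr0 htop]
  refine (hg.norm.const_mul (C ^ (r.toReal - 1))).mono'
    ((hg.aestronglyMeasurable.norm.aemeasurable.pow_const _).aestronglyMeasurable)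
    (Eventually.of_forall fun z => ?_)
  have hz := norm_nonneg (g z)
  rw [Real.norm_of_nonneg (Real.rpow_nonneg hz _)]
  calc ‖g z‖ ^ r.toReal = ‖g z‖ ^ (r.toReal - 1) * ‖g z‖ := by
        rw [← Real.rpow_add_one' hz (by linarith), sub_add_cancel]
    _ ≤ _ := mul_le_mul_of_nonneg_right (Real.rpow_le_rpow hz (hC z) (by linarith)) hz

/-- The Fourier transform of a real-valued function is hermitian. -/
theorem conj_fourier_ofReal (f : Plane → ℝ) (ξ : Plane) :
    starRingEnd ℂ (𝓕 (fun z => (f z : ℂ)) ξ) = 𝓕 (fun z => (f z : ℂ)) (-ξ) := by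
  rw [Real.fourier_eq', Real.fourier_eq', ← integral_conj]
  refine integral_congr_ae (Eventually.of_forall fun z => ?_)
  simp only [smul_eq_mul, map_mul, ← Complex.exp_conj, Complex.conj_ofReal, Complex.conj_I,
    inner_neg_right]
  congr 2; push_cast; ring

/-- The inverse Fourier transform of a hermitian function is real-valued. -/
theorem ofReal_re_fourierInv {G : Plane → ℂ} (hG : ∀ ξ, starRingEnd ℂ (G ξ) = G (-ξ)) (z : Plane) :
    (((𝓕⁻ G z).re : ℝ) : ℂ) = 𝓕⁻ G z := by
  rw [← Complex.conj_eq_iff_re, Real.fourierInv_eq', ← integral_conj,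
    ← integral_neg_eq_self (fun ξ => Complex.exp (↑(2 * Real.pi * inner ℝ ξ z) * Complex.I) • G ξ)]
  refine integral_congr_ae (Eventually.of_forall fun ξ => ?_)
  simp only [smul_eq_mul, map_mul, ← Complex.exp_conj, Complex.conj_ofReal, Complex.conj_I,
    inner_neg_left, hG]
  congr 2; push_cast; ring

theorem HasDecay.fourier_fourierInv {N : ℕ} {u : Plane → ℂ} (hu : HasDecay N u)
    (hi : Integrable (𝓕⁻ u)) : 𝓕 (𝓕⁻ u) = u := by
  refine hu.continuous.fourier_fourierInv_eq hu.integrable ?_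
  have := hi.comp_neg
  simpa only [Real.fourierInv_eq_fourier_neg, neg_neg] using this

/-- If `f` is the inverse Fourier transform of `u`, its Bessel derivative is the inverse transform
of the symbol of the Bessel derivative times `u`. -/
theorem hasBesselD_of_fourierInv {f g : Plane → ℝ} {u : Plane → ℂ} (hu : HasDecay 0 u)
    (hi : Integrable (𝓕⁻ u)) (hf : ∀ᵐ z, (f z : ℂ) = 𝓕⁻ u z) (i : Fin 2) (s : ℝ)
    (hs : Integrable fun ξ : Plane => (((1 + (2 * Real.pi * ξ i) ^ 2) ^ (s / 2) : ℝ) : ℂ) * u ξ)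
    (hg : ∀ z, (g z : ℂ)
      = 𝓕⁻ (fun ξ : Plane => (((1 + (2 * Real.pi * ξ i) ^ 2) ^ (s / 2) : ℝ) : ℂ) * u ξ) z)
    (hv : ∀ v : 𝓢(Plane, ℂ), Integrable fun ξ : Plane =>
      (((1 + (2 * Real.pi * ξ i) ^ 2) ^ (s / 2) : ℝ) : ℂ) * 𝓕 (v : Plane → ℂ) ξ) :
    HasBesselD i s f g := by
  intro v
  have h1 : ∫ z, (f z : ℂ) * besselD i s v z = ∫ z, 𝓕⁻ u z * besselD i s v z :=
    integral_congr_ae (by filter_upwards [hf] with z hz; rw [hz])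
  rw [h1, besselD]
  simp_rw [hg]
  rw [integral_fourierInv_mul_eq hs v.integrable, ← integral_fourierInv_mul_eq hi (hv v)]
  -- Two inverse transforms give a reflection, which is harmless because the Bessel symbol is even.
  have h2 : ∀ ξ, 𝓕⁻ (𝓕⁻ u) ξ = u (-ξ) := fun ξ => by
    rw [Real.fourierInv_eq_fourier_neg, hu.fourier_fourierInv hi]
  simp_rw [h2]
  rw [← integral_neg_eq_self]
  refine integral_congr_ae (Eventually.of_forall fun ξ => ?_)
  simp only [neg_neg, PiLp.neg_apply, mul_neg, neg_sq, Real.fourierInv_eq_fourier_neg (v : Plane → ℂ)]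
  ring

theorem one_le_besselSymbol (i : Fin 2) (ξ : Plane) : 1 ≤ 1 + (2 * Real.pi * ξ i) ^ 2 :=
  le_add_of_nonneg_right (sq_nonneg _)

theorem continuous_besselSymbol_rpow (i : Fin 2) (s : ℝ) :
    Continuous fun ξ : Plane => (1 + (2 * Real.pi * ξ i) ^ 2) ^ s :=
  Continuous.rpow_const (by fun_prop) fun ξ =>
    Or.inl (zero_lt_one.trans_le (one_le_besselSymbol i ξ)).ne'

theorem integrable_besselSymbol_mul_fourier (i : Fin 2) (k : ℕ) (v : 𝓢(Plane, ℂ)) :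
    Integrable fun ξ : Plane =>
      (((1 + (2 * Real.pi * ξ i) ^ 2) ^ ((k : ℝ) / 2) : ℝ) : ℂ) * 𝓕 (v : Plane → ℂ) ξ := by
  have hg : (fun ξ : Plane => (1 + (2 * Real.pi * ξ i) ^ 2) ^ k).HasTemperateGrowth := by
    have h1 : (fun ξ : Plane => ξ i).HasTemperateGrowth :=
      (EuclideanSpace.proj i : Plane →L[ℝ] ℝ).hasTemperateGrowth
    fun_prop
  have hi := (SchwartzMap.smulLeftCLM ℂ (fun ξ : Plane => (1 + (2 * Real.pi * ξ i) ^ 2) ^ k)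
    (𝓕 v)).integrable (μ := volume)
  have hc := continuous_besselSymbol_rpow i ((k : ℝ) / 2)
  have hv := continuous_fourier v.integrable
  refine hi.mono (by fun_prop) (Eventually.of_forall fun ξ => ?_)
  have hB := one_le_besselSymbol i ξ
  rw [SchwartzMap.smulLeftCLM_apply_apply hg, norm_mul, norm_smul, Complex.norm_real,
    SchwartzMap.fourier_coe]
  refine mul_le_mul_of_nonneg_right ?_ (norm_nonneg _)
  rw [Real.norm_of_nonneg (by positivity), Real.norm_of_nonneg (by positivity), ← Real.rpow_natCast _ k]
  exact Real.rpow_le_rpow_of_exponent_le hB (by linarith [(Nat.cast_nonneg k : (0 : ℝ) ≤ k)])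

/-- Bootstrap: convolution powers keep N weights, the inverse symbol adds one, and the equation
returns this gain to u. -/
theorem HasDecay.forall_of_eq_convPow {c α : ℝ} (hc : c ≠ 0) (hα : α ≠ 0) {u : Plane → ℂ}
    (h0 : HasDecay 0 u) {κ : ℂ} {p : ℕ}
    (h : ∀ ξ, u ξ = κ * ((((symbol c α ξ)⁻¹ : ℝ) : ℂ) * BOZK.convPow u p ξ)) (N : ℕ) :
    HasDecay N u := by
  induction N with
  | zero => exact h0
  | succ N ih =>
    rw [show u = fun ξ => κ * ((((symbol c α ξ)⁻¹ : ℝ) : ℂ) * BOZK.convPow u p ξ) from funext h]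
    exact ((ih.convPow p).inv_symbol_mul hc hα).const_mul κ

/-- For a solution of `a u = κ u^{*(p+1)}`, the functions `𝓕⁻ ((1 + (2π ξ_i)²)^{k/2} u)` are
integrable. -/
theorem integrable_fourierInv_besselSymbol_mul {c α : ℝ} (hc : c ≠ 0) (hα : α ≠ 0)
    {u : Plane → ℂ} (hu : ∀ N, HasDecay N u) {κ : ℂ} {p : ℕ} (hp : 0 < p)
    (h : ∀ ξ, u ξ = κ * ((((symbol c α ξ)⁻¹ : ℝ) : ℂ) * convPow u p ξ)) (i : Fin 2) (k : ℕ) :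
    Integrable (fun ξ : Plane => (((1 + (2 * Real.pi * ξ i) ^ 2) ^ ((k : ℝ) / 2) : ℝ) : ℂ) * u ξ) ∧
    Integrable (𝓕⁻ fun ξ : Plane =>
      (((1 + (2 * Real.pi * ξ i) ^ 2) ^ ((k : ℝ) / 2) : ℝ) : ℂ) * u ξ) := by
  -- With p ≥ 1 the convolution power has at least two factors, as needed to see its inverse
  -- transform as a product of two L² functions.
  obtain ⟨m, rfl⟩ : ∃ m, p = m + 1 := ⟨p - 1, by omega⟩
  obtain ⟨hd, hI⟩ := integrable_fourierInv_bessel_pow_mul i (k + 1)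
    (fun N => (hu N).convPow (m + 1))
    (integrable_fourierInv_pow_coord_mul_conv hu (fun N => (hu N).convPow m) i)
  set V : Plane → ℂ := fun ξ =>
    (((1 + (2 * Real.pi * ξ i) ^ 2) ^ (k + 1) : ℝ) : ℂ) * convPow u (m + 1) ξ
  -- The exponent k/2 is written as (k+1) − s: an integer power handled by the Leibniz rule and a
  -- negative one handled by the Gamma integral. The extra 1 keeps s positive when k = 0.
  set s : ℝ := (k : ℝ) / 2 + 1
  have hs : 0 < s := by positivity
  have hI1 := integrable_fourierInv_bessel_neg_mul i hs (hd 0).integrable hI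
  have hd1 : HasDecay 0 fun ξ => (((1 + (2 * Real.pi * ξ i) ^ 2) ^ (-s) : ℝ) : ℂ) * V ξ := by
    have h1 := continuous_besselSymbol_rpow i (-s)
    have h2 := (hd 0).continuous
    refine (hd 0).of_le (by fun_prop) (C := 1) fun ξ => ?_
    have hB := one_le_besselSymbol i ξ
    rw [norm_mul, Complex.norm_real, Real.norm_of_nonneg (by positivity), pow_zero, one_mul,
      one_mul, one_mul]
    exact mul_le_of_le_one_left (norm_nonneg _) (Real.rpow_le_one_of_one_le_of_nonpos hB (by linarith))
  have hI2 := integrable_fourierInv_inv_symbol_mul hc α hd1.integrable hI1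
  have hd2 := (hd1.inv_symbol_mul hc hα).const_mul κ
  have e : (fun ξ : Plane => (((1 + (2 * Real.pi * ξ i) ^ 2) ^ ((k : ℝ) / 2) : ℝ) : ℂ) * u ξ)
      = fun ξ => κ * ((((symbol c α ξ)⁻¹ : ℝ) : ℂ) *
        ((((1 + (2 * Real.pi * ξ i) ^ 2) ^ (-s) : ℝ) : ℂ) * V ξ)) := by
    ext ξ
    have hB := zero_lt_one.trans_le (one_le_besselSymbol i ξ)
    have h1 : (1 + (2 * Real.pi * ξ i) ^ 2) ^ ((k : ℝ) / 2)
        = (1 + (2 * Real.pi * ξ i) ^ 2) ^ (-s) * (1 + (2 * Real.pi * ξ i) ^ 2) ^ (k + 1) := by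
      rw [← Real.rpow_natCast _ (k + 1), ← Real.rpow_add hB]
      congr 1
      push_cast; ring
    conv_lhs => rw [h ξ, h1, Complex.ofReal_mul]
    simp only [V]
    ring
  rw [e]
  refine ⟨hd2.integrable, (hI2.const_mul κ).congr (Eventually.of_forall fun z => ?_)⟩
  simp only [Real.fourierInv_eq]
  rw [← integral_const_mul]
  simp only [mul_smul_comm]

/-- The Fourier transform of a solitary wave with an integer power solves a convolution equation. -/
theorem IsSolitaryWave.exists_convolution_eq {c α ε : ℝ} (hε : ε = 1 ∨ ε = -1) (hαε : α * ε < 0)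
    (hcα : c * α < 0) {p : ℕ} (hp : 0 < p) {φ : Plane → ℝ}
    (h : IsSolitaryWave c α ε (p : ℚ) φ) (hF : MemLp (fun z => φ z ^ (p + 1)) 2 volume) :
    ∃ (u : Plane → ℂ) (κ : ℂ), HasDecay 0 u ∧ (∀ᵐ z, (φ z : ℂ) = 𝓕⁻ u z) ∧
      (∀ ξ, starRingEnd ℂ (u ξ) = u (-ξ)) ∧
      ∀ ξ, u ξ = κ * ((((symbol c α ξ)⁻¹ : ℝ) : ℂ) * convPow u p ξ) := by
  have hα : α ≠ 0 := by rintro rfl; simp at hαε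
  have hc : c ≠ 0 := by rintro rfl; simp at hcα
  have hF' : MemLp (fun z => ((ratPow ((p : ℚ) + 1) (φ z) : ℝ) : ℂ)) 2 volume := by
    simp_rw [ratPow_natCast_add_one]
    exact hF.ofReal
  obtain ⟨κ, hκ⟩ := h.exists_fourier_eq hε hαε hcα hF'
  have hu0 := integrable_of_eq_inv_symbol_mul hc hα hκ
  obtain ⟨ψ, hψ, -, hψb, -⟩ := exists_continuous_of_integrable_fourier h.memZ.memLp hu0
  have hφ2 : MemLp φ 2 volume := by simpa using h.memZ.memLp.re
  have hφb : MemLp φ ⊤ volume := hψb.ae_eq hψ.symm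
  obtain ⟨C, hC⟩ : ∃ C : ℝ, ∀ᵐ z, ‖φ z‖ ≤ C := by
    have hf := hφb.eLpNorm_lt_top
    rw [eLpNorm_exponent_top] at hf
    refine ⟨(eLpNormEssSup φ volume).toReal, ?_⟩
    filter_upwards [ae_le_eLpNormEssSup (f := φ) (μ := volume)] with z hz
    rw [← toReal_enorm]
    exact ENNReal.toReal_mono hf.ne hz
  -- As φ is bounded, |φ|^{p+1} ≤ C^{p−1} φ², so the nonlinearity is integrable and its transform is
  -- continuous.
  have hFi : Integrable fun z => ((φ z ^ (p + 1) : ℝ) : ℂ) := by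
    refine Integrable.ofReal ?_
    refine ((hφ2.integrable_sq.norm).const_mul (C ^ (p - 1))).mono' hF.aestronglyMeasurable ?_
    filter_upwards [hC] with z hz
    have e : φ z ^ (p + 1) = φ z ^ (p - 1) * φ z ^ 2 := by rw [← pow_add]; congr 1; omega
    change ‖φ z ^ (p + 1)‖ ≤ _
    rw [e, norm_mul, norm_pow]
    gcongr
  set U : Plane → ℂ := 𝓕 fun z => ((φ z ^ (p + 1) : ℝ) : ℂ)
  set u : Plane → ℂ := fun ξ => κ * ((((symbol c α ξ)⁻¹ : ℝ) : ℂ) * U ξ)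
  have hUe : (𝓕 (hF'.toLp _) : L2) =ᵐ[volume] U := by
    have e : (fun z => ((ratPow ((p : ℚ) + 1) (φ z) : ℝ) : ℂ))
        = fun z => ((φ z ^ (p + 1) : ℝ) : ℂ) := by simp_rw [ratPow_natCast_add_one]
    have := lp_fourier_ae_eq (f := fun z => ((ratPow ((p : ℚ) + 1) (φ z) : ℝ) : ℂ))
      (by rw [e]; exact hFi) hF'
    refine this.trans (Eventually.of_forall fun ξ => ?_)
    rw [e]
  have hue : (𝓕 (h.memZ.memLp.toLp _) : L2) =ᵐ[volume] u := by
    filter_upwards [hκ, hUe] with ξ h1 h2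
    rw [h1, h2, mul_assoc]
  have hUc : Continuous U := continuous_fourier hFi
  have hsc : Continuous fun ξ => (symbol c α ξ)⁻¹ :=
    (continuous_symbol c α).inv₀ fun ξ => (symbol_pos hc α ξ).ne'
  have hu : HasDecay 0 u := by
    have hcont : Continuous u := by fun_prop
    refine ⟨hcont, by simpa using (hu0.congr hue).norm, ‖(κ : ℂ)‖ * (|c|⁻¹ * ∫ z, ‖((φ z ^ (p + 1) : ℝ) : ℂ)‖), fun ξ => ?_⟩
    rw [pow_zero, one_mul, norm_mul, norm_mul, Complex.norm_real (symbol c α ξ)⁻¹,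
      Real.norm_of_nonneg (inv_nonneg.2 (symbol_pos hc α ξ).le)]
    have h1 : (symbol c α ξ)⁻¹ ≤ |c|⁻¹ := inv_anti₀ (abs_pos.2 hc) (le_symbol c α ξ)
    have h2 := norm_fourier_le (fun z => ((φ z ^ (p + 1) : ℝ) : ℂ)) ξ
    gcongr
  have hφu : ∀ᵐ z, (φ z : ℂ) = 𝓕⁻ u z := by
    have h1 := lp_fourierInv_ae_eq hu.integrable hu.memLp_two
    have h2 : hu.memLp_two.toLp u = (𝓕 (h.memZ.memLp.toLp _) : L2) :=
      Lp.ext (hu.memLp_two.coeFn_toLp.trans hue.symm)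
    rw [h2, FourierTransform.fourierInv_fourier_eq] at h1
    filter_upwards [h1, h.memZ.memLp.coeFn_toLp] with z a1 a2
    rw [← a1, a2]
  -- The inverse transform of the convolution power is φ^{p+1} almost everywhere; inversion applies
  -- because φ^{p+1} is integrable and the convolution power is continuous and integrable.
  have hU : U = convPow u p := by
    have e : (fun z => ((φ z ^ (p + 1) : ℝ) : ℂ)) =ᵐ[volume] 𝓕⁻ (convPow u p) := by
      filter_upwards [hφu] with z hz
      rw [hu.fourierInv_convPow, ← hz, Complex.ofReal_pow]
    rw [← (hu.convPow p).fourier_fourierInv (hFi.congr e)]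
    ext ξ
    exact integral_congr_ae (by filter_upwards [e] with z hz; rw [hz])
  refine ⟨u, κ, hu, hφu, fun ξ => ?_, fun ξ => by rw [← hU]⟩
  have hs : symbol c α (-ξ) = symbol c α ξ := by simp [symbol]
  simp only [u, U, map_mul, Complex.conj_ofReal, conj_fourier_ofReal, hs]

theorem IsSolitaryWave.memSobolevLiouville {c α ε : ℝ} (hε : ε = 1 ∨ ε = -1) (hαε : α * ε < 0)
    (hcα : c * α < 0) {p : ℕ} (hp : 0 < p) {φ : Plane → ℝ}
    (h : IsSolitaryWave c α ε (p : ℚ) φ) (hF : 4 < p → MemLp (fun z => φ z ^ (p + 1)) 2 volume)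
    (k : ℕ) {r : ℝ≥0∞} (hr : 1 ≤ r) : MemSobolevLiouville (fun _ => (k : ℝ)) r φ := by
  have hα : α ≠ 0 := by rintro rfl; simp at hαε
  have hc : c ≠ 0 := by rintro rfl; simp at hcα
  have hF2 : MemLp (fun z => φ z ^ (p + 1)) 2 volume := by
    rcases lt_or_ge 4 p with h4 | h4
    · exact hF h4
    · have := h.memLp_ratPow hε hαε hcα (by exact_mod_cast hp) (by exact_mod_cast h4)
      simpa only [ratPow_natCast_add_one] using this
  obtain ⟨u, κ, hu0, hφu, hconj, hu⟩ := h.exists_convolution_eq hε hαε hcα hp hF2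
  have key := integrable_fourierInv_besselSymbol_mul hc hα (hu0.forall_of_eq_convPow hc hα hu) hp hu
  -- Both u and its Bessel multiples are integrable with integrable inverse transforms; the latter
  -- are therefore in L¹ ∩ L^∞, hence in L^r.
  have hmem : ∀ w : Plane → ℂ, Integrable (𝓕⁻ w) →
      MemLp (fun z => (𝓕⁻ w z).re) r volume := fun w hw =>
    memLp_of_integrable_of_bounded hw.re (C := ∫ ξ, ‖w ξ‖)
      (fun z => (Complex.abs_re_le_norm _).trans (norm_fourierInv_le w z)) hr
  have hi : Integrable (𝓕⁻ u) := by simpa using (key 0 0).2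
  refine ⟨(hmem u hi).ae_eq ?_, fun i => ⟨_, hmem _ (key i k).2, ?_⟩⟩
  · filter_upwards [hφu] with z hz
    rw [← hz, Complex.ofReal_re]
  · refine hasBesselD_of_fourierInv hu0 hi hφu i k (key i k).1 (ofReal_re_fourierInv fun ξ => ?_)
      (integrable_besselSymbol_mul_fourier i k)
    simp [hconj]

end BOZK

theorem theorem4p5 (c α ε : ℝ) (hε : ε = 1 ∨ ε = -1) (hαε : α * ε < 0) (hcα : c * α < 0) :
    (∀ p : ℕ, 0 < p → ∀ φ : BOZK.Plane → ℝ, BOZK.IsSolitaryWave c α ε (p : ℚ) φ →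
      (4 < p → MemLp (fun z => φ z ^ (p + 1)) 2 volume) →
      ∀ k : ℕ, ∀ r : ℝ≥0∞, 1 ≤ r → BOZK.MemSobolevLiouville (fun _ => (k : ℝ)) r φ) ∧
    (∀ p : ℚ, 0 < p → p < 4 → Odd p.den →
      ∀ φ : BOZK.Plane → ℝ, BOZK.IsSolitaryWave c α ε p φ →
      ∃ ψ : BOZK.Plane → ℝ, φ =ᵐ[volume] ψ ∧ Continuous ψ ∧ MemLp ψ ∞ volume ∧
        Tendsto ψ (cocompact BOZK.Plane) (𝓝 0)) := by
  refine ⟨fun p hp φ h hF k r hr => h.memSobolevLiouville hε hαε hcα hp hF k hr,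
    fun p hp hp4 _ φ h => h.exists_continuous hε hαε hcα hp hp4⟩
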